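/- Let $0<\alpha<1$. For a measurable set $F\subset\mathbb R^2$ let $P(F)=\sup\{\int_F\nabla\cdot\phi\,dx:\ \phi\in C^1_c(\mathbb R^2;\mathbb R^2),\ |\phi|\le 1\}$ be its De Giorgi perimeter and $V(F)=\int_F\int_F |x-y|^{-\alpha}\,dx\,dy$. Let $V_0=V(B_1(0))$ and, for $\varepsilon>0$, put $$C_0(\alpha,\varepsilon)=\frac{\varepsilon}{2\pi}\left(V_0-\frac{\pi^{2-\alpha}}{\left(1+\frac{\varepsilon}{2\pi}V_0\right)^{\alpha}}\right),\qquad C_3(\alpha,\varepsilon)=\frac{\pi^2\alpha(2-\alpha)\Gamma(1-\alpha)}{2\,\Gamma^2\!\left(2-\frac{\alpha}{2}\right)}\left(1+\frac23\sqrt{\pi C_0(\alpha,\varepsilon)\,(C_0(\alpha,\varepsilon)+2)}\right).$$ Then there exists a unique $\varepsilon=\varepsilon_1(\alpha)>0$ solving $$\varepsilon C_3(\alpha,\varepsilon)\Big[\varepsilon C_3(\alpha,\varepsilon)C_0(\alpha,\varepsilon)\big(C_0(\alpha,\varepsilon)+2\big)+2\Big]=1.$$ Furthermore, if $0<\varepsilon<\varepsilon_1(\alpha)$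 and $\Omega_\varepsilon$ is a minimizer of $P+\varepsilon V$ among all bounded open subsets of $\mathbb R^2$ with boundary of class $C^1$ and area $\pi$, and if $\Omega_\varepsilon$ is convex, then $\Omega_\varepsilon$ is an open disk of radius $1$. -/

import Mathlib

open MeasureTheory
open scoped ENNReal ContDiff

noncomputable section

namespace RieszIsoperimetric

/-- The Euclidean plane. -/
abbrev Plane : Type := EuclideanSpace ℝ (Fin 2)

/-- The divergence of a (differentiable) vector field on the plane. -/
def divergence (φ : Plane → Plane) (x : Plane) : ℝ :=
  ∑ i : Fin 2, fderiv ℝ φ x (EuclideanSpace.single i 1) i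

/-- The perimeter in the sense of De Giorgi:
the supremum of `∫_F div φ` over the `C¹` compactly supported fields with `|φ| ≤ 1`.
Since `φ = 0` is admissible, truncating the integrals at `0` does not change the supremum. -/
def perimeter (F : Set Plane) : ℝ≥0∞ :=
  ⨆ (φ : Plane → Plane) (_ : ContDiff ℝ 1 φ) (_ : HasCompactSupport φ) (_ : ∀ x, ‖φ x‖ ≤ 1),
    ENNReal.ofReal (∫ x in F, divergence φ x)

/-- The Riesz interaction energy `∫_F ∫_F |x - y|^{-α} dx dy`. -/
def rieszEnergy (α : ℝ) (F : Set Plane) : ℝ≥0∞ :=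
  ∫⁻ y in F, ∫⁻ x in F, ENNReal.ofReal (1 / ‖x - y‖ ^ α)

/-- The energy `E_ε = P + ε V`. -/
def energy (α ε : ℝ) (F : Set Plane) : ℝ≥0∞ :=
  perimeter F + ENNReal.ofReal ε * rieszEnergy α F

/-- The boundary of the open set `Ω` is of class `C¹`: near each boundary point `p`, `Ω` is
`{ψ < 0}` for a function `ψ` which is `C¹` near `p` and has nonzero differential at `p`. -/
def HasC1Boundary (Ω : Set Plane) : Prop :=
  ∀ p ∈ frontier Ω, ∃ ψ : Plane → ℝ,
    ContDiffAt ℝ 1 ψ p ∧ fderiv ℝ ψ p ≠ 0 ∧ ∀ᶠ x in nhds p, (x ∈ Ω ↔ ψ x < 0)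

/-- The admissible sets: bounded open sets with `C¹` boundary and area `π`. -/
structure IsAdmissible (Ω : Set Plane) : Prop where
  isOpen : IsOpen Ω
  isBounded : Bornology.IsBounded Ω
  hasC1Boundary : HasC1Boundary Ω
  volume_eq : volume Ω = ENNReal.ofReal Real.pi

/-- `Ω` minimizes `E_ε` among the admissible sets. -/
structure IsMinimizer (α ε : ℝ) (Ω : Set Plane) : Prop where
  isAdmissible : IsAdmissible Ω
  energy_le : ∀ F : Set Plane, IsAdmissible F → energy α ε Ω ≤ energy α ε F

/-- `V₀(α) = V(B₁(0))`, the Riesz energy of the unit disk (finite for `α < 2`). -/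
def V₀ (α : ℝ) : ℝ := (rieszEnergy α (Metric.ball 0 1)).toReal

/-- The bound `C₀(α, ε)` on the isoperimetric deficit. -/
def C₀ (α ε : ℝ) : ℝ :=
  ε / (2 * Real.pi) *
    (V₀ α - Real.pi ^ (2 - α) / (1 + ε / (2 * Real.pi) * V₀ α) ^ α)

/-- The constant `C₃(α, ε)`. -/
def C₃ (α ε : ℝ) : ℝ :=
  Real.pi ^ 2 * α * (2 - α) * Real.Gamma (1 - α) / (2 * Real.Gamma (2 - α / 2) ^ 2) *
    (1 + 2 / 3 * Real.sqrt (Real.pi * C₀ α ε * (C₀ α ε + 2)))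

end RieszIsoperimetric

end

/-!
The proof compares a convex minimizer `Ω` with the unit disk `B` through the isoperimetric deficit
`D = P(Ω) / 2π - 1` and shows that `D` satisfies an inequality which, below the threshold, only
`D = 0` can satisfy.

*A priori bound on the deficit.* Testing minimality against `B` gives
`2π D ≤ ε (V₀ - V(Ω))` (`isAdmissible_ball`, `perimeter_ball_le`). By Cauchy's formula
(`integral_supportFn_le_perimeter`, which only needs the inequality `∫ h ≤ P` for the support
function `h`) the diameter of `Ω` is at most `P / 2`, so `V(Ω) ≥ π² / (P / 2) ^ α`, and `D ≤ C₀`.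

*Energy gap versus moment gap.* The Riesz kernel is positive definite, being a superposition of
Gaussians (`two_mul_interaction_le`); hence `V₀ - V(Ω) ≤ 2 (∫_B v - ∫_Ω v)`, where `v` is the
potential of `B`. This potential is radial and its radial derivative is at least `-L`, where
`L = diskLipschitz α` (`diskPotential_le_add`), so `v + L |x|` is at most its boundary value
inside `B` and at least that value outside. The bathtub principle yields
`V₀ - V(Ω) ≤ 2 L (∫_Ω |x - x₀| - 2π / 3)` for every centre `x₀` (`rieszEnergy_ball_add_le`). The
bound on the derivative of `v` at radius `ρ` comes from the binomial series of `(1 - z) ^ (-α / 2)`: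
its coefficients are nonnegative, so the derivative is decreasing in `ρ < 1`; its value at `ρ = 1`
is a Beta integral, and inversion takes care of `ρ > 1`.

*Moment gap versus deficit.* In polar coordinates, `3 ∫_Ω |x| ≤ ∫ h³`. After centering at the
Steiner point the support function has no Fourier modes of order one, and Wirtinger's inequality
turns the bound `π = |Ω| ≤ ½ ∫ h (h + h'')` into an `L²` bound of `h` minus its mean by
`X = D (D + 2)`, whence `∫_Ω |x - x₀| - 2π / 3 ≤ π² X (1 + ⅔ √(π X))`
(`exists_lintegral_norm_sub_le`, `cubicBound_le`). The support function need not be smooth, so the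
computation is made for smooth majorants of `h` (`exists_smooth_majorant`).

Together, `D ≤ ε C₃ X`, that is `X = D² + 2 D ≤ (κ X)² + 2 κ X` with `κ = ε C₃`. If `D > 0` then
`1 ≤ κ (κ C₀ (C₀ + 2) + 2)`, and the right side is the strictly increasing function of `ε` which
reaches `1` at `ε₁`. So `D = 0` for `ε < ε₁`, the moment of `Ω` is that of the disk, and `Ω` is a
disk (`eq_ball_of_lintegral_norm_sub_le`).
-/

namespace RieszIsoperimetric

open Real Set

/-! ### Directions and coordinates in the plane -/

/-- The unit vector `(cos θ, sin θ)`. -/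
noncomputable def dir (θ : ℝ) : Plane := !₂[cos θ, sin θ]

@[simp] lemma dir_zero_apply (θ : ℝ) : dir θ 0 = cos θ := rfl
@[simp] lemma dir_one_apply (θ : ℝ) : dir θ 1 = sin θ := rfl

lemma inner_plane (x y : Plane) : inner ℝ x y = x 0 * y 0 + x 1 * y 1 := by
  simp [PiLp.inner_apply, Fin.sum_univ_two]
  ring

lemma norm_sq_plane (x : Plane) : ‖x‖ ^ 2 = x 0 ^ 2 + x 1 ^ 2 := by
  rw [EuclideanSpace.norm_sq_eq, Fin.sum_univ_two]
  simp

lemma inner_dir (x : Plane) (θ : ℝ) : inner ℝ x (dir θ) = x 0 * cos θ + x 1 * sin θ := by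
  simp [inner_plane]

lemma inner_dir_dir (a b : ℝ) : inner ℝ (dir a) (dir b) = cos (a - b) := by
  simp [inner_plane, cos_sub]

@[simp] lemma norm_dir (θ : ℝ) : ‖dir θ‖ = 1 := by
  have h := norm_sq_plane (dir θ)
  rw [dir_zero_apply, dir_one_apply, cos_sq_add_sin_sq] at h
  exact (pow_eq_one_iff_of_nonneg (norm_nonneg _) two_ne_zero).1 h

lemma dir_add_pi (θ : ℝ) : dir (θ + π) = - dir θ := by
  ext i
  fin_cases i <;> simp [dir, cos_add_pi, sin_add_pi]

lemma dir_add_two_pi (θ : ℝ) : dir (θ + 2 * π) = dir θ := by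
  simp [dir]

lemma dir_add_dir (θ δ : ℝ) : dir (θ + δ) + dir (θ - δ) = (2 * cos δ) • dir θ := by
  ext i
  fin_cases i <;> simp [dir, cos_add, cos_sub, sin_add, sin_sub] <;> ring

lemma hasDerivAt_dir (θ : ℝ) : HasDerivAt dir (dir (θ + π / 2)) θ := by
  have h : ∀ t, dir t = cos t • dir 0 + sin t • dir (π / 2) := by
    intro t
    ext i
    fin_cases i <;> simp
  rw [h (θ + π / 2), cos_add_pi_div_two, sin_add_pi_div_two]
  exact (((hasDerivAt_cos θ).smul_const (dir 0)).add
    ((hasDerivAt_sin θ).smul_const (dir (π / 2)))).congr_of_eventuallyEq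
    (Filter.Eventually.of_forall h)

lemma continuous_dir : Continuous dir :=
  continuous_iff_continuousAt.2 fun θ => (hasDerivAt_dir θ).continuousAt

lemma exists_eq_smul_dir (x : Plane) : ∃ θ, x = ‖x‖ • dir θ := by
  set z : ℂ := ⟨x 0, x 1⟩ with hz
  have hn : ‖z‖ = ‖x‖ := by
    have h1 := norm_sq_plane x
    have h2 : ‖z‖ ^ 2 = x 0 ^ 2 + x 1 ^ 2 := by
      rw [Complex.sq_norm, Complex.normSq_apply]; simp [hz]; ring
    exact (pow_left_inj₀ (norm_nonneg _) (norm_nonneg _) two_ne_zero).1 (h2.trans h1.symm)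
  refine ⟨Complex.arg z, ?_⟩
  rw [← hn]
  ext i
  fin_cases i
  · simp [Complex.norm_mul_cos_arg, hz]
  · simp [Complex.norm_mul_sin_arg, hz]

/-- The identification of `ℝ × ℝ` with the Euclidean plane, as a measurable equivalence. -/
noncomputable def ofProd : ℝ × ℝ ≃ᵐ Plane :=
  MeasurableEquiv.finTwoArrow.symm.trans (MeasurableEquiv.toLp 2 (Fin 2 → ℝ))

lemma ofProd_apply (p : ℝ × ℝ) : ofProd p = !₂[p.1, p.2] := by
  ext i
  fin_cases i <;> rfl

lemma measurePreserving_ofProd : MeasurePreserving ofProd volume volume :=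
  (EuclideanSpace.volume_preserving_symm_measurableEquiv_toLp (Fin 2)).symm.comp
    (volume_preserving_finTwoArrow ℝ).symm

/-- The rotation by the angle `θ` of the plane. -/
noncomputable def rot (θ : ℝ) : Plane ≃ₗᵢ[ℝ] Plane :=
  LinearIsometry.toLinearIsometryEquiv
    { toFun := fun x => x 0 • dir θ + x 1 • dir (θ + π / 2)
      map_add' := fun x y => by simp only [PiLp.add_apply, add_smul]; abel
      map_smul' := fun c x => by
        simp only [PiLp.smul_apply, smul_eq_mul, mul_smul, smul_add, RingHom.id_apply]
      norm_map' := fun x => by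
        refine (pow_left_inj₀ (norm_nonneg _) (norm_nonneg _) two_ne_zero).1 ?_
        simp only [LinearMap.coe_mk, AddHom.coe_mk]
        rw [norm_sq_plane, norm_sq_plane]
        simp only [PiLp.add_apply, PiLp.smul_apply, smul_eq_mul, dir_zero_apply, dir_one_apply,
          cos_add_pi_div_two, sin_add_pi_div_two]
        linear_combination (x 0 ^ 2 + x 1 ^ 2) * sin_sq_add_cos_sq θ }
    rfl

lemma rot_apply (θ : ℝ) (x : Plane) : rot θ x = x 0 • dir θ + x 1 • dir (θ + π / 2) := rfl

lemma lintegral_rot (θ : ℝ) (f : Plane → ℝ≥0∞) : ∫⁻ x, f (rot θ x) = ∫⁻ x, f x :=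
  (rot θ).measurePreserving.lintegral_comp_emb
    (rot θ).toHomeomorph.measurableEmbedding f

/-- Fubini's theorem in the orthonormal frame `dir θ`, `dir (θ + π / 2)`. -/
lemma lintegral_eq_lintegral_frame (θ : ℝ) {f : Plane → ℝ≥0∞} (hf : Measurable f) :
    ∫⁻ x, f x = ∫⁻ t : ℝ, ∫⁻ s : ℝ, f (s • dir θ + t • dir (θ + π / 2)) := by
  rw [← lintegral_rot θ, ← measurePreserving_ofProd.lintegral_comp_emb
    ofProd.measurableEmbedding, Measure.volume_eq_prod, lintegral_prod_symm]
  · simp [ofProd_apply, rot_apply]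
  · refine Measurable.aemeasurable ?_
    exact (hf.comp (rot θ).continuous.measurable).comp ofProd.measurable

/-- Integration in polar coordinates. -/
lemma lintegral_eq_lintegral_polar {f : Plane → ℝ≥0∞} (hf : Measurable f) :
    ∫⁻ x, f x = ∫⁻ θ in Ioo (-π) π, ∫⁻ r in Ioi (0 : ℝ), ENNReal.ofReal r * f (r • dir θ) := by
  rw [← measurePreserving_ofProd.lintegral_comp_emb ofProd.measurableEmbedding,
    ← lintegral_comp_polarCoord_symm]
  have h : ∀ p : ℝ × ℝ, f (ofProd (polarCoord.symm p)) = f (p.1 • dir p.2) := by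
    intro p
    congr 1
    ext i
    fin_cases i <;> simp [ofProd_apply, dir]
  simp only [h, smul_eq_mul]
  rw [polarCoord_target, Measure.volume_eq_prod, ← Measure.prod_restrict, lintegral_prod_symm]
  refine Measurable.aemeasurable ?_
  refine (ENNReal.measurable_ofReal.comp measurable_fst).mul (hf.comp ?_)
  exact (continuous_fst.smul (continuous_dir.comp continuous_snd)).measurable

end RieszIsoperimetric

namespace RieszIsoperimetric

open Real Set Filter Topology NNReal

/-! ### The divergence theorem against Lipschitz functions and the perimeter of the disk -/

lemma sum_smul_single (v : Plane) :
    ∑ i : Fin 2, v i • (EuclideanSpace.single i (1 : ℝ) : Plane) = v := by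
  ext j
  fin_cases j <;> simp [Fin.sum_univ_two]

lemma _root_.HasCompactSupport.of_eq_zero {X E F : Type*} [TopologicalSpace X] [Zero E] [Zero F]
    {g : X → E} {f : X → F} (hg : HasCompactSupport g) (h : ∀ x, g x = 0 → f x = 0) :
    HasCompactSupport f :=
  hg.mono fun _ hx hgx => hx (h _ hgx)

lemma hasCompactSupport_apply {φ : Plane → Plane} (hc : HasCompactSupport φ) (i : Fin 2) :
    HasCompactSupport fun x => φ x i :=
  hc.comp_left (g := fun y : Plane => y i) rfl

lemma contDiff_apply_coord {φ : Plane → Plane} (hφ : ContDiff ℝ 1 φ) (i : Fin 2) :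
    ContDiff ℝ 1 fun x => φ x i := by
  fun_prop

lemma fderiv_apply_coord {φ : Plane → Plane} (hφ : ContDiff ℝ 1 φ) (i : Fin 2) (x v : Plane) :
    fderiv ℝ (fun y => φ y i) x v = fderiv ℝ φ x v i := by
  have h := ((hφ.differentiable one_ne_zero) x).hasFDerivAt
  have h2 := (EuclideanSpace.proj (𝕜 := ℝ) i).hasFDerivAt.comp x h
  have h3 : fderiv ℝ (fun y => φ y i) x = (EuclideanSpace.proj (𝕜 := ℝ) i).comp (fderiv ℝ φ x) :=
    h2.fderiv
  rw [h3]
  rfl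

lemma continuous_divergence {φ : Plane → Plane} (hφ : ContDiff ℝ 1 φ) :
    Continuous (divergence φ) := by
  unfold divergence
  refine continuous_finsetSum _ fun i _ => ?_
  have h : Continuous fun x => fderiv ℝ φ x (EuclideanSpace.single i 1) :=
    (hφ.continuous_fderiv one_ne_zero).clm_apply continuous_const
  fun_prop

lemma hasCompactSupport_divergence {φ : Plane → Plane} (hc : HasCompactSupport φ) :
    HasCompactSupport (divergence φ) := by
  exact (hc.fderiv (𝕜 := ℝ)).of_eq_zero fun x hx => by simp [divergence, hx]

/-- The divergence theorem for the product of a Lipschitz function and a `C¹` field; by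
Rademacher's theorem the Lipschitz function is differentiable almost everywhere. -/
lemma integral_mul_divergence {f : Plane → ℝ} {C : ℝ≥0} (hf : LipschitzWith C f)
    {φ : Plane → Plane} (hφ : ContDiff ℝ 1 φ) (hc : HasCompactSupport φ) :
    ∫ x, f x * divergence φ x = - ∫ x, fderiv ℝ f x (φ x) := by
  have key : ∀ i : Fin 2, ∫ x, f x * fderiv ℝ φ x (EuclideanSpace.single i 1) i
      = - ∫ x, lineDeriv ℝ f x (EuclideanSpace.single i 1) * φ x i := by
    intro i
    obtain ⟨D, hD⟩ := (contDiff_apply_coord hφ i).lipschitzWith_of_hasCompactSupport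
      (hasCompactSupport_apply hc i) one_ne_zero
    rw [hf.integral_lineDeriv_mul_eq hD (hasCompactSupport_apply hc i), ← integral_neg]
    refine integral_congr_ae (Eventually.of_forall fun x => ?_)
    have hd := (contDiff_apply_coord hφ i).differentiable one_ne_zero x
    simp only [hd.lineDeriv_eq_fderiv, map_neg, fderiv_apply_coord hφ]
    rw [PiLp.neg_apply, neg_mul, neg_neg, mul_comm]
  have int1 : ∀ i : Fin 2,
      Integrable fun x => f x * fderiv ℝ φ x (EuclideanSpace.single i 1) i := by
    intro i
    refine Continuous.integrable_of_hasCompactSupport ?_ ?_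
    · have h : Continuous fun x => fderiv ℝ φ x (EuclideanSpace.single i 1) :=
        (hφ.continuous_fderiv one_ne_zero).clm_apply continuous_const
      exact hf.continuous.mul (by fun_prop)
    · exact (hc.fderiv (𝕜 := ℝ)).of_eq_zero fun x hx => by simp [hx]
  have int2 : ∀ i : Fin 2,
      Integrable fun x => lineDeriv ℝ f x (EuclideanSpace.single i 1) * φ x i := by
    intro i
    have h1 : Integrable fun x => φ x i :=
      (contDiff_apply_coord hφ i).continuous.integrable_of_hasCompactSupport
        (hasCompactSupport_apply hc i)
    refine h1.bdd_mul (c := C * ‖(EuclideanSpace.single i 1 : Plane)‖)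
      (measurable_lineDeriv hf.continuous).aestronglyMeasurable ?_
    exact Eventually.of_forall fun x => norm_lineDeriv_le_of_lipschitz ℝ hf
  unfold divergence
  simp only [Finset.mul_sum]
  rw [integral_finsetSum _ fun i _ => int1 i]
  simp only [key]
  rw [Finset.sum_neg_distrib, ← integral_finsetSum _ fun i _ => int2 i]
  congr 1
  refine integral_congr_ae ?_
  filter_upwards [hf.ae_differentiableAt (μ := volume)] with x hx
  conv_rhs => rw [← sum_smul_single (φ x)]
  rw [map_sum]
  refine Finset.sum_congr rfl fun i _ => ?_
  rw [hx.lineDeriv_eq_fderiv, map_smul, smul_eq_mul, mul_comm]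

/-- The Lipschitz function that is `1` on the unit disk, `0` outside the disk of radius `1 + δ`,
and affine in the norm in between. -/
noncomputable def diskCutoff (δ : ℝ) (x : Plane) : ℝ := max 0 (min 1 ((1 + δ - ‖x‖) / δ))

lemma lipschitzWith_diskCutoff {δ : ℝ} (hδ : 0 < δ) :
    LipschitzWith (Real.toNNReal δ⁻¹) (diskCutoff δ) := by
  have h : LipschitzWith (Real.toNNReal δ⁻¹) fun x : Plane => (1 + δ - ‖x‖) / δ := by
    refine LipschitzWith.of_dist_le_mul fun x y => ?_
    rw [Real.coe_toNNReal _ (by positivity), Real.dist_eq, div_sub_div_same, abs_div, abs_of_pos hδ,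
      div_eq_inv_mul]
    gcongr
    rw [show 1 + δ - ‖x‖ - (1 + δ - ‖y‖) = ‖y‖ - ‖x‖ by ring, dist_comm, dist_eq_norm]
    exact abs_norm_sub_norm_le y x
  exact (h.const_min 1).const_max 0

lemma diskCutoff_eq_one {δ : ℝ} (hδ : 0 < δ) {x : Plane} (hx : ‖x‖ ≤ 1) : diskCutoff δ x = 1 := by
  have : 1 ≤ (1 + δ - ‖x‖) / δ := by rw [le_div_iff₀ hδ]; linarith
  simp [diskCutoff, this]

lemma diskCutoff_eq_zero {δ : ℝ} (hδ : 0 < δ) {x : Plane} (hx : 1 + δ ≤ ‖x‖) :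
    diskCutoff δ x = 0 := by
  have : (1 + δ - ‖x‖) / δ ≤ 0 := div_nonpos_of_nonpos_of_nonneg (by linarith) hδ.le
  simp [diskCutoff, this]

lemma diskCutoff_mem_Icc (δ : ℝ) (x : Plane) : diskCutoff δ x ∈ Icc (0 : ℝ) 1 :=
  ⟨le_max_left _ _, max_le zero_le_one (min_le_left _ _)⟩

lemma volume_real_ball (x : Plane) {r : ℝ} (hr : 0 ≤ r) :
    volume.real (Metric.ball x r) = π * r ^ 2 := by
  rw [measureReal_def, EuclideanSpace.volume_ball_fin_two, ENNReal.toReal_mul, ENNReal.toReal_pow,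
    ENNReal.toReal_ofReal hr, mul_comm]
  simp [pi_nonneg]

lemma volume_real_annulus {δ : ℝ} (hδ : 0 < δ) :
    volume.real (Metric.closedBall (0 : Plane) (1 + δ) \ Metric.ball 0 1)
      = δ * (π * (2 + δ)) := by
  rw [measureReal_sdiff (Metric.ball_subset_closedBall.trans
    (Metric.closedBall_subset_closedBall (by linarith))) measurableSet_ball
    measure_closedBall_lt_top.ne,
    volume_real_ball _ zero_le_one, measureReal_def, Measure.addHaar_closedBall_eq_addHaar_ball,
    ← measureReal_def, volume_real_ball _ (by linarith)]
  ring

/-- Half of the divergence theorem on the disk: the indicator function is approximated by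
`diskCutoff δ`, whose gradient is bounded by `δ⁻¹` on an annulus of area close to `2 π δ`. -/
lemma integral_ball_divergence_le {φ : Plane → Plane} (hφ : ContDiff ℝ 1 φ)
    (hc : HasCompactSupport φ) (h1 : ∀ x, ‖φ x‖ ≤ 1) :
    ∫ x in Metric.ball 0 1, divergence φ x ≤ 2 * π := by
  obtain ⟨M, hM⟩ := (hasCompactSupport_divergence hc).exists_bound_of_continuous
    (continuous_divergence hφ)
  have hdint : Integrable (divergence φ) :=
    (continuous_divergence hφ).integrable_of_hasCompactSupport (hasCompactSupport_divergence hc)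
  have key : ∀ δ : ℝ, 0 < δ →
      ∫ x in Metric.ball 0 1, divergence φ x ≤ (1 + M * δ) * (π * (2 + δ)) := by
    intro δ hδ
    set S : Set Plane := Metric.closedBall (0 : Plane) (1 + δ) \ Metric.ball 0 1 with hS
    have hSm : MeasurableSet S := measurableSet_closedBall.diff measurableSet_ball
    have hSfin : volume S ≠ ⊤ :=
      ((measure_mono sdiff_subset).trans_lt measure_closedBall_lt_top).ne
    have hL := lipschitzWith_diskCutoff hδ
    have e1 := integral_mul_divergence hL hφ hc
    have b1 : |∫ x, fderiv ℝ (diskCutoff δ) x (φ x)| ≤ δ⁻¹ * (δ * (π * (2 + δ))) := by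
      rw [← volume_real_annulus hδ, mul_comm, ← smul_eq_mul, ← setIntegral_const,
        ← integral_indicator hSm]
      rw [← Real.norm_eq_abs]
      refine norm_integral_le_of_norm_le ((integrable_indicator_iff hSm).2
        (integrableOn_const hSfin)) (Eventually.of_forall fun x => ?_)
      by_cases hx : x ∈ S
      · rw [indicator_of_mem hx]
        refine ((fderiv ℝ (diskCutoff δ) x).le_opNorm (φ x)).trans ?_
        have : ‖fderiv ℝ (diskCutoff δ) x‖ ≤ _ := norm_fderiv_le_of_lipschitz ℝ hL
        rw [Real.coe_toNNReal _ (by positivity)] at this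
        calc _ ≤ δ⁻¹ * 1 := mul_le_mul this (h1 x) (norm_nonneg _) (by positivity)
          _ = _ := mul_one _
      · have h0 : fderiv ℝ (diskCutoff δ) x = 0 := by
          rcases lt_or_ge ‖x‖ 1 with h | h
          · have : diskCutoff δ =ᶠ[𝓝 x] fun _ => 1 := by
              filter_upwards [Metric.isOpen_ball.mem_nhds (mem_ball_zero_iff.2 h)] with y hy
              exact diskCutoff_eq_one hδ (mem_ball_zero_iff.1 hy).le
            rw [this.fderiv_eq]; simp
          · have h' : x ∈ (Metric.closedBall (0 : Plane) (1 + δ))ᶜ := by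
              intro hx'
              exact hx ⟨hx', by simpa using h⟩
            have : diskCutoff δ =ᶠ[𝓝 x] fun _ => 0 := by
              filter_upwards [Metric.isClosed_closedBall.isOpen_compl.mem_nhds h'] with y hy
              refine diskCutoff_eq_zero hδ ?_
              simp only [mem_compl_iff, mem_closedBall_zero_iff, not_le] at hy
              exact hy.le
            rw [this.fderiv_eq]; simp
        rw [indicator_of_notMem hx, h0]
        simp
    have hi : Integrable fun x => diskCutoff δ x * divergence φ x := by
      refine hdint.bdd_mul (c := 1) hL.continuous.aestronglyMeasurable
        (Eventually.of_forall fun x => ?_)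
      have := diskCutoff_mem_Icc δ x
      rw [Real.norm_eq_abs, abs_of_nonneg this.1]
      exact this.2
    have b2 : |(∫ x in Metric.ball 0 1, divergence φ x) - ∫ x, diskCutoff δ x * divergence φ x|
        ≤ M * (δ * (π * (2 + δ))) := by
      rw [← volume_real_annulus hδ, mul_comm, ← smul_eq_mul, ← setIntegral_const,
        ← integral_indicator hSm, ← integral_indicator measurableSet_ball,
        ← integral_sub (hdint.indicator measurableSet_ball) hi]
      rw [← Real.norm_eq_abs]
      refine norm_integral_le_of_norm_le ((integrable_indicator_iff hSm).2
        (integrableOn_const hSfin)) (Eventually.of_forall fun x => ?_)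
      by_cases hB : x ∈ Metric.ball (0 : Plane) 1
      · rw [indicator_of_mem hB, indicator_of_notMem (fun h => h.2 hB),
          diskCutoff_eq_one hδ (mem_ball_zero_iff.1 hB).le]
        simp
      · rw [indicator_of_notMem hB, zero_sub, norm_neg]
        by_cases hx : x ∈ S
        · rw [indicator_of_mem hx, norm_mul]
          have := diskCutoff_mem_Icc δ x
          rw [Real.norm_of_nonneg this.1]
          exact (mul_le_of_le_one_left (norm_nonneg _) this.2).trans (hM x)
        · rw [indicator_of_notMem hx, diskCutoff_eq_zero hδ]
          · simp
          · by_contra! h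
            exact hx ⟨mem_closedBall_zero_iff.2 h.le, hB⟩
    rw [e1] at b2
    have h3 := (abs_le.1 b1).1
    have h4 := (abs_le.1 b2).2
    rw [inv_mul_cancel_left₀ hδ.ne'] at h3
    linarith
  have ht : Tendsto (fun δ : ℝ => (1 + M * δ) * (π * (2 + δ))) (𝓝[>] 0)
      (𝓝 ((1 + M * 0) * (π * (2 + 0)))) := by
    refine Tendsto.mono_left ?_ nhdsWithin_le_nhds
    exact Continuous.tendsto (by fun_prop) 0
  have := ge_of_tendsto ht (eventually_nhdsWithin_of_forall key)
  linarith

lemma perimeter_ball_le : perimeter (Metric.ball 0 1) ≤ ENNReal.ofReal (2 * π) := by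
  unfold perimeter
  refine iSup_le fun φ => iSup_le fun hφ => iSup_le fun hc => iSup_le fun h1 => ?_
  exact ENNReal.ofReal_le_ofReal (integral_ball_divergence_le hφ hc h1)

lemma le_perimeter {F : Set Plane} {φ : Plane → Plane} (hφ : ContDiff ℝ 1 φ)
    (hc : HasCompactSupport φ) (h1 : ∀ x, ‖φ x‖ ≤ 1) :
    ENNReal.ofReal (∫ x in F, divergence φ x) ≤ perimeter F := by
  unfold perimeter
  exact le_iSup_of_le φ (le_iSup_of_le hφ (le_iSup_of_le hc (le_iSup_of_le h1 le_rfl)))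

lemma isAdmissible_ball : IsAdmissible (Metric.ball 0 1) where
  isOpen := Metric.isOpen_ball
  isBounded := Metric.isBounded_ball
  hasC1Boundary := by
    intro p hp
    rw [frontier_ball _ one_ne_zero, mem_sphere_zero_iff_norm] at hp
    refine ⟨fun x => ‖x‖ ^ 2 - 1, ?_, ?_, Eventually.of_forall fun x => ?_⟩
    · exact ((contDiff_norm_sq ℝ).sub contDiff_const).contDiffAt
    · have h : HasFDerivAt (fun x : Plane => ‖x‖ ^ 2 - 1) (2 • innerSL ℝ p) p :=
        (hasStrictFDerivAt_norm_sq p).hasFDerivAt.sub_const 1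
      rw [h.fderiv]
      intro h0
      have := DFunLike.congr_fun h0 p
      simp [hp] at this
    · rw [mem_ball_zero_iff, sub_neg, sq_lt_one_iff₀ (norm_nonneg _)]
  volume_eq := by
    rw [EuclideanSpace.volume_ball_fin_two]
    simp

end RieszIsoperimetric

namespace RieszIsoperimetric

open Real Set Filter Topology NNReal ContinuousLinearMap
open scoped Convolution

/-! ### Mollified indicator functions and the perimeter -/

/-- The indicator function of `F`, mollified with the normalized bump function `b`. -/
noncomputable def mollify (b : ContDiffBump (0 : Plane)) (F : Set Plane) : Plane → ℝ :=
  b.normed volume ⋆[lsmul ℝ ℝ, volume] F.indicator fun _ => (1 : ℝ)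

section mollify

variable (b : ContDiffBump (0 : Plane)) {F : Set Plane}

lemma locallyIntegrable_indicator_one (hF : MeasurableSet F) :
    LocallyIntegrable (F.indicator fun _ => (1 : ℝ)) volume :=
  (locallyIntegrable_const (1 : ℝ)).indicator hF

lemma contDiff_mollify (hF : MeasurableSet F) {n : ℕ∞} : ContDiff ℝ n (mollify b F) :=
  b.hasCompactSupport_normed.contDiff_convolution_left _ b.contDiff_normed
    (locallyIntegrable_indicator_one hF)

lemma hasCompactSupport_mollify (hb : Bornology.IsBounded F) :
    HasCompactSupport (mollify b F) := by
  refine b.hasCompactSupport_normed.convolution _ ?_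
  refine HasCompactSupport.intro (Metric.isCompact_of_isClosed_isBounded isClosed_closure
    hb.closure) fun x hx => indicator_of_notMem (fun h => hx (subset_closure h)) _

lemma mollify_eq_one {x : Plane} (hx : Metric.ball x b.rOut ⊆ F) : mollify b F x = 1 := by
  have hxF : x ∈ F := hx (Metric.mem_ball_self b.rOut_pos)
  unfold mollify
  rw [b.normed_convolution_eq_right, indicator_of_mem hxF]
  intro y hy
  rw [indicator_of_mem hxF, indicator_of_mem (hx hy)]

lemma divergence_convolution {φ : Plane → Plane} (hφ : ContDiff ℝ 1 φ)
    (hc : HasCompactSupport φ) (y : Plane) :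
    divergence (b.normed volume ⋆[lsmul ℝ ℝ, volume] φ) y
      = ∫ x, b.normed volume (y - x) * divergence φ x := by
  have hloc : LocallyIntegrable (b.normed volume) volume :=
    b.integrable_normed.locallyIntegrable
  have hcont : ∀ i : Fin 2, Continuous fun x => fderiv ℝ φ x (EuclideanSpace.single i 1) :=
    fun i => (hφ.continuous_fderiv one_ne_zero).clm_apply continuous_const
  have hcs : ∀ i : Fin 2, HasCompactSupport fun x => fderiv ℝ φ x (EuclideanSpace.single i 1) := by
    exact fun i => (hc.fderiv (𝕜 := ℝ)).of_eq_zero fun x hx => by simp [hx]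
  have hint : ∀ i : Fin 2, Integrable fun x =>
      b.normed volume (y - x) • fderiv ℝ φ x (EuclideanSpace.single i 1) := by
    intro i
    refine Continuous.integrable_of_hasCompactSupport ?_
      ((hcs i).of_eq_zero fun x hx => by simp [hx])
    exact (b.continuous_normed.comp (by fun_prop)).smul (hcont i)
  unfold divergence
  rw [(hc.hasFDerivAt_convolution_right (lsmul ℝ ℝ) hloc hφ y).fderiv]
  have h1 : ∀ i : Fin 2, ((b.normed volume ⋆[(lsmul ℝ ℝ).precompR Plane, volume] fderiv ℝ φ) y)
      (EuclideanSpace.single i 1) i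
      = ∫ x, b.normed volume (y - x) * fderiv ℝ φ x (EuclideanSpace.single i 1) i := by
    intro i
    rw [convolution_precompR_apply _ hloc (hc.fderiv (𝕜 := ℝ))
      (hφ.continuous_fderiv one_ne_zero), convolution_eq_swap]
    exact ((EuclideanSpace.proj (𝕜 := ℝ) i).integral_comp_comm (hint i)).symm
  simp only [h1, Finset.mul_sum]
  rw [integral_finsetSum]
  intro i _
  exact (EuclideanSpace.proj (𝕜 := ℝ) i).integrable_comp (hint i)

/-- Testing the divergence of `φ` against the mollified indicator function amounts to integrating
the divergence of the mollified field over the set. -/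
lemma integral_mollify_mul_divergence (hF : MeasurableSet F) (hb : Bornology.IsBounded F)
    {φ : Plane → Plane} (hφ : ContDiff ℝ 1 φ) (hc : HasCompactSupport φ) :
    ∫ x, mollify b F x * divergence φ x
      = ∫ y in F, divergence (b.normed volume ⋆[lsmul ℝ ℝ, volume] φ) y := by
  have h1 : ∀ x, mollify b F x * divergence φ x
      = ∫ y in F, b.normed volume (y - x) * divergence φ x := by
    intro x
    rw [integral_mul_const, mollify, convolution_eq_swap, ← integral_indicator hF]
    congr 1
    refine integral_congr_ae (Eventually.of_forall fun y => ?_)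
    have hs : b.normed volume (x - y) = b.normed volume (y - x) := by
      rw [← neg_sub, b.normed_neg]
    by_cases hy : y ∈ F <;> simp [hy, hs]
  simp only [h1, divergence_convolution b hφ hc]
  refine integral_integral_swap ?_
  have : IsFiniteMeasure (volume.restrict F) := ⟨by simpa using hb.measure_lt_top⟩
  obtain ⟨M, hM⟩ := b.hasCompactSupport_normed.exists_bound_of_continuous
    (b.continuous_normed (μ := volume))
  have hd : Integrable (divergence φ) :=
    (continuous_divergence hφ).integrable_of_hasCompactSupport (hasCompactSupport_divergence hc)
  have hd2 : Integrable (fun p : Plane × Plane => divergence φ p.1)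
      (volume.prod (volume.restrict F)) := hd.comp_fst _
  refine hd2.bdd_mul (c := M) ?_ (Eventually.of_forall fun p => hM _)
  refine Continuous.aestronglyMeasurable ?_
  exact b.continuous_normed.comp (by fun_prop)

lemma norm_convolution_le {φ : Plane → Plane} (h1 : ∀ x, ‖φ x‖ ≤ 1) (y : Plane) :
    ‖(b.normed volume ⋆[lsmul ℝ ℝ, volume] φ) y‖ ≤ 1 := by
  rw [convolution_def, ← b.integral_normed (μ := volume)]
  refine norm_integral_le_of_norm_le b.integrable_normed (Eventually.of_forall fun t => ?_)
  rw [lsmul_apply, norm_smul, Real.norm_of_nonneg (b.nonneg_normed t)]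
  exact mul_le_of_le_one_right (b.nonneg_normed t) (h1 _)

lemma integral_mollify_mul_divergence_le (hF : MeasurableSet F) (hb : Bornology.IsBounded F)
    (hP : perimeter F ≠ ⊤) {φ : Plane → Plane} (hφ : ContDiff ℝ 1 φ) (hc : HasCompactSupport φ)
    (h1 : ∀ x, ‖φ x‖ ≤ 1) :
    ∫ x, mollify b F x * divergence φ x ≤ (perimeter F).toReal := by
  rw [integral_mollify_mul_divergence b hF hb hφ hc]
  refine (ENNReal.ofReal_le_iff_le_toReal hP).1 (le_perimeter ?_ ?_ (norm_convolution_le b h1))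
  · exact hc.contDiff_convolution_right (n := 1) _ b.integrable_normed.locallyIntegrable hφ
  · exact b.hasCompactSupport_normed.convolution _ hc

/-- The total variation of the mollified indicator function is at most the perimeter. -/
lemma integral_norm_fderiv_mollify_le (hF : MeasurableSet F) (hb : Bornology.IsBounded F)
    (hP : perimeter F ≠ ⊤) :
    ∫ x, ‖fderiv ℝ (mollify b F) x‖ ≤ (perimeter F).toReal := by
  set u := mollify b F with hu
  have hu2 : ContDiff ℝ 2 u := contDiff_mollify b hF (n := 2)
  have hu1 : ContDiff ℝ 1 u := hu2.of_le (by norm_num)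
  have huc : HasCompactSupport u := hasCompactSupport_mollify b hb
  obtain ⟨C, hC⟩ := hu1.lipschitzWith_of_hasCompactSupport huc one_ne_zero
  set G : Plane → Plane := gradient u with hG
  have hGd : ContDiff ℝ 1 G :=
    (InnerProductSpace.toDual ℝ Plane).symm.contDiff.comp (hu2.fderiv_right (by norm_num))
  have hGn : ∀ x, ‖G x‖ = ‖fderiv ℝ u x‖ := fun x => LinearIsometryEquiv.norm_map _ _
  have hGi : ∀ x v, fderiv ℝ u x v = inner ℝ (G x) v := by
    intro x v
    simp [hG, gradient]
  have hGc : HasCompactSupport G := by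
    refine (huc.fderiv (𝕜 := ℝ)).of_eq_zero fun x hx => ?_
    rw [← norm_eq_zero, hGn, hx, norm_zero]
  set K := tsupport G with hK
  have hKfin : volume K ≠ ⊤ := hGc.isCompact.measure_lt_top.ne
  have hKm : MeasurableSet K := (isClosed_tsupport G).measurableSet
  have hGint : Integrable fun x => ‖G x‖ :=
    (hGd.continuous.integrable_of_hasCompactSupport hGc).norm
  have key : ∀ c : ℝ, 0 < c →
      ∫ x, ‖fderiv ℝ u x‖ ≤ (perimeter F).toReal + c * volume.real K := by
    intro c hc
    have hpos : ∀ x, 0 < c ^ 2 + ‖G x‖ ^ 2 := fun x => by positivity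
    -- the field `φ` is a regularization of the direction of steepest descent of `u`
    set φ : Plane → Plane := fun x => (-(√(c ^ 2 + ‖G x‖ ^ 2))⁻¹) • G x with hφ
    have hle : ∀ x, ‖G x‖ ≤ √(c ^ 2 + ‖G x‖ ^ 2) := fun x =>
      Real.le_sqrt_of_sq_le (by nlinarith [sq_nonneg c])
    have hsq : ∀ x, 0 < √(c ^ 2 + ‖G x‖ ^ 2) := fun x => Real.sqrt_pos.2 (hpos x)
    have hφd : ContDiff ℝ 1 φ := by
      refine ContDiff.smul (ContDiff.neg (ContDiff.inv ?_ fun x => (hsq x).ne')) hGd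
      exact ContDiff.sqrt (contDiff_const.add (hGd.norm_sq ℝ)) fun x => (hpos x).ne'
    have hφc : HasCompactSupport φ := hGc.of_eq_zero fun x hx => by simp [hφ, hx]
    have hφ1 : ∀ x, ‖φ x‖ ≤ 1 := by
      intro x
      rw [hφ, norm_smul, norm_neg, norm_inv, Real.norm_of_nonneg (hsq x).le,
        inv_mul_le_iff₀ (hsq x), mul_one]
      exact hle x
    have h1 := integral_mollify_mul_divergence_le b hF hb hP hφd hφc hφ1
    rw [← hu, integral_mul_divergence hC hφd hφc, ← integral_neg] at h1
    have h2 : ∫ x, (‖G x‖ - K.indicator (fun _ => c) x) ≤ ∫ x, -(fderiv ℝ u x) (φ x) := by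
      refine integral_mono (hGint.sub ((integrable_indicator_iff hKm).2
        (integrableOn_const hKfin))) ?_ fun x => ?_
      · refine Integrable.neg (Continuous.integrable_of_hasCompactSupport ?_ ?_)
        · exact (hu1.continuous_fderiv one_ne_zero).clm_apply hφd.continuous
        · exact hφc.of_eq_zero fun x hx => by simp [hx]
      · simp only [hGi, hφ, inner_smul_right, real_inner_self_eq_norm_sq]
        by_cases hx : x ∈ K
        · rw [indicator_of_mem hx, neg_mul, neg_neg, inv_mul_eq_div, le_div_iff₀ (hsq x)]
          have h3 := Real.sq_sqrt (hpos x).le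
          have h4 : √(c ^ 2 + ‖G x‖ ^ 2) ≤ c + ‖G x‖ := by
            rw [Real.sqrt_le_left (by positivity)]
            nlinarith [norm_nonneg (G x)]
          rcases le_or_gt (‖G x‖) c with h5 | h5
          · nlinarith [norm_nonneg (G x), hsq x]
          · nlinarith [norm_nonneg (G x), hsq x]
        · rw [indicator_of_notMem hx, image_eq_zero_of_notMem_tsupport hx]
          simp
    rw [integral_sub hGint ((integrable_indicator_iff hKm).2
        (integrableOn_const hKfin)), integral_indicator hKm, setIntegral_const, smul_eq_mul] at h2
    simp only [← hGn]
    linarith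
  have ht : Tendsto (fun c : ℝ => (perimeter F).toReal + c * volume.real K) (𝓝[>] 0)
      (𝓝 ((perimeter F).toReal + 0 * volume.real K)) := by
    refine Tendsto.mono_left ?_ nhdsWithin_le_nhds
    exact Continuous.tendsto (by fun_prop) 0
  have := ge_of_tendsto ht (eventually_nhdsWithin_of_forall key)
  simpa using this

end mollify

end RieszIsoperimetric

namespace RieszIsoperimetric

open Real Set Filter Topology

/-! ### Support functions -/

/-- The support function of `F`, as a function of the angle of the direction. -/
noncomputable def supportFn (F : Set Plane) (θ : ℝ) : ℝ :=
  sSup ((fun x => inner ℝ x (dir θ)) '' F)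

section supportFn

variable {F : Set Plane}

lemma abs_inner_dir_le (x : Plane) (θ : ℝ) : |inner ℝ x (dir θ)| ≤ ‖x‖ := by
  simpa using abs_real_inner_le_norm x (dir θ)

lemma bddAbove_image_inner_dir (hb : Bornology.IsBounded F) (θ : ℝ) :
    BddAbove ((fun x => inner ℝ x (dir θ)) '' F) := by
  obtain ⟨R, hR⟩ := hb.subset_closedBall (0 : Plane)
  refine ⟨R, ?_⟩
  rintro _ ⟨x, hx, rfl⟩
  exact (le_abs_self _).trans ((abs_inner_dir_le x θ).trans (mem_closedBall_zero_iff.1 (hR hx)))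

lemma inner_le_supportFn (hb : Bornology.IsBounded F) {x : Plane} (hx : x ∈ F) (θ : ℝ) :
    inner ℝ x (dir θ) ≤ supportFn F θ :=
  le_csSup (bddAbove_image_inner_dir hb θ) (mem_image_of_mem _ hx)

lemma supportFn_le (hne : F.Nonempty) {θ c : ℝ} (h : ∀ x ∈ F, inner ℝ x (dir θ) ≤ c) :
    supportFn F θ ≤ c := by
  refine csSup_le (hne.image _) ?_
  rintro _ ⟨x, hx, rfl⟩
  exact h x hx

lemma exists_lt_inner_of_lt_supportFn (hne : F.Nonempty) {θ c : ℝ} (h : c < supportFn F θ) :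
    ∃ x ∈ F, c < inner ℝ x (dir θ) := by
  obtain ⟨_, ⟨x, hx, rfl⟩, hc⟩ := exists_lt_of_lt_csSup (hne.image _) h
  exact ⟨x, hx, hc⟩

lemma supportFn_add_two_pi (F : Set Plane) (θ : ℝ) : supportFn F (θ + 2 * π) = supportFn F θ := by
  simp [supportFn, dir_add_two_pi]

lemma lipschitzWith_dir : LipschitzWith 1 dir := by
  refine lipschitzWith_of_nnnorm_deriv_le (fun θ => (hasDerivAt_dir θ).differentiableAt) ?_
  intro θ
  rw [(hasDerivAt_dir θ).deriv, ← NNReal.coe_le_coe]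
  simp

lemma lipschitzWith_supportFn (hne : F.Nonempty) {R : ℝ} (hR : F ⊆ Metric.closedBall 0 R) :
    LipschitzWith R.toNNReal (supportFn F) := by
  have hb : Bornology.IsBounded F := Metric.isBounded_closedBall.subset hR
  have hR0 : 0 ≤ R := by
    obtain ⟨x, hx⟩ := hne
    exact (norm_nonneg x).trans (mem_closedBall_zero_iff.1 (hR hx))
  refine LipschitzWith.of_le_add_mul _ fun a b => supportFn_le hne fun x hx => ?_
  rw [Real.coe_toNNReal _ hR0]
  have h1 : inner ℝ x (dir a) = inner ℝ x (dir b) + inner ℝ x (dir a - dir b) := by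
    rw [← inner_add_right]; congr 1; abel
  have h2 : inner ℝ x (dir a - dir b) ≤ R * dist a b := by
    refine (real_inner_le_norm _ _).trans ?_
    gcongr
    · exact mem_closedBall_zero_iff.1 (hR hx)
    · have := lipschitzWith_dir.dist_le_mul a b
      rwa [dist_eq_norm, NNReal.coe_one, one_mul] at this
  linarith [inner_le_supportFn hb hx b]

lemma continuous_supportFn (hb : Bornology.IsBounded F) (hne : F.Nonempty) :
    Continuous (supportFn F) := by
  obtain ⟨R, hR⟩ := hb.subset_closedBall (0 : Plane)
  exact (lipschitzWith_supportFn hne hR).continuous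

/-- Sublinearity of the support function along three directions. -/
lemma two_mul_cos_mul_supportFn_le (hb : Bornology.IsBounded F) (hne : F.Nonempty) (θ : ℝ) {δ : ℝ}
    (hδ : 0 < cos δ) :
    2 * cos δ * supportFn F θ ≤ supportFn F (θ + δ) + supportFn F (θ - δ) := by
  have h : supportFn F θ ≤ (supportFn F (θ + δ) + supportFn F (θ - δ)) / (2 * cos δ) := by
    refine supportFn_le hne fun x hx => ?_
    rw [le_div_iff₀ (by positivity)]
    have h1 : inner ℝ x (dir θ) * (2 * cos δ)
        = inner ℝ x (dir (θ + δ)) + inner ℝ x (dir (θ - δ)) := by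
      rw [← inner_add_right, dir_add_dir, inner_smul_right]; ring
    rw [h1]
    exact add_le_add (inner_le_supportFn hb hx _) (inner_le_supportFn hb hx _)
  rw [le_div_iff₀ (by positivity)] at h
  linarith

/-- The projection of a convex set on the direction `θ` contains an open interval of length
`supportFn F θ + supportFn F (θ + π)`. -/
lemma Ioo_subset_image_inner_dir (hne : F.Nonempty) (hconv : Convex ℝ F)
    (θ : ℝ) : Ioo (-supportFn F (θ + π)) (supportFn F θ) ⊆ (fun x => inner ℝ x (dir θ)) '' F := by
  rintro t ⟨h1, h2⟩
  have hoc : OrdConnected ((fun x => inner ℝ x (dir θ)) '' F) := by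
    refine Convex.ordConnected ?_
    refine hconv.is_linear_image (f := fun x => inner ℝ x (dir θ)) ⟨fun x y => ?_, fun c x => ?_⟩
    · exact inner_add_left _ _ _
    · simp [inner_smul_left]
  obtain ⟨x, hx, hxt⟩ := exists_lt_inner_of_lt_supportFn hne (neg_lt.1 h1)
  obtain ⟨y, hy, hyt⟩ := exists_lt_inner_of_lt_supportFn hne h2
  rw [dir_add_pi, inner_neg_right] at hxt
  exact hoc.out (mem_image_of_mem _ hx) (mem_image_of_mem _ hy) ⟨by linarith, hyt.le⟩

end supportFn

/-! ### Cauchy's formula as a lower bound for the perimeter -/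

lemma integral_abs_cos_sub (a : ℝ) : ∫ θ in (0 : ℝ)..2 * π, |cos (a - θ)| = 4 := by
  have hper : Function.Periodic (fun θ : ℝ => |cos θ|) π := by
    intro θ
    simp [cos_add_pi]
  have hcont : Continuous fun θ : ℝ => |cos θ| := by fun_prop
  have h1 : ∫ θ in (-(π / 2))..(-(π / 2) + π), |cos θ| = 2 := by
    rw [show -(π / 2) + π = π / 2 by ring]
    rw [intervalIntegral.integral_congr (g := cos)]
    · rw [integral_cos]; simp; norm_num
    · intro θ hθ
      rw [uIcc_of_le (by linarith [Real.pi_pos])] at hθ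
      exact abs_of_nonneg (cos_nonneg_of_mem_Icc hθ)
  rw [intervalIntegral.integral_comp_sub_left (fun θ => |cos θ|) a,
    ← intervalIntegral.integral_add_adjacent_intervals (b := a - 2 * π + π)
      (hcont.intervalIntegrable _ _) (hcont.intervalIntegrable _ _),
    hper.intervalIntegral_add_eq _ (-(π / 2)), h1,
    show a - 0 = a - 2 * π + π + π by ring, hper.intervalIntegral_add_eq _ (-(π / 2)), h1]
  norm_num

lemma lintegral_abs_inner_dir (G : Plane) :
    ∫⁻ θ in Ioc 0 (2 * π), ENNReal.ofReal |inner ℝ G (dir θ)| = 4 * ENNReal.ofReal ‖G‖ := by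
  obtain ⟨a, ha⟩ := exists_eq_smul_dir G
  have h : ∀ θ, |inner ℝ G (dir θ)| = ‖G‖ * |cos (a - θ)| := by
    intro θ
    conv_lhs => rw [ha]
    rw [real_inner_smul_left, inner_dir_dir, abs_mul, abs_norm]
  simp only [h]
  rw [← ofReal_integral_eq_lintegral_ofReal]
  · rw [← intervalIntegral.integral_of_le (by positivity), intervalIntegral.integral_const_mul,
      integral_abs_cos_sub, ENNReal.ofReal_mul (norm_nonneg _), mul_comm]
    simp
  · refine Integrable.const_mul ?_ _
    exact (Continuous.integrableOn_Icc (by fun_prop)).mono_set Ioc_subset_Icc_self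
  · exact Eventually.of_forall fun θ => by positivity

/-- A compactly supported function on the line that takes the value `1` has total variation at
least `2`. -/
lemma two_le_lintegral_abs_deriv {f : ℝ → ℝ} (hf : ContDiff ℝ 1 f) (hc : HasCompactSupport f)
    {s : ℝ} (hs : f s = 1) : 2 ≤ ∫⁻ x, ENNReal.ofReal |deriv f x| := by
  obtain ⟨R, hR⟩ := hc.isCompact.isBounded.subset_closedBall s
  have hz : ∀ x, |R| < |x - s| → f x = 0 := by
    intro x hx
    refine image_eq_zero_of_notMem_tsupport fun h => ?_
    have := hR h
    rw [Metric.mem_closedBall, Real.dist_eq] at this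
    exact (this.trans (le_abs_self R)).not_gt hx
  have hcd : Continuous (deriv f) := hf.continuous_deriv le_rfl
  have hd : ∀ a b : ℝ, ∫ x in a..b, deriv f x = f b - f a := fun a b =>
    intervalIntegral.integral_deriv_eq_sub
      (fun x _ => hf.differentiable one_ne_zero x) (hcd.intervalIntegrable _ _)
  have key : ∀ a b : ℝ, a ≤ b → |f b - f a| = 1 →
      1 ≤ ∫⁻ x in Ioc a b, ENNReal.ofReal |deriv f x| := by
    intro a b hab h
    rw [← hd, intervalIntegral.integral_of_le hab] at h
    have h2 := enorm_integral_le_lintegral_enorm (μ := volume.restrict (Ioc a b)) (deriv f)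
    rw [← ofReal_norm, Real.norm_eq_abs, h, ENNReal.ofReal_one] at h2
    refine h2.trans (le_of_eq (lintegral_congr fun x => ?_))
    rw [← ofReal_norm, Real.norm_eq_abs]
  set a := s - (|R| + 1)
  set b := s + (|R| + 1)
  have hR0 := abs_nonneg R
  have ha : f a = 0 := hz a (by
    rw [show a - s = -(|R| + 1) by simp only [a]; ring, abs_neg,
      abs_of_pos (by positivity : 0 < |R| + 1)]
    linarith)
  have hb : f b = 0 := hz b (by
    rw [show b - s = |R| + 1 by simp only [b]; ring, abs_of_pos (by positivity : 0 < |R| + 1)]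
    linarith)
  have h1 := key a s (by simp only [a]; linarith) (by simp [hs, ha])
  have h2 := key s b (by simp only [b]; linarith) (by simp [hs, hb])
  calc (2 : ℝ≥0∞) = 1 + 1 := by norm_num
    _ ≤ _ := add_le_add h1 h2
    _ = ∫⁻ x in Ioc a s ∪ Ioc s b, ENNReal.ofReal |deriv f x| := by
        rw [lintegral_union measurableSet_Ioc (Ioc_disjoint_Ioc_of_le le_rfl)]
    _ ≤ _ := setLIntegral_le_lintegral _ _

/-- In a given direction, the variation of a function that equals `1` on `T` is at least twice the
length of the projection of `T` on the orthogonal direction. -/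
lemma two_mul_volume_le_lintegral_abs_fderiv {u : Plane → ℝ} (hu : ContDiff ℝ 1 u)
    (hc : HasCompactSupport u) (θ : ℝ) {T : Set Plane} (hT : ∀ x ∈ T, u x = 1) {I : Set ℝ}
    (hI : MeasurableSet I) (hIT : I ⊆ (fun x => inner ℝ x (dir (θ + π / 2))) '' T) :
    2 * volume I ≤ ∫⁻ x, ENNReal.ofReal |fderiv ℝ u x (dir θ)| := by
  have hm : Measurable fun x => ENNReal.ofReal |fderiv ℝ u x (dir θ)| := by
    refine ENNReal.measurable_ofReal.comp (Continuous.measurable ?_)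
    exact ((hu.continuous_fderiv one_ne_zero).clm_apply continuous_const).abs
  rw [lintegral_eq_lintegral_frame θ hm]
  calc 2 * volume I = ∫⁻ t in I, 2 := by rw [setLIntegral_const]
    _ ≤ ∫⁻ t in I, ∫⁻ s : ℝ, ENNReal.ofReal
          |fderiv ℝ u (s • dir θ + t • dir (θ + π / 2)) (dir θ)| := by
        refine setLIntegral_mono' hI fun t ht => ?_
        obtain ⟨x, hx, hxt⟩ := hIT ht
        have hxeq : x = inner ℝ x (dir θ) • dir θ + t • dir (θ + π / 2) := by
          rw [← hxt]
          ext i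
          fin_cases i
          · simp [inner_dir, cos_add_pi_div_two, sin_add_pi_div_two]
            linear_combination (-(x 0)) * sin_sq_add_cos_sq θ
          · simp [inner_dir, cos_add_pi_div_two, sin_add_pi_div_two]
            linear_combination (-(x 1)) * sin_sq_add_cos_sq θ
        set ℓ : ℝ → Plane := fun s => s • dir θ + t • dir (θ + π / 2) with hℓ
        have hℓd : ∀ s, HasDerivAt ℓ (dir θ) s := by
          intro s
          have := ((hasDerivAt_id s).smul_const (dir θ)).add_const (t • dir (θ + π / 2))
          rwa [one_smul] at this
        have hd : ∀ s, deriv (u ∘ ℓ) s = fderiv ℝ u (ℓ s) (dir θ) := fun s =>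
          ((hu.differentiable one_ne_zero _).hasFDerivAt.comp_hasDerivAt s (hℓd s)).deriv
        have hℓc : ContDiff ℝ 1 ℓ := by fun_prop
        have hcl : HasCompactSupport (u ∘ ℓ) := by
          refine hc.comp_isClosedEmbedding ?_
          refine Isometry.isClosedEmbedding (Isometry.of_dist_eq fun s s' => ?_)
          rw [hℓ, dist_add_right, dist_eq_norm, ← sub_smul, norm_smul, norm_dir, mul_one,
            dist_eq_norm]
        have := two_le_lintegral_abs_deriv (hu.comp hℓc) hcl (s := inner ℝ x (dir θ))
          (by rw [Function.comp_apply, ← hT x hx]; exact congrArg u hxeq.symm)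
        simpa only [hd] using this
    _ ≤ _ := setLIntegral_le_lintegral _ _

/-- **Cauchy's formula**, as a lower bound: the perimeter of a bounded open convex set is at least
the integral of its support function. -/
theorem integral_supportFn_le_perimeter {Ω : Set Plane} (ho : IsOpen Ω)
    (hb : Bornology.IsBounded Ω) (hne : Ω.Nonempty) (hconv : Convex ℝ Ω)
    (hP : perimeter Ω ≠ ⊤) :
    ∫ θ in (0 : ℝ)..2 * π, supportFn Ω θ ≤ (perimeter Ω).toReal := by
  obtain ⟨y, hy⟩ := id hne
  obtain ⟨r, hr, hball⟩ := Metric.isOpen_iff.1 ho y hy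
  have hhc := continuous_supportFn hb hne
  have key : ∀ l ∈ Ioo (0 : ℝ) 1,
      l * ∫ θ in (0 : ℝ)..2 * π, supportFn Ω θ ≤ (perimeter Ω).toReal := by
    intro l hl
    have hl1 : 0 < (1 - l) * r := mul_pos (by linarith [hl.2]) hr
    let b : ContDiffBump (0 : Plane) := ⟨(1 - l) * r / 2, (1 - l) * r, by linarith, by linarith⟩
    set u := mollify b Ω with hu
    have hu1 : ContDiff ℝ 1 u := contDiff_mollify b ho.measurableSet (n := 1)
    have huc : HasCompactSupport u := hasCompactSupport_mollify b hb
    -- `u` equals `1` on the homothetic copy of `Ω` with centre `y` and ratio `l`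
    have hu_one : ∀ x ∈ (fun z => y + l • (z - y)) '' Ω, u x = 1 := by
      rintro _ ⟨z, hz, rfl⟩
      refine mollify_eq_one b fun p hp => ?_
      have hp' : ‖p - (y + l • (z - y))‖ < (1 - l) * r := by
        rw [← dist_eq_norm]; exact hp
      have hq : y + (1 - l)⁻¹ • (p - (y + l • (z - y))) ∈ Ω := by
        refine hball ?_
        rw [Metric.mem_ball, dist_eq_norm, add_sub_cancel_left, norm_smul, norm_inv,
          Real.norm_of_nonneg (by linarith [hl.2]), inv_mul_lt_iff₀ (by linarith [hl.2])]
        exact hp'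
      have := hconv hz hq hl.1.le (by linarith [hl.2] : (0 : ℝ) ≤ 1 - l) (by ring)
      convert this using 1
      rw [smul_add, smul_smul, mul_inv_cancel₀ (by linarith [hl.2]), one_smul, smul_sub, sub_smul,
        one_smul]
      abel
    -- in each direction, the variation of `u` is at least twice the width of that copy
    have hdir : ∀ θ, ENNReal.ofReal (2 * l * (supportFn Ω (θ + π / 2)
        + supportFn Ω (θ + π / 2 + π))) ≤ ∫⁻ x, ENNReal.ofReal |fderiv ℝ u x (dir θ)| := by
      intro θ
      set A := -supportFn Ω (θ + π / 2 + π)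
      set B := supportFn Ω (θ + π / 2)
      set c := inner ℝ y (dir (θ + π / 2))
      have := two_mul_volume_le_lintegral_abs_fderiv hu1 huc θ hu_one
        (I := Ioo (c + l * (A - c)) (c + l * (B - c))) measurableSet_Ioo ?_
      · refine le_trans (le_of_eq ?_) this
        rw [Real.volume_Ioo, show (2 : ℝ≥0∞) = ENNReal.ofReal 2 by norm_num,
          ← ENNReal.ofReal_mul (by norm_num)]
        congr 1
        simp only [A]
        ring
      · rintro t ⟨ht1, ht2⟩
        have ht : c + (t - c) / l ∈ Ioo A B := by
          constructor
          · rw [← sub_lt_iff_lt_add', lt_div_iff₀ hl.1]; linarith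
          · rw [← lt_sub_iff_add_lt', div_lt_iff₀ hl.1]; linarith
        obtain ⟨z, hz, hzt⟩ := Ioo_subset_image_inner_dir hne hconv (θ + π / 2) ht
        refine ⟨_, mem_image_of_mem _ hz, ?_⟩
        simp only at hzt ⊢
        rw [inner_add_left, real_inner_smul_left, inner_sub_left, hzt]
        simp only [c]
        field_simp [hl.1.ne']
        ring
    have hcf : Continuous fun p : Plane × ℝ => |fderiv ℝ u p.1 (dir p.2)| :=
      (((hu1.continuous_fderiv one_ne_zero).comp continuous_fst).clm_apply
        (continuous_dir.comp continuous_snd)).abs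
    -- averaging over the directions recovers the total variation, since `∫ |cos| = 4`
    have hswap : ∫⁻ θ in Ioc 0 (2 * π), ∫⁻ x, ENNReal.ofReal |fderiv ℝ u x (dir θ)|
        = 4 * ENNReal.ofReal (∫ x, ‖fderiv ℝ u x‖) := by
      rw [lintegral_lintegral_swap]
      · have h1 : ∀ x, ∫⁻ θ in Ioc 0 (2 * π), ENNReal.ofReal |fderiv ℝ u x (dir θ)|
            = 4 * ENNReal.ofReal ‖fderiv ℝ u x‖ := by
          intro x
          rw [← LinearIsometryEquiv.norm_map (InnerProductSpace.toDual ℝ Plane).symm,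
            ← lintegral_abs_inner_dir]
          simp
        simp only [h1]
        rw [lintegral_const_mul' _ _ (by norm_num), ofReal_integral_eq_lintegral_ofReal]
        · refine ((hu1.continuous_fderiv one_ne_zero).integrable_of_hasCompactSupport ?_).norm
          exact huc.fderiv (𝕜 := ℝ)
        · exact Eventually.of_forall fun x => norm_nonneg _
      · refine Measurable.aemeasurable (ENNReal.measurable_ofReal.comp ?_)
        exact (hcf.comp continuous_swap).measurable
    have hint : ENNReal.ofReal (∫ θ in (0 : ℝ)..2 * π, 2 * l * (supportFn Ω (θ + π / 2)
        + supportFn Ω (θ + π / 2 + π))) ≤ 4 * ENNReal.ofReal (∫ x, ‖fderiv ℝ u x‖) := by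
      rw [← hswap, intervalIntegral.integral_of_le (by positivity)]
      have hc1 : Continuous fun θ => 2 * l * (supportFn Ω (θ + π / 2)
        + supportFn Ω (θ + π / 2 + π)) := by fun_prop
      rw [ofReal_integral_eq_lintegral_ofReal]
      · exact lintegral_mono hdir
      · exact hc1.integrableOn_Icc.mono_set Ioc_subset_Icc_self
      · refine Eventually.of_forall fun θ => ?_
        have h1 := inner_le_supportFn hb hy (θ + π / 2)
        have h2 := inner_le_supportFn hb hy (θ + π / 2 + π)
        rw [dir_add_pi, inner_neg_right] at h2
        exact mul_nonneg (by linarith [hl.1]) (by linarith)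
    have hper : Function.Periodic (supportFn Ω) (2 * π) := supportFn_add_two_pi Ω
    have hsh : ∀ a : ℝ, ∫ θ in (0 : ℝ)..2 * π, supportFn Ω (θ + a)
        = ∫ θ in (0 : ℝ)..2 * π, supportFn Ω θ := by
      intro a
      rw [intervalIntegral.integral_comp_add_right (supportFn Ω) a]
      have := hper.intervalIntegral_add_eq a 0
      simpa [add_comm] using this
    simp only [add_assoc] at hint
    rw [intervalIntegral.integral_const_mul, intervalIntegral.integral_add
      (Continuous.intervalIntegrable (by fun_prop) _ _)
      (Continuous.intervalIntegrable (by fun_prop) _ _), hsh, hsh,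
      show (4 : ℝ≥0∞) = ENNReal.ofReal 4 by norm_num, ← ENNReal.ofReal_mul (by norm_num),
      ENNReal.ofReal_le_ofReal_iff (by positivity)] at hint
    have := integral_norm_fderiv_mollify_le b ho.measurableSet hb hP
    rw [← hu] at this
    linarith
  have ht : Tendsto (fun l : ℝ => l * ∫ θ in (0 : ℝ)..2 * π, supportFn Ω θ) (𝓝[<] 1)
      (𝓝 (1 * ∫ θ in (0 : ℝ)..2 * π, supportFn Ω θ)) := by
    refine Tendsto.mono_left ?_ nhdsWithin_le_nhds
    exact Continuous.tendsto (by fun_prop) 1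
  rw [one_mul] at ht
  refine le_of_tendsto ht ?_
  filter_upwards [Ioo_mem_nhdsLT (zero_lt_one (α := ℝ))] with l hl using key l hl

end RieszIsoperimetric

namespace RieszIsoperimetric

open Real Set Filter Topology

/-! ### A Wirtinger inequality -/

/-- Wirtinger's inequality for functions orthogonal to the Fourier modes of order at most one. -/
lemma four_mul_integral_sq_le {g g' : ℝ → ℝ} (hg : ∀ θ, HasDerivAt g (g' θ) θ)
    (hg' : Continuous g') (hper : g (2 * π) = g 0)
    (h0 : ∫ θ in (0 : ℝ)..2 * π, g θ = 0)
    (hcos : ∫ θ in (0 : ℝ)..2 * π, g θ * cos θ = 0)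
    (hsin : ∫ θ in (0 : ℝ)..2 * π, g θ * sin θ = 0) :
    4 * ∫ θ in (0 : ℝ)..2 * π, g θ ^ 2 ≤ ∫ θ in (0 : ℝ)..2 * π, g' θ ^ 2 := by
  have hpi : (0 : ℝ) < 2 * π := by positivity
  have hgc : Continuous g := continuous_iff_continuousAt.2 fun θ => (hg θ).continuousAt
  set f : ℝ → ℂ := fun θ => (g θ : ℂ) with hf
  set f' : ℝ → ℂ := fun θ => (g' θ : ℂ) with hf'
  have hfc : Continuous f := Complex.continuous_ofReal.comp hgc
  have hfc' : Continuous f' := Complex.continuous_ofReal.comp hg'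
  have hmem : ∀ u : ℝ → ℂ, Continuous u → MemLp u 2 (volume.restrict (Ioc 0 (2 * π))) := by
    intro u hu
    obtain ⟨C, hC⟩ := (isCompact_Icc (a := (0 : ℝ)) (b := 2 * π)).exists_bound_of_continuousOn
      hu.continuousOn
    refine MemLp.of_bound hu.aestronglyMeasurable C ?_
    filter_upwards [ae_restrict_mem measurableSet_Ioc] with x hx
    exact hC x (Ioc_subset_Icc_self hx)
  have hS := hasSum_sq_fourierCoeffOn hpi (hmem f hfc)
  have hS' := hasSum_sq_fourierCoeffOn hpi (hmem f' hfc')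
  -- the coefficients of order `-1, 0, 1` of `f` vanish
  have hcoef : ∀ n : ℤ, fourierCoeffOn hpi f n = (1 / (2 * π) : ℝ) •
      ∫ θ in (0 : ℝ)..2 * π, ((g θ * cos (n * θ) : ℝ) - (g θ * sin (n * θ) : ℝ) * Complex.I) := by
    intro n
    rw [fourierCoeffOn_eq_integral]
    simp only [sub_zero]
    congr 1
    refine intervalIntegral.integral_congr fun θ _ => ?_
    simp only [hf, fourier_coe_apply, smul_eq_mul]
    rw [show 2 * (π : ℂ) * Complex.I * ((-n : ℤ) : ℂ) * (θ : ℂ) / ((2 * π - 0 : ℝ) : ℂ)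
      = ((-(n * θ) : ℝ) : ℂ) * Complex.I by
        have : (π : ℂ) ≠ 0 := by exact_mod_cast Real.pi_ne_zero
        push_cast
        field_simp
        ring, Complex.exp_mul_I, ← Complex.ofReal_cos, ← Complex.ofReal_sin, cos_neg, sin_neg]
    push_cast
    ring
  have hsplit : ∀ n : ℤ, ∫ θ in (0 : ℝ)..2 * π,
      (((g θ * cos (n * θ) : ℝ) : ℂ) - (g θ * sin (n * θ) : ℝ) * Complex.I)
      = ((∫ θ in (0 : ℝ)..2 * π, g θ * cos (n * θ) : ℝ) : ℂ)
        - ((∫ θ in (0 : ℝ)..2 * π, g θ * sin (n * θ) : ℝ) : ℂ) * Complex.I := by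
    intro n
    rw [intervalIntegral.integral_sub (Continuous.intervalIntegrable (by fun_prop) _ _)
      (Continuous.intervalIntegrable (by fun_prop) _ _), intervalIntegral.integral_mul_const,
      intervalIntegral.integral_ofReal, intervalIntegral.integral_ofReal]
  have hz : ∀ n : ℤ, n.natAbs ≤ 1 → fourierCoeffOn hpi f n = 0 := by
    intro n hn
    rw [hcoef, hsplit]
    have : n = 0 ∨ n = 1 ∨ n = -1 := by omega
    rcases this with rfl | rfl | rfl
    · simp [h0]
    · simp [hcos, hsin]
    · simp [hcos, hsin]
  have hderiv : ∀ n : ℤ, n ≠ 0 →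
      ‖fourierCoeffOn hpi f' n‖ = |(n : ℝ)| * ‖fourierCoeffOn hpi f n‖ := by
    intro n hn
    have h := fourierCoeffOn_of_hasDerivAt hpi hn (f := f) (f' := f')
      (fun x _ => (hg x).ofReal_comp) (hfc'.intervalIntegrable _ _)
    have h1 : f (2 * π) - f 0 = 0 := by simp [hf, hper]
    rw [h1, mul_zero, zero_sub] at h
    rw [h, norm_mul, norm_neg, norm_mul]
    have hn' : |(n : ℝ)| ≠ 0 := by simpa using hn
    have e1 : ‖(1 / (-2 * (π : ℂ) * Complex.I * n))‖ = 1 / (2 * π * |(n : ℝ)|) := by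
      simp [abs_of_pos Real.pi_pos]
    have e2 : ‖((2 * π : ℝ) : ℂ) - ((0 : ℝ) : ℂ)‖ = 2 * π := by
      simp [abs_of_pos Real.pi_pos]
    rw [e1, e2]
    field_simp
  have hle : ∀ n : ℤ, 4 * ‖fourierCoeffOn hpi f n‖ ^ 2 ≤ ‖fourierCoeffOn hpi f' n‖ ^ 2 := by
    intro n
    by_cases hn : n.natAbs ≤ 1
    · rw [hz n hn]; simp
    · rw [hderiv n (by omega), mul_pow]
      have h2 : (2 : ℝ) ≤ |(n : ℝ)| := by
        rw [← Int.cast_abs, ← Nat.cast_natAbs]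
        have : 2 ≤ n.natAbs := by omega
        exact_mod_cast this
      have h4 : (4 : ℝ) ≤ |(n : ℝ)| ^ 2 := by nlinarith
      gcongr
  have h := hasSum_le hle (hS.mul_left 4) hS'
  have en : ∀ u : ℝ → ℝ, ∫ θ in (0 : ℝ)..2 * π, ‖((u θ : ℝ) : ℂ)‖ ^ 2
      = ∫ θ in (0 : ℝ)..2 * π, u θ ^ 2 := by
    intro u
    refine intervalIntegral.integral_congr fun θ _ => ?_
    simp
  simp only [hf, hf', en, smul_eq_mul, sub_zero] at h
  rw [mul_left_comm] at h
  exact le_of_mul_le_mul_left h (by positivity)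

/-! ### Smooth support functions -/

/-- The bound of `integral_max_pow_three_le` for the integral of the cube of a centred support
function of mean `a`, for sets of area at least `π`. -/
noncomputable def cubicBound (a : ℝ) : ℝ :=
  2 * π * a ^ 3 + 2 * π * a * (a ^ 2 - 1)
    + 8 * π ^ 2 / 3 * √((a ^ 2 - 1) / 3) * (a ^ 2 - 1)

/-- The second derivative is symmetric on periodic functions. -/
lemma integral_mul_deriv_two {ℓ ℓ' ℓ'' k k' k'' : ℝ → ℝ}
    (hl : ∀ θ, HasDerivAt ℓ (ℓ' θ) θ) (hl' : ∀ θ, HasDerivAt ℓ' (ℓ'' θ) θ)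
    (hk : ∀ θ, HasDerivAt k (k' θ) θ) (hk' : ∀ θ, HasDerivAt k' (k'' θ) θ)
    (hlc : Continuous ℓ'') (hkc : Continuous k'')
    (e1 : ℓ (2 * π) = ℓ 0) (e2 : ℓ' (2 * π) = ℓ' 0) (e3 : k (2 * π) = k 0)
    (e4 : k' (2 * π) = k' 0) :
    ∫ θ in (0 : ℝ)..2 * π, ℓ θ * k'' θ = ∫ θ in (0 : ℝ)..2 * π, ℓ'' θ * k θ := by
  have c1 : Continuous ℓ := continuous_iff_continuousAt.2 fun θ => (hl θ).continuousAt
  have c2 : Continuous k := continuous_iff_continuousAt.2 fun θ => (hk θ).continuousAt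
  have hF : ∀ θ, HasDerivAt (fun θ => ℓ θ * k' θ - ℓ' θ * k θ)
      (ℓ θ * k'' θ - ℓ'' θ * k θ) θ := by
    intro θ
    exact (((hl θ).mul (hk' θ)).sub ((hl' θ).mul (hk θ))).congr_deriv (by ring)
  have h := intervalIntegral.integral_eq_sub_of_hasDerivAt (a := 0) (b := 2 * π)
    (fun θ _ => hF θ) (Continuous.intervalIntegrable (by fun_prop) _ _)
  rw [intervalIntegral.integral_sub (Continuous.intervalIntegrable (by fun_prop) _ _)
    (Continuous.intervalIntegrable (by fun_prop) _ _), e1, e2, e3, e4] at h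
  linarith

/-- A function of mean zero over the period is bounded by the `L²` norm of its derivative. -/
lemma abs_le_sqrt_of_integral_eq_zero {g g' : ℝ → ℝ} (hgd : ∀ θ, HasDerivAt g (g' θ) θ)
    (c1 : Continuous g') (hg0 : ∫ θ in (0 : ℝ)..2 * π, g θ = 0) :
    ∀ θ ∈ Icc 0 (2 * π), |g θ| ≤ √(2 * π * ∫ t in (0 : ℝ)..2 * π, g' t ^ 2) := by
  have hpi := Real.pi_pos
  have cg : Continuous g := continuous_iff_continuousAt.2 fun θ => (hgd θ).continuousAt
  have ii : ∀ {u : ℝ → ℝ}, Continuous u → IntervalIntegrable u volume 0 (2 * π) :=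
    fun h => h.intervalIntegrable _ _
  have hzero : ∃ θ₀ ∈ Icc 0 (2 * π), g θ₀ = 0 := by
    by_contra! hne
    have hcon : ∀ θ ∈ Icc 0 (2 * π), ∀ φ ∈ Icc 0 (2 * π), g θ < 0 → 0 < g φ → False := by
      intro θ hθ φ hφ h1 h2
      obtain ⟨ψ, hψ, hψ0⟩ := (isPreconnected_Icc (a := (0 : ℝ)) (b := 2 * π)).intermediate_value
        hθ hφ cg.continuousOn (show (0 : ℝ) ∈ Icc (g θ) (g φ) from ⟨h1.le, h2.le⟩)
      exact hne ψ hψ hψ0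
    have hz : (0 : ℝ) ∈ Icc 0 (2 * π) := ⟨le_rfl, by positivity⟩
    rcases lt_or_gt_of_ne (hne 0 hz) with h | h
    · have : 0 < ∫ θ in (0 : ℝ)..2 * π, -g θ := by
        refine intervalIntegral.intervalIntegral_pos_of_pos_on (ii cg.neg) (fun θ hθ => ?_)
          (by positivity)
        have hθ' := Ioo_subset_Icc_self hθ
        rcases lt_or_gt_of_ne (hne θ hθ') with h' | h'
        · linarith
        · exact (hcon 0 hz θ hθ' h h').elim
      rw [intervalIntegral.integral_neg, hg0] at this
      simp at this
    · have : 0 < ∫ θ in (0 : ℝ)..2 * π, g θ := by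
        refine intervalIntegral.intervalIntegral_pos_of_pos_on (ii cg) (fun θ hθ => ?_)
          (by positivity)
        have hθ' := Ioo_subset_Icc_self hθ
        rcases lt_or_gt_of_ne (hne θ hθ') with h' | h'
        · exact (hcon θ hθ' 0 hz h' h).elim
        · exact h'
      rw [hg0] at this
      exact this.ne rfl
  set J := ∫ t in (0 : ℝ)..2 * π, g' t ^ 2 with hJ
  obtain ⟨θ₀, hθ₀, hg₀⟩ := hzero
  intro θ hθ
  have h1 : g θ = ∫ t in θ₀..θ, g' t := by
    rw [intervalIntegral.integral_eq_sub_of_hasDerivAt (fun t _ => hgd t)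
      (c1.intervalIntegrable _ _), hg₀, sub_zero]
  have h2 : |g θ| ≤ ∫ t in (0 : ℝ)..2 * π, |g' t| := by
    rw [h1, ← Real.norm_eq_abs,
      intervalIntegral.integral_of_le (by positivity : (0 : ℝ) ≤ 2 * π)]
    refine (intervalIntegral.norm_integral_le_integral_norm_uIoc).trans ?_
    refine setIntegral_mono_set (c1.abs.integrableOn_Icc.mono_set Ioc_subset_Icc_self)
      (Eventually.of_forall fun t => abs_nonneg _) (Eventually.of_forall fun t ht => ?_)
    exact ⟨(le_min hθ₀.1 hθ.1).trans_lt ht.1, ht.2.trans (max_le hθ₀.2 hθ.2)⟩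
  have h3 : (∫ t in (0 : ℝ)..2 * π, |g' t|) ≤ √(2 * π * J) := by
    set S := ∫ t in (0 : ℝ)..2 * π, |g' t| with hS
    have hS0 : 0 ≤ S := intervalIntegral.integral_nonneg (by positivity)
      fun t _ => abs_nonneg _
    have hvar : 0 ≤ ∫ t in (0 : ℝ)..2 * π, (|g' t| - S / (2 * π)) ^ 2 :=
      intervalIntegral.integral_nonneg (by positivity) fun t _ => sq_nonneg _
    have hexp : ∀ t, (|g' t| - S / (2 * π)) ^ 2
        = g' t ^ 2 - 2 * (S / (2 * π)) * |g' t| + (S / (2 * π)) ^ 2 := fun t => by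
      rw [← sq_abs (g' t)]; ring
    simp only [hexp] at hvar
    rw [intervalIntegral.integral_add (ii (by fun_prop)) (ii (by fun_prop)),
      intervalIntegral.integral_sub (ii (by fun_prop)) (ii (by fun_prop)),
      intervalIntegral.integral_const_mul, ← hS, ← hJ, intervalIntegral.integral_const,
      smul_eq_mul, sub_zero] at hvar
    have hSJ : S ^ 2 ≤ 2 * π * J := by
      have : J - 2 * (S / (2 * π)) * S + 2 * π * (S / (2 * π)) ^ 2 = J - S ^ 2 / (2 * π) := by
        field_simp
        ring
      rw [this] at hvar
      have h4 : S ^ 2 / (2 * π) ≤ J := by linarith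
      rwa [div_le_iff₀ (by positivity), mul_comm] at h4
    exact Real.le_sqrt_of_sq_le hSJ
  exact h2.trans h3

/-- A quantitative isoperimetric inequality for support functions: a centred periodic `k` of mean
`a` whose area functional `½ ∫ k (k + k'')` is at least `π` has `a ≥ 1` and a cubic moment close
to that of the constant function. -/
lemma integral_max_pow_three_le {k k' k'' : ℝ → ℝ}
    (hk : ∀ θ, HasDerivAt k (k' θ) θ) (hk' : ∀ θ, HasDerivAt k' (k'' θ) θ)
    (hkc : Continuous k'') (hp : Function.Periodic k (2 * π)) {a : ℝ} (ha : 0 ≤ a)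
    (hmean : ∫ θ in (0 : ℝ)..2 * π, k θ = 2 * π * a)
    (hcos : ∫ θ in (0 : ℝ)..2 * π, k θ * cos θ = 0)
    (hsin : ∫ θ in (0 : ℝ)..2 * π, k θ * sin θ = 0)
    (harea : π ≤ 1 / 2 * ∫ θ in (0 : ℝ)..2 * π, k θ * (k θ + k'' θ)) :
    1 ≤ a ∧ ∫ θ in (0 : ℝ)..2 * π, max (k θ) 0 ^ 3 ≤ cubicBound a := by
  have hpi := Real.pi_pos
  have c0 : Continuous k := continuous_iff_continuousAt.2 fun θ => (hk θ).continuousAt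
  have c1 : Continuous k' := continuous_iff_continuousAt.2 fun θ => (hk' θ).continuousAt
  have ii : ∀ {u : ℝ → ℝ}, Continuous u → IntervalIntegrable u volume 0 (2 * π) :=
    fun h => h.intervalIntegrable _ _
  have e3 : k (2 * π) = k 0 := by simpa using hp 0
  have e4 : k' (2 * π) = k' 0 := by
    have h1 : HasDerivAt (fun θ => k (θ + 2 * π)) (k' (0 + 2 * π)) 0 :=
      (hk (0 + 2 * π)).comp_add_const 0 (2 * π)
    rw [show (fun θ => k (θ + 2 * π)) = k from funext hp, zero_add] at h1
    exact h1.unique (hk 0)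
  set g : ℝ → ℝ := fun θ => k θ - a with hg
  have cg : Continuous g := c0.sub continuous_const
  have hgd : ∀ θ, HasDerivAt g (k' θ) θ := fun θ => (hk θ).sub_const a
  have hg0 : ∫ θ in (0 : ℝ)..2 * π, g θ = 0 := by
    simp only [hg]
    rw [intervalIntegral.integral_sub (ii c0) (ii continuous_const), hmean]
    simp
  have hgcos : ∫ θ in (0 : ℝ)..2 * π, g θ * cos θ = 0 := by
    simp only [hg, sub_mul]
    rw [intervalIntegral.integral_sub (ii (by fun_prop)) (ii (by fun_prop)), hcos]
    simp
  have hgsin : ∫ θ in (0 : ℝ)..2 * π, g θ * sin θ = 0 := by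
    simp only [hg, sub_mul]
    rw [intervalIntegral.integral_sub (ii (by fun_prop)) (ii (by fun_prop)), hsin]
    simp
  have hW := four_mul_integral_sq_le hgd c1 (by simp [hg, e3]) hg0 hgcos hgsin
  set I := ∫ θ in (0 : ℝ)..2 * π, g θ ^ 2 with hI
  set J := ∫ θ in (0 : ℝ)..2 * π, k' θ ^ 2 with hJ
  have hI0 : 0 ≤ I := intervalIntegral.integral_nonneg (by positivity) fun θ _ => sq_nonneg _
  have hksq : ∫ θ in (0 : ℝ)..2 * π, k θ ^ 2 = 2 * π * a ^ 2 + I := by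
    have : ∀ θ, k θ ^ 2 = a ^ 2 + 2 * a * g θ + g θ ^ 2 := fun θ => by simp only [hg]; ring
    simp only [this]
    rw [intervalIntegral.integral_add (ii (by fun_prop)) (ii (by fun_prop)),
      intervalIntegral.integral_add (ii (by fun_prop)) (ii (by fun_prop)),
      intervalIntegral.integral_const_mul, hg0]
    simp [hI]
  have hkk : ∫ θ in (0 : ℝ)..2 * π, k θ * (k θ + k'' θ) = 2 * π * a ^ 2 + I - J := by
    have hF : ∀ θ, HasDerivAt (fun θ => k θ * k' θ) (k θ * k'' θ + k' θ ^ 2) θ := by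
      intro θ
      exact ((hk θ).mul (hk' θ)).congr_deriv (by ring)
    have h := intervalIntegral.integral_eq_sub_of_hasDerivAt (a := 0) (b := 2 * π)
      (fun θ _ => hF θ) (ii (by fun_prop))
    rw [intervalIntegral.integral_add (ii (by fun_prop)) (ii (by fun_prop)), e3, e4] at h
    have : ∀ θ, k θ * (k θ + k'' θ) = k θ ^ 2 + k θ * k'' θ := fun θ => by ring
    simp only [this]
    rw [intervalIntegral.integral_add (ii (by fun_prop)) (ii (by fun_prop)), hksq]
    linarith
  rw [hkk] at harea
  set Y := a ^ 2 - 1 with hY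
  have hJI : J - I ≤ 2 * π * Y := by rw [hY]; linarith
  -- Wirtinger's inequality `4 I ≤ J` and `J - I ≤ 2 π Y` bound both integrals
  have hIY : I ≤ 2 * π / 3 * Y := by linarith
  have hJY : J ≤ 8 * π / 3 * Y := by linarith
  have hY0 : 0 ≤ Y := by
    by_contra! h
    nlinarith
  refine ⟨by nlinarith, ?_⟩
  -- the cubic term of `(a + g) ^ 3` is absorbed in the quadratic one through a bound of `|g|`
  have hsup : ∀ θ ∈ Icc 0 (2 * π), |g θ| ≤ 4 * π * √(Y / 3) := by
    intro θ hθ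
    refine (abs_le_sqrt_of_integral_eq_zero hgd c1 hg0 θ hθ).trans ?_
    rw [← hJ, Real.sqrt_le_left (by positivity), mul_pow, Real.sq_sqrt (by positivity)]
    nlinarith
  set M := 4 * π * √(Y / 3) with hM
  have hM0 : 0 ≤ M := by positivity
  have hpt : ∀ θ ∈ Icc 0 (2 * π),
      max (k θ) 0 ^ 3 ≤ a ^ 3 + 3 * a ^ 2 * g θ + (3 * a + M) * g θ ^ 2 := by
    intro θ hθ
    have h1 := hsup θ hθ
    have h2 := abs_le.1 h1
    have hkg : k θ = a + g θ := by simp only [hg]; ring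
    have h4 : |g θ| * g θ ^ 2 ≤ M * g θ ^ 2 := by gcongr
    rcases le_total 0 (k θ) with h | h
    · rw [max_eq_left h, hkg]
      have h3 : g θ * g θ ^ 2 ≤ |g θ| * g θ ^ 2 := by gcongr; exact le_abs_self _
      have h5 : (a + g θ) ^ 3 = a ^ 3 + 3 * a ^ 2 * g θ + 3 * a * g θ ^ 2 + g θ * g θ ^ 2 := by
        ring
      rw [h5, add_mul]
      linarith
    · rw [max_eq_right h]
      rw [hkg] at h
      rw [abs_of_nonpos (by linarith)] at h4
      set t := -g θ with ht
      have hgt : g θ = -t := by rw [ht]; ring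
      rw [hgt] at h4 ⊢
      have hta : a ≤ t := by linarith
      have h5 : 0 ≤ a ^ 3 - 3 * a ^ 2 * t + 3 * a * t ^ 2 + t ^ 3 := by
        have h6 : 0 ≤ t * (t ^ 2 - a ^ 2) := mul_nonneg (by linarith) (by nlinarith)
        nlinarith [mul_nonneg ha (sq_nonneg (t - a)), pow_nonneg ha 3,
          mul_nonneg ha (sq_nonneg t)]
      rw [neg_sq] at h4 ⊢
      have h7 : t ^ 3 = t * t ^ 2 := by ring
      have h8 : 3 * a ^ 2 * -t = -(3 * a ^ 2 * t) := by ring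
      rw [add_mul, h8]
      norm_num
      linarith
  have hint := intervalIntegral.integral_mono_on (by positivity : (0 : ℝ) ≤ 2 * π)
    (ii (by fun_prop)) (ii (by fun_prop)) hpt
  refine hint.trans ?_
  rw [intervalIntegral.integral_add (ii (by fun_prop)) (ii (by fun_prop)),
    intervalIntegral.integral_add (ii (by fun_prop)) (ii (by fun_prop)),
    intervalIntegral.integral_const_mul, intervalIntegral.integral_const_mul, hg0]
  have hfin : (3 * a + M) * I ≤ (3 * a + M) * (2 * π / 3 * Y) :=
    mul_le_mul_of_nonneg_left hIY (by positivity)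
  simp only [intervalIntegral.integral_const, smul_eq_mul, sub_zero, mul_zero, add_zero,
    cubicBound]
  refine (add_le_add_right hfin _).trans (le_of_eq ?_)
  rw [hM]
  ring

end RieszIsoperimetric

namespace RieszIsoperimetric

open Real Set Filter Topology

/-! ### The area of a set with a smooth support function -/

section area

variable {k k' k'' : ℝ → ℝ}

/-- The point at ratio `r` between the origin and the boundary point with normal direction `θ` of
the convex set with support function `k`. -/
noncomputable def boundaryMap (k k' : ℝ → ℝ) (p : ℝ × ℝ) : ℝ × ℝ :=
  (p.1 * (k p.2 * cos p.2 - k' p.2 * sin p.2), p.1 * (k p.2 * sin p.2 + k' p.2 * cos p.2))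

/-- The derivative of `boundaryMap`. -/
noncomputable def fderivBoundaryMap (k k' k'' : ℝ → ℝ) (p : ℝ × ℝ) : ℝ × ℝ →L[ℝ] ℝ × ℝ :=
  (Matrix.toLin (.finTwoProd ℝ) (.finTwoProd ℝ)
    !![k p.2 * cos p.2 - k' p.2 * sin p.2, p.1 * (-(k p.2 + k'' p.2) * sin p.2);
      k p.2 * sin p.2 + k' p.2 * cos p.2,
        p.1 * ((k p.2 + k'' p.2) * cos p.2)]).toContinuousLinearMap

lemma hasFDerivAt_boundaryMap (hk : ∀ θ, HasDerivAt k (k' θ) θ)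
    (hk' : ∀ θ, HasDerivAt k' (k'' θ) θ) (p : ℝ × ℝ) :
    HasFDerivAt (boundaryMap k k') (fderivBoundaryMap k k' k'' p) p := by
  have h1 : HasDerivAt (fun θ => k θ * cos θ - k' θ * sin θ)
      (-(k p.2 + k'' p.2) * sin p.2) p.2 :=
    (((hk p.2).mul (hasDerivAt_cos p.2)).sub ((hk' p.2).mul (hasDerivAt_sin p.2))).congr_deriv
      (by ring)
  have h2 : HasDerivAt (fun θ => k θ * sin θ + k' θ * cos θ)
      ((k p.2 + k'' p.2) * cos p.2) p.2 :=
    (((hk p.2).mul (hasDerivAt_sin p.2)).add ((hk' p.2).mul (hasDerivAt_cos p.2))).congr_deriv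
      (by ring)
  unfold fderivBoundaryMap
  rw [Matrix.toLin_finTwoProd_toContinuousLinearMap]
  convert!
    HasFDerivAt.prodMk (𝕜 := ℝ)
      (hasFDerivAt_fst.mul (h1.comp_hasFDerivAt p hasFDerivAt_snd))
      (hasFDerivAt_fst.mul (h2.comp_hasFDerivAt p hasFDerivAt_snd)) using 2 <;>
  simp [smul_smul, add_comm]

lemma det_fderivBoundaryMap (p : ℝ × ℝ) :
    (fderivBoundaryMap k k' k'' p).det = p.1 * (k p.2 * (k p.2 + k'' p.2)) := by
  unfold fderivBoundaryMap
  simp only [LinearMap.det_toContinuousLinearMap, LinearMap.det_toLin,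
    Matrix.det_fin_two_of]
  linear_combination (p.1 * (k p.2 * (k p.2 + k'' p.2))) * sin_sq_add_cos_sq p.2

/-- The maximum over `θ` of `⟪x, dir θ⟫ / k θ` singles out the normal direction `θ` at the boundary
point on the ray through `x`. -/
lemma exists_boundaryMap_eq (hk : ∀ θ, HasDerivAt k (k' θ) θ)
    (hp : Function.Periodic k (2 * π)) (hpos : ∀ θ, 0 < k θ) {x : Plane}
    (hx : ∀ θ, inner ℝ x (dir θ) ≤ k θ) :
    ∃ p ∈ Icc (0 : ℝ) 1 ×ˢ Icc 0 (2 * π), ofProd (boundaryMap k k' p) = x := by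
  have hkc : Continuous k := continuous_iff_continuousAt.2 fun θ => (hk θ).continuousAt
  set q : ℝ → ℝ := fun θ => inner ℝ x (dir θ) / k θ with hq
  have hqc : Continuous q :=
    (continuous_const.inner continuous_dir).div hkc fun θ => (hpos θ).ne'
  have hqp : Function.Periodic q (2 * π) := fun θ => by
    simp only [hq, dir_add_two_pi, hp θ]
  obtain ⟨t, ht, hmax⟩ := (isCompact_Icc (a := (0 : ℝ)) (b := 2 * π)).exists_isMaxOn
    ⟨0, le_rfl, by positivity⟩ hqc.continuousOn
  have hglob : ∀ θ, q θ ≤ q t := by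
    intro θ
    obtain ⟨θ', hθ', he⟩ := hqp.exists_mem_Ico₀ (by positivity) θ
    rw [he]
    exact hmax (Ico_subset_Icc_self hθ')
  have hder : HasDerivAt q ((inner ℝ x (dir (t + π / 2)) * k t - inner ℝ x (dir t) * k' t)
      / k t ^ 2) t := by
    have h1 : HasDerivAt (fun θ => inner ℝ x (dir θ)) (inner ℝ x (dir (t + π / 2))) t := by
      have := (hasDerivAt_const t x).inner ℝ (hasDerivAt_dir t)
      simpa using this
    exact h1.div (hk t) (hpos t).ne'
  have hz := IsLocalMax.hasDerivAt_eq_zero (Eventually.of_forall hglob) hder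
  have hk2 : k t ^ 2 ≠ 0 := pow_ne_zero _ (hpos t).ne'
  have hz' : inner ℝ x (dir (t + π / 2)) * k t = inner ℝ x (dir t) * k' t := by
    have := (div_eq_zero_iff.1 hz).resolve_right hk2
    linarith
  have hr : inner ℝ x (dir t) = q t * k t := by
    simp only [hq]
    field_simp [(hpos t).ne']
  have hr' : inner ℝ x (dir (t + π / 2)) = q t * k' t := by
    have h3 : inner ℝ x (dir (t + π / 2)) * k t = (q t * k' t) * k t := by
      rw [hz', hr]; ring
    exact mul_right_cancel₀ (hpos t).ne' h3
  refine ⟨(q t, t), ⟨⟨?_, ?_⟩, ht⟩, ?_⟩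
  · obtain ⟨a, ha⟩ := exists_eq_smul_dir x
    refine le_trans ?_ (hglob a)
    refine div_nonneg ?_ (hpos a).le
    rw [ha, real_inner_smul_left, inner_dir_dir]
    simp
  · exact (div_le_one (hpos t)).2 (hx t)
  · rw [inner_dir] at hr hr'
    rw [cos_add_pi_div_two, sin_add_pi_div_two] at hr'
    ext i
    fin_cases i
    · simp only [ofProd_apply, boundaryMap, Fin.zero_eta, Fin.isValue, PiLp.toLp_apply,
        Matrix.cons_val_zero]
      linear_combination (-cos t) * hr + sin t * hr' + x 0 * sin_sq_add_cos_sq t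
    · simp only [ofProd_apply, boundaryMap, Fin.mk_one, Fin.isValue, PiLp.toLp_apply,
        Matrix.cons_val_one, Matrix.cons_val_fin_one]
      linear_combination (-sin t) * hr - cos t * hr' + x 1 * sin_sq_add_cos_sq t

/-- The area of a set whose support function is at most `k` is at most the area functional
`½ ∫ k (k + k'')`. -/
lemma volume_le_of_inner_le (hk : ∀ θ, HasDerivAt k (k' θ) θ)
    (hk' : ∀ θ, HasDerivAt k' (k'' θ) θ) (hkc : Continuous k'')
    (hp : Function.Periodic k (2 * π)) (hpos : ∀ θ, 0 < k θ) (hcurv : ∀ θ, 0 ≤ k θ + k'' θ)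
    {F : Set Plane} (hF : ∀ x ∈ F, ∀ θ, inner ℝ x (dir θ) ≤ k θ) :
    volume F ≤ ENNReal.ofReal (1 / 2 * ∫ θ in (0 : ℝ)..2 * π, k θ * (k θ + k'' θ)) := by
  have c0 : Continuous k := continuous_iff_continuousAt.2 fun θ => (hk θ).continuousAt
  set S : Set (ℝ × ℝ) := Icc (0 : ℝ) 1 ×ˢ Icc 0 (2 * π) with hS
  have hSm : MeasurableSet S := measurableSet_Icc.prod measurableSet_Icc
  have hsub : F ⊆ ofProd '' (boundaryMap k k' '' S) := by
    intro x hx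
    obtain ⟨p, hp, he⟩ := exists_boundaryMap_eq hk hp hpos (hF x hx)
    exact ⟨_, mem_image_of_mem _ hp, he⟩
  have hvol : ∀ A : Set (ℝ × ℝ), volume (ofProd '' A) = volume A := by
    intro A
    rw [← MeasurableEquiv.preimage_symm]
    exact measurePreserving_ofProd.symm.measure_preimage_equiv A
  calc volume F ≤ volume (ofProd '' (boundaryMap k k' '' S)) := measure_mono hsub
    _ = volume (boundaryMap k k' '' S) := hvol _
    _ ≤ ∫⁻ p in S, ENNReal.ofReal |(fderivBoundaryMap k k' k'' p).det| :=
        addHaar_image_le_lintegral_abs_det_fderiv volume hSm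
          fun p _ => (hasFDerivAt_boundaryMap hk hk' p).hasFDerivWithinAt
    _ = ∫⁻ p in S, ENNReal.ofReal p.1 * ENNReal.ofReal (k p.2 * (k p.2 + k'' p.2)) := by
        refine setLIntegral_congr_fun hSm fun p hp => ?_
        rw [det_fderivBoundaryMap, abs_of_nonneg (mul_nonneg hp.1.1
          (mul_nonneg (hpos _).le (hcurv _))), ENNReal.ofReal_mul hp.1.1]
    _ = (∫⁻ r in Icc (0 : ℝ) 1, ENNReal.ofReal r)
        * ∫⁻ θ in Icc 0 (2 * π), ENNReal.ofReal (k θ * (k θ + k'' θ)) := by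
        rw [hS, Measure.volume_eq_prod, ← Measure.prod_restrict,
          lintegral_prod_mul (f := ENNReal.ofReal)
            (g := fun θ => ENNReal.ofReal (k θ * (k θ + k'' θ)))]
        · exact ENNReal.measurable_ofReal.aemeasurable
        · exact (ENNReal.measurable_ofReal.comp
            (c0.mul (c0.add hkc)).measurable).aemeasurable
    _ = _ := by
        rw [← ofReal_integral_eq_lintegral_ofReal, ← ofReal_integral_eq_lintegral_ofReal,
          integral_Icc_eq_integral_Ioc, integral_Icc_eq_integral_Ioc,
          ← intervalIntegral.integral_of_le zero_le_one,
          ← intervalIntegral.integral_of_le (by positivity), integral_id,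
          ← ENNReal.ofReal_mul (by norm_num)]
        · norm_num
        · exact (c0.mul (c0.add hkc)).integrableOn_Icc
        · exact Eventually.of_forall fun θ => mul_nonneg (hpos _).le (hcurv _)
        · exact continuous_id.integrableOn_Icc
        · filter_upwards [ae_restrict_mem measurableSet_Icc] with r hr using hr.1

end area

/-! ### Smooth majorants of support functions -/

section smoothing

open ContinuousLinearMap
open scoped Convolution

variable (b : ContDiffBump (0 : ℝ)) {h : ℝ → ℝ}

/-- The mollification of `h` by the normalized bump function `b`. -/
noncomputable def mollifyReal (b : ContDiffBump (0 : ℝ)) (h : ℝ → ℝ) : ℝ → ℝ :=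
  b.normed volume ⋆[lsmul ℝ ℝ, volume] h

lemma mollifyReal_apply (h : ℝ → ℝ) (θ : ℝ) :
    mollifyReal b h θ = ∫ t, b.normed volume t * h (θ - t) := rfl

lemma contDiff_mollifyReal (hc : Continuous h) {n : ℕ∞} : ContDiff ℝ n (mollifyReal b h) :=
  b.hasCompactSupport_normed.contDiff_convolution_left _ b.contDiff_normed hc.locallyIntegrable

lemma integrable_normed_mul {u : ℝ → ℝ} (hu : Continuous u) :
    Integrable fun t => b.normed volume t * u t :=
  (b.continuous_normed.mul hu).integrable_of_hasCompactSupport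
    ((b.hasCompactSupport_normed (μ := volume)).of_eq_zero fun t ht => by simp [ht])

/-- Integrating a mollified periodic function against a periodic weight. -/
lemma integral_mollifyReal_mul (hc : Continuous h) (hp : Function.Periodic h (2 * π))
    {w : ℝ → ℝ} (hw : Continuous w) (hwp : Function.Periodic w (2 * π)) :
    ∫ θ in (0 : ℝ)..2 * π, mollifyReal b h θ * w θ
      = ∫ t, b.normed volume t * ∫ θ in (0 : ℝ)..2 * π, h θ * w (θ + t) := by
  have h1 : ∀ θ, mollifyReal b h θ * w θ = ∫ t, b.normed volume t * (h (θ - t) * w θ) := by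
    intro θ
    rw [mollifyReal_apply, ← integral_mul_const]
    simp only [mul_assoc]
  simp only [h1]
  rw [intervalIntegral.integral_of_le (by positivity), integral_integral_swap]
  · refine integral_congr_ae (Eventually.of_forall fun t => ?_)
    simp only
    rw [integral_const_mul, ← intervalIntegral.integral_of_le (by positivity)]
    congr 1
    have hper : Function.Periodic (fun θ => h θ * w (θ + t)) (2 * π) := by
      intro θ
      simp only
      rw [hp θ, show θ + 2 * π + t = θ + t + 2 * π by ring, hwp]
    have := intervalIntegral.integral_comp_sub_right (a := 0) (b := 2 * π)
      (fun θ => h θ * w (θ + t)) t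
    simp only [sub_add_cancel] at this
    rw [this, show 2 * π - t = (0 - t) + 2 * π by ring, hper.intervalIntegral_add_eq _ 0, zero_add]
  · have hcomp : IsCompact (Icc 0 (2 * π) ×ˢ tsupport (b.normed (volume : Measure ℝ))) :=
      isCompact_Icc.prod b.hasCompactSupport_normed.isCompact
    have hcont : Continuous (Function.uncurry fun θ t =>
        b.normed volume t * (h (θ - t) * w θ)) := by
      have := b.continuous_normed (μ := (volume : Measure ℝ))
      unfold Function.uncurry
      fun_prop
    have hi : IntegrableOn (Function.uncurry fun θ t => b.normed volume t * (h (θ - t) * w θ))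
        (Icc 0 (2 * π) ×ˢ univ) := by
      refine (hcont.continuousOn.integrableOn_compact hcomp).of_forall_sdiff_eq_zero
        (measurableSet_Icc.prod MeasurableSet.univ) ?_
      rintro ⟨θ, t⟩ ⟨⟨h1, -⟩, h2⟩
      have : t ∉ tsupport (b.normed (volume : Measure ℝ)) := fun ht => h2 ⟨h1, ht⟩
      simp [Function.uncurry, image_eq_zero_of_notMem_tsupport this]
    have hi2 := hi.mono_set (prod_mono Ioc_subset_Icc_self subset_rfl : Ioc 0 (2 * π) ×ˢ univ ⊆ _)
    rw [IntegrableOn, Measure.volume_eq_prod, ← Measure.prod_restrict, Measure.restrict_univ]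
      at hi2
    exact hi2

/-- The second-order condition for the inequality `2 cos δ · k θ ≤ k (θ + δ) + k (θ - δ)`, which
is an equality at `δ = 0`. -/
lemma add_deriv_two_nonneg {k k' k'' : ℝ → ℝ} (hk : ∀ θ, HasDerivAt k (k' θ) θ)
    (hk' : ∀ θ, HasDerivAt k' (k'' θ) θ)
    (hsub : ∀ θ δ, 0 < cos δ → 2 * cos δ * k θ ≤ k (θ + δ) + k (θ - δ)) (θ : ℝ) :
    0 ≤ k θ + k'' θ := by
  by_contra! hneg
  set G : ℝ → ℝ := fun δ => k (θ + δ) + k (θ - δ) - 2 * cos δ * k θ with hG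
  have d1 : ∀ δ, HasDerivAt G (k' (θ + δ) - k' (θ - δ) + 2 * sin δ * k θ) δ := by
    intro δ
    have e1 := (hk (θ + δ)).comp_const_add θ δ
    have e2 := (hk (θ - δ)).comp_const_sub θ δ
    have e3 := ((hasDerivAt_cos δ).const_mul 2).mul_const (k θ)
    exact ((e1.add e2).sub e3).congr_deriv (by ring)
  have d2 : HasDerivAt (fun δ => k' (θ + δ) - k' (θ - δ) + 2 * sin δ * k θ)
      (2 * (k θ + k'' θ)) 0 := by
    have e1 := (hk' (θ + 0)).comp_const_add θ 0
    have e2 := (hk' (θ - 0)).comp_const_sub θ 0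
    have e3 := ((hasDerivAt_sin 0).const_mul 2).mul_const (k θ)
    refine ((e1.sub e2).add e3).congr_deriv ?_
    simp
    ring
  have hd : deriv G = fun δ => k' (θ + δ) - k' (θ - δ) + 2 * sin δ * k θ :=
    funext fun δ => (d1 δ).deriv
  have hmax : IsLocalMax G 0 := by
    refine isLocalMax_of_deriv_deriv_neg ?_ ?_ (d1 0).continuousAt
    · rw [hd, d2.deriv]; linarith
    · rw [hd]; simp
  have hG0 : G 0 = 0 := by simp [hG]; ring
  have hcos : ∀ᶠ δ in 𝓝 (0 : ℝ), 0 < cos δ :=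
    continuous_cos.continuousAt.eventually (by simpa using lt_mem_nhds zero_lt_one)
  have hzero : G =ᶠ[𝓝 0] fun _ => 0 := by
    filter_upwards [hmax, hcos] with δ h1 h2
    have := hsub θ δ h2
    rw [hG0] at h1
    refine le_antisymm h1 ?_
    simp only [hG]
    linarith
  have hdz : deriv G =ᶠ[𝓝 0] fun _ => 0 := by
    have := hzero.deriv
    simpa using this
  have h3 : deriv (deriv G) 0 = 0 := by rw [hdz.deriv_eq]; simp
  rw [hd, d2.deriv] at h3
  linarith

/-- A centred support function has smooth majorants with arbitrarily close mean that are again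
centred and satisfy the convexity condition `0 ≤ k + k''`. -/
lemma exists_smooth_majorant {F : Set Plane} (hb : Bornology.IsBounded F) (hne : F.Nonempty)
    (hcos : ∫ θ in (0 : ℝ)..2 * π, supportFn F θ * cos θ = 0)
    (hsin : ∫ θ in (0 : ℝ)..2 * π, supportFn F θ * sin θ = 0) {c : ℝ} (hc : 0 < c) :
    ∃ k k' k'' : ℝ → ℝ, (∀ θ, HasDerivAt k (k' θ) θ) ∧ (∀ θ, HasDerivAt k' (k'' θ) θ) ∧
      Continuous k'' ∧ Function.Periodic k (2 * π) ∧ (∀ θ, supportFn F θ < k θ) ∧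
      (∀ θ, 0 ≤ k θ + k'' θ) ∧
      (∫ θ in (0 : ℝ)..2 * π, k θ = (∫ θ in (0 : ℝ)..2 * π, supportFn F θ) + 2 * π * c) ∧
      (∫ θ in (0 : ℝ)..2 * π, k θ * cos θ = 0) ∧ ∫ θ in (0 : ℝ)..2 * π, k θ * sin θ = 0 := by
  obtain ⟨R, hR⟩ := hb.subset_closedBall (0 : Plane)
  have hL := lipschitzWith_supportFn hne hR
  set h := supportFn F with hh
  have hcont : Continuous h := hL.continuous
  have hper : Function.Periodic h (2 * π) := supportFn_add_two_pi F
  have hR0 : 0 ≤ R := by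
    obtain ⟨x, hx⟩ := hne
    exact (norm_nonneg x).trans (mem_closedBall_zero_iff.1 (hR hx))
  set d := c / (2 * (R + 1)) with hd
  have hd0 : 0 < d := by positivity
  let b : ContDiffBump (0 : ℝ) := ⟨d / 2, d, by linarith, by linarith⟩
  set m := mollifyReal b h with hm
  have hmd : ContDiff ℝ 2 m := contDiff_mollifyReal b hcont (n := 2)
  have hmc : Continuous m := hmd.continuous
  have hmc' : Continuous (mollifyReal b h) := hmc
  have hclose : ∀ θ, |m θ - h θ| ≤ c / 2 := by
    intro θ
    rw [← Real.dist_eq]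
    refine b.dist_normed_convolution_le hcont.aestronglyMeasurable fun x hx => ?_
    refine (hL.dist_le_mul x θ).trans ?_
    rw [Real.coe_toNNReal _ hR0]
    have h1 : dist x θ ≤ d := hx.le
    calc R * dist x θ ≤ (R + 1) * d := by gcongr; linarith
      _ = c / 2 := by rw [hd]; field_simp
  have hkd : ∀ θ, HasDerivAt (fun θ => m θ + c) (deriv m θ) θ := fun θ =>
    ((hmd.differentiable two_ne_zero) θ).hasDerivAt.add_const c
  have hmd' : ContDiff ℝ 1 (deriv m) := by
    have : ContDiff ℝ (1 + 1) m := by norm_num; exact hmd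
    exact (contDiff_succ_iff_deriv.1 this).2.2
  have hkd' : ∀ θ, HasDerivAt (deriv m) (deriv (deriv m) θ) θ := fun θ =>
    ((hmd'.differentiable one_ne_zero) θ).hasDerivAt
  have hint : ∀ {w : ℝ → ℝ}, Continuous w → Function.Periodic w (2 * π) →
      ∫ θ in (0 : ℝ)..2 * π, (m θ + c) * w θ
        = (∫ t, b.normed volume t * ∫ θ in (0 : ℝ)..2 * π, h θ * w (θ + t))
          + c * ∫ θ in (0 : ℝ)..2 * π, w θ := by
    intro w hw hwp
    rw [← integral_mollifyReal_mul b hcont hper hw hwp, ← intervalIntegral.integral_const_mul,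
      ← intervalIntegral.integral_add (Continuous.intervalIntegrable (by fun_prop) _ _)
      (Continuous.intervalIntegrable (by fun_prop) _ _)]
    refine intervalIntegral.integral_congr fun θ _ => ?_
    simp only [add_mul, hm]
  refine ⟨fun θ => m θ + c, deriv m, deriv (deriv m), hkd, hkd',
    hmd'.continuous_deriv le_rfl, ?_, ?_, ?_, ?_, ?_, ?_⟩
  · intro θ
    simp only [hm, mollifyReal_apply]
    congr 1
    refine integral_congr_ae (Eventually.of_forall fun t => ?_)
    simp only
    rw [show θ + 2 * π - t = θ - t + 2 * π by ring, hper]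
  · intro θ
    have := (abs_le.1 (hclose θ)).1
    linarith
  · refine add_deriv_two_nonneg hkd hkd' fun θ δ hδ => ?_
    have h1 : 2 * cos δ * m θ ≤ m (θ + δ) + m (θ - δ) := by
      simp only [hm, mollifyReal_apply]
      rw [← integral_const_mul, ← integral_add (integrable_normed_mul b (by fun_prop))
        (integrable_normed_mul b (by fun_prop))]
      refine integral_mono ((integrable_normed_mul b (by fun_prop)).const_mul _)
        ((integrable_normed_mul b (by fun_prop)).add (integrable_normed_mul b (by fun_prop)))
        fun t => ?_
      have h2 := two_mul_cos_mul_supportFn_le hb hne (θ - t) hδ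
      have h3 := mul_le_mul_of_nonneg_left h2 (b.nonneg_normed (μ := volume) t)
      simp only [← hh] at h3
      rw [show θ + δ - t = θ - t + δ by ring, show θ - δ - t = θ - t - δ by ring]
      linarith
    nlinarith [cos_le_one δ]
  · have h1 := hint (w := fun _ => 1) continuous_const (fun _ => rfl)
    simp only [mul_one] at h1
    rw [h1, integral_mul_const, b.integral_normed]
    simp
    ring
  · rw [hint continuous_cos cos_periodic]
    have h1 : ∀ t, ∫ θ in (0 : ℝ)..2 * π, h θ * cos (θ + t) = 0 := by
      intro t
      have : ∀ θ, h θ * cos (θ + t) = cos t * (h θ * cos θ) - sin t * (h θ * sin θ) := fun θ => by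
        rw [cos_add]; ring
      simp only [this]
      rw [intervalIntegral.integral_sub (Continuous.intervalIntegrable (by fun_prop) _ _)
        (Continuous.intervalIntegrable (by fun_prop) _ _), intervalIntegral.integral_const_mul,
        intervalIntegral.integral_const_mul, hcos, hsin]
      simp
    simp [h1]
  · rw [hint continuous_sin sin_periodic]
    have h1 : ∀ t, ∫ θ in (0 : ℝ)..2 * π, h θ * sin (θ + t) = 0 := by
      intro t
      have : ∀ θ, h θ * sin (θ + t) = cos t * (h θ * sin θ) + sin t * (h θ * cos θ) := fun θ => by
        rw [sin_add]; ring
      simp only [this]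
      rw [intervalIntegral.integral_add (Continuous.intervalIntegrable (by fun_prop) _ _)
        (Continuous.intervalIntegrable (by fun_prop) _ _), intervalIntegral.integral_const_mul,
        intervalIntegral.integral_const_mul, hcos, hsin]
      simp
    simp [h1]

end smoothing

end RieszIsoperimetric

namespace RieszIsoperimetric

open Real Set Filter Topology

/-! ### The first moment of a convex set -/

lemma lintegral_rpow_two_Ioc {m : ℝ} (hm : 0 ≤ m) :
    ∫⁻ r in Ioc 0 m, ENNReal.ofReal (r ^ 2) = ENNReal.ofReal (m ^ 3 / 3) := by
  rw [← ofReal_integral_eq_lintegral_ofReal, ← intervalIntegral.integral_of_le hm, integral_pow]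
  · norm_num
  · exact (continuous_pow 2).integrableOn_Icc.mono_set Ioc_subset_Icc_self
  · exact Eventually.of_forall fun r => sq_nonneg r

/-- A ray of direction `θ` meets the set at distance at most `k θ`. -/
lemma lintegral_norm_le_of_inner_le {k : ℝ → ℝ} (hk : Continuous k)
    (hp : Function.Periodic k (2 * π)) {F : Set Plane} (hFm : MeasurableSet F)
    (hF : ∀ x ∈ F, ∀ θ, inner ℝ x (dir θ) ≤ k θ) :
    ∫⁻ x in F, ENNReal.ofReal ‖x‖
      ≤ ENNReal.ofReal (1 / 3 * ∫ θ in (0 : ℝ)..2 * π, max (k θ) 0 ^ 3) := by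
  have hcont : Continuous fun θ => max (k θ) 0 ^ 3 / 3 := by fun_prop
  have hper : Function.Periodic (fun θ => max (k θ) 0 ^ 3 / 3) (2 * π) := fun θ => by
    simp only [hp θ]
  have hmeas : Measurable (F.indicator fun x => ENNReal.ofReal ‖x‖) :=
    (ENNReal.measurable_ofReal.comp measurable_norm).indicator hFm
  calc ∫⁻ x in F, ENNReal.ofReal ‖x‖ = ∫⁻ x, F.indicator (fun x => ENNReal.ofReal ‖x‖) x :=
        (lintegral_indicator hFm _).symm
    _ = ∫⁻ θ in Ioo (-π) π, ∫⁻ r in Ioi (0 : ℝ),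
          ENNReal.ofReal r * F.indicator (fun x => ENNReal.ofReal ‖x‖) (r • dir θ) :=
        lintegral_eq_lintegral_polar hmeas
    _ ≤ ∫⁻ θ in Ioo (-π) π, ENNReal.ofReal (max (k θ) 0 ^ 3 / 3) := by
        refine lintegral_mono fun θ => ?_
        rw [← lintegral_rpow_two_Ioc (le_max_right _ _), ← lintegral_indicator measurableSet_Ioi,
          ← lintegral_indicator measurableSet_Ioc]
        refine lintegral_mono fun r => ?_
        by_cases hr : r ∈ Ioi (0 : ℝ)
        · rw [indicator_of_mem hr]
          by_cases hrF : r • dir θ ∈ F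
          · have h1 := hF _ hrF θ
            rw [real_inner_smul_left, inner_dir_dir, sub_self, cos_zero, mul_one] at h1
            rw [indicator_of_mem hrF, indicator_of_mem
              (show r ∈ Ioc 0 (max (k θ) 0) from ⟨hr, h1.trans (le_max_left _ _)⟩),
              norm_smul, norm_dir, mul_one, Real.norm_of_nonneg (le_of_lt hr),
              ← ENNReal.ofReal_mul (le_of_lt hr), sq]
          · rw [indicator_of_notMem hrF]; simp
        · rw [indicator_of_notMem hr]; exact zero_le
    _ = _ := by
        rw [← ofReal_integral_eq_lintegral_ofReal, ← integral_Ioc_eq_integral_Ioo,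
          ← intervalIntegral.integral_of_le (by linarith [Real.pi_pos])]
        · congr 1
          have h1 := hper.intervalIntegral_add_eq (-π) 0
          rw [show -π + 2 * π = π by ring, zero_add] at h1
          rw [h1, intervalIntegral.integral_div]
          ring
        · exact hcont.integrableOn_Icc.mono_set Ioo_subset_Icc_self
        · exact Eventually.of_forall fun θ => by positivity

lemma cubicBound_mono {a b : ℝ} (ha : 1 ≤ a) (hab : a ≤ b) : cubicBound a ≤ cubicBound b := by
  have hpi := Real.pi_pos
  have hb : 0 ≤ b := by linarith
  have h1 : 0 ≤ a ^ 2 - 1 := by nlinarith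
  have h2 : a ^ 2 - 1 ≤ b ^ 2 - 1 := by nlinarith
  unfold cubicBound
  gcongr

lemma continuous_cubicBound : Continuous cubicBound := by
  unfold cubicBound
  fun_prop

/-- The first moment of a bounded convex set of area `π`, about a suitable centre (the Steiner
point), is controlled by its perimeter. -/
theorem exists_lintegral_norm_sub_le {Ω : Set Plane} (ho : IsOpen Ω)
    (hb : Bornology.IsBounded Ω) (hconv : Convex ℝ Ω) (hvol : volume Ω = ENNReal.ofReal π)
    (hP : perimeter Ω ≠ ⊤) :
    1 ≤ (perimeter Ω).toReal / (2 * π) ∧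
    ∃ x₀ : Plane, ∫⁻ x in Ω, ENNReal.ofReal ‖x - x₀‖
      ≤ ENNReal.ofReal (1 / 3 * cubicBound ((perimeter Ω).toReal / (2 * π))) := by
  have hpi := Real.pi_pos
  have hne : Ω.Nonempty := by
    by_contra h
    rw [not_nonempty_iff_eq_empty] at h
    rw [h, measure_empty, eq_comm, ENNReal.ofReal_eq_zero] at hvol
    linarith
  have hC := integral_supportFn_le_perimeter ho hb hne hconv hP
  set p := (perimeter Ω).toReal / (2 * π) with hp
  have hhc := continuous_supportFn hb hne
  -- the Steiner point of `Ω`: translating it to the origin centres the support function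
  set x₀ : Plane := !₂[1 / π * ∫ θ in (0 : ℝ)..2 * π, supportFn Ω θ * cos θ,
    1 / π * ∫ θ in (0 : ℝ)..2 * π, supportFn Ω θ * sin θ] with hx₀
  set F : Set Plane := (fun x => x + x₀) ⁻¹' Ω with hF
  have hFne : F.Nonempty := by
    obtain ⟨x, hx⟩ := hne
    exact ⟨x - x₀, by simpa [hF] using hx⟩
  have hFb : Bornology.IsBounded F := by
    have h1 : F = (fun x => x - x₀) '' Ω := by
      ext x
      simp [hF, sub_eq_iff_eq_add]
    obtain ⟨R, hR⟩ := hb.subset_closedBall (0 : Plane)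
    refine (Metric.isBounded_closedBall (x := (0 : Plane)) (r := R + ‖x₀‖)).subset ?_
    rw [h1]
    rintro _ ⟨x, hx, rfl⟩
    rw [mem_closedBall_zero_iff]
    exact (norm_sub_le _ _).trans (add_le_add_left (mem_closedBall_zero_iff.1 (hR hx)) _)
  have hFm : MeasurableSet F := ho.measurableSet.preimage (measurable_add_const x₀)
  have hsupp : ∀ θ, supportFn F θ = supportFn Ω θ - inner ℝ x₀ (dir θ) := by
    intro θ
    apply le_antisymm
    · refine supportFn_le hFne fun x hx => ?_
      have := inner_le_supportFn hb (x := x + x₀) hx θ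
      rw [inner_add_left] at this
      linarith
    · rw [sub_le_iff_le_add]
      refine supportFn_le hne fun x hx => ?_
      have := inner_le_supportFn hFb (x := x - x₀) (by simpa [hF] using hx) θ
      rw [inner_sub_left] at this
      linarith
  have hi0 : ∫ θ in (0 : ℝ)..2 * π, inner ℝ x₀ (dir θ) = 0 := by
    simp only [inner_dir]
    rw [intervalIntegral.integral_add (Continuous.intervalIntegrable (by fun_prop) _ _)
      (Continuous.intervalIntegrable (by fun_prop) _ _), intervalIntegral.integral_const_mul,
      intervalIntegral.integral_const_mul]
    simp
  have hcc : ∫ θ in (0 : ℝ)..2 * π, cos θ * cos θ = π := by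
    simp only [← sq]
    rw [integral_cos_sq]
    simp
  have hss : ∫ θ in (0 : ℝ)..2 * π, sin θ * sin θ = π := by
    simp only [← sq]
    rw [integral_sin_sq]
    simp
  have hsc : ∫ θ in (0 : ℝ)..2 * π, sin θ * cos θ = 0 := by
    rw [integral_sin_mul_cos₁]
    simp
  have hcos : ∫ θ in (0 : ℝ)..2 * π, supportFn F θ * cos θ = 0 := by
    have : ∀ θ, supportFn F θ * cos θ = supportFn Ω θ * cos θ
        - (x₀ 0 * (cos θ * cos θ) + x₀ 1 * (sin θ * cos θ)) := fun θ => by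
      rw [hsupp, inner_dir]; ring
    simp only [this]
    rw [intervalIntegral.integral_sub (Continuous.intervalIntegrable (by fun_prop) _ _)
      (Continuous.intervalIntegrable (by fun_prop) _ _),
      intervalIntegral.integral_add (Continuous.intervalIntegrable (by fun_prop) _ _)
      (Continuous.intervalIntegrable (by fun_prop) _ _), intervalIntegral.integral_const_mul,
      intervalIntegral.integral_const_mul, hcc, hsc]
    simp only [hx₀, PiLp.toLp_apply, Matrix.cons_val_zero]
    field_simp
    ring
  have hsin : ∫ θ in (0 : ℝ)..2 * π, supportFn F θ * sin θ = 0 := by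
    have : ∀ θ, supportFn F θ * sin θ = supportFn Ω θ * sin θ
        - (x₀ 0 * (sin θ * cos θ) + x₀ 1 * (sin θ * sin θ)) := fun θ => by
      rw [hsupp, inner_dir]; ring
    simp only [this]
    rw [intervalIntegral.integral_sub (Continuous.intervalIntegrable (by fun_prop) _ _)
      (Continuous.intervalIntegrable (by fun_prop) _ _),
      intervalIntegral.integral_add (Continuous.intervalIntegrable (by fun_prop) _ _)
      (Continuous.intervalIntegrable (by fun_prop) _ _), intervalIntegral.integral_const_mul,
      intervalIntegral.integral_const_mul, hss, hsc]
    simp only [hx₀, PiLp.toLp_apply, Matrix.cons_val_one, Matrix.cons_val_fin_one]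
    field_simp
    ring
  have hmeanF : ∫ θ in (0 : ℝ)..2 * π, supportFn F θ = ∫ θ in (0 : ℝ)..2 * π, supportFn Ω θ := by
    simp only [hsupp]
    rw [intervalIntegral.integral_sub (hhc.intervalIntegrable _ _)
      ((continuous_const.inner continuous_dir).intervalIntegrable _ _), hi0, sub_zero]
  have key : ∀ c : ℝ, 0 < c → 1 ≤ p + c ∧ ∫⁻ x in F, ENNReal.ofReal ‖x‖
      ≤ ENNReal.ofReal (1 / 3 * cubicBound (p + c)) := by
    intro c hc
    obtain ⟨k, k', k'', hk, hk', hkc, hper, hlt, hcurv, hmean, hkcos, hksin⟩ :=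
      exists_smooth_majorant hFb hFne hcos hsin hc
    have c0 : Continuous k := continuous_iff_continuousAt.2 fun θ => (hk θ).continuousAt
    rw [hmeanF] at hmean
    obtain ⟨y, hy⟩ := hFne
    have hinner : ∀ x ∈ F, ∀ θ, inner ℝ x (dir θ) ≤ k θ := fun x hx θ =>
      (inner_le_supportFn hFb hx θ).trans (hlt θ).le
    -- the support function relative to the point `y` of the set is positive
    set ℓ : ℝ → ℝ := fun θ => inner ℝ y (dir θ) with hℓ
    have hld : ∀ θ, HasDerivAt ℓ (inner ℝ y (dir (θ + π / 2))) θ := by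
      intro θ
      have := (hasDerivAt_const θ y).inner ℝ (hasDerivAt_dir θ)
      simpa using this
    have hld' : ∀ θ, HasDerivAt (fun θ => inner ℝ y (dir (θ + π / 2))) (-ℓ θ) θ := by
      intro θ
      have := (hld (θ + π / 2)).comp_add_const θ (π / 2)
      rw [show θ + π / 2 + π / 2 = θ + π by ring, dir_add_pi, inner_neg_right] at this
      exact this
    have hlp : Function.Periodic ℓ (2 * π) := fun θ => by simp only [hℓ, dir_add_two_pi]
    have hlc : Continuous ℓ := continuous_const.inner continuous_dir
    have hpos : ∀ θ, 0 < k θ - ℓ θ := fun θ =>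
      sub_pos.2 ((inner_le_supportFn hFb hy θ).trans_lt (hlt θ))
    have harea := volume_le_of_inner_le (k := fun θ => k θ - ℓ θ)
      (k'' := fun θ => k'' θ - -ℓ θ) (fun θ => (hk θ).sub (hld θ))
      (fun θ => (hk' θ).sub (hld' θ)) (by fun_prop)
      (fun θ => by simp only [hper θ, hlp θ]) hpos (fun θ => by linarith [hcurv θ])
      (F := (fun x => x + (y + x₀)) ⁻¹' Ω) (fun x hx θ => by
        have h1 : x + y ∈ F := by simpa [hF, add_assoc] using hx
        have h2 := hinner _ h1 θ
        rw [inner_add_left] at h2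
        simp only [hℓ]
        linarith)
    rw [measure_preimage_add_right, hvol] at harea
    have e3 : k (2 * π) = k 0 := by simpa using hper 0
    have e4 : k' (2 * π) = k' 0 := by
      have h1 : HasDerivAt (fun θ => k (θ + 2 * π)) (k' (0 + 2 * π)) 0 :=
        (hk (0 + 2 * π)).comp_add_const 0 (2 * π)
      rw [show (fun θ => k (θ + 2 * π)) = k from funext hper, zero_add] at h1
      exact h1.unique (hk 0)
    have hshift : ∫ θ in (0 : ℝ)..2 * π, (k θ - ℓ θ) * (k θ - ℓ θ + (k'' θ - -ℓ θ))
        = ∫ θ in (0 : ℝ)..2 * π, k θ * (k θ + k'' θ) := by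
      have h1 := integral_mul_deriv_two hld hld' hk hk' hlc.neg hkc
        (by simpa using hlp 0) (by
          rw [show 2 * π + π / 2 = 0 + π / 2 + 2 * π by ring, dir_add_two_pi]) e3 e4
      have h2 : ∀ θ, (k θ - ℓ θ) * (k θ - ℓ θ + (k'' θ - -ℓ θ))
          = k θ * (k θ + k'' θ) - (ℓ θ * k'' θ - -ℓ θ * k θ) := fun θ => by ring
      simp only [h2]
      rw [intervalIntegral.integral_sub (Continuous.intervalIntegrable (by fun_prop) _ _)
        (Continuous.intervalIntegrable (by fun_prop) _ _),
        intervalIntegral.integral_sub (Continuous.intervalIntegrable (by fun_prop) _ _)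
        (Continuous.intervalIntegrable (by fun_prop) _ _), h1, sub_self, sub_zero]
    rw [hshift, ENNReal.ofReal_le_ofReal_iff'] at harea
    have harea' := harea.resolve_right (by linarith)
    have hmean' : ∫ θ in (0 : ℝ)..2 * π, k θ
        = 2 * π * ((∫ θ in (0 : ℝ)..2 * π, supportFn Ω θ) / (2 * π) + c) := by
      rw [hmean]; field_simp
    set a := (∫ θ in (0 : ℝ)..2 * π, supportFn Ω θ) / (2 * π) + c with ha
    have ha0 : 0 ≤ a := by
      have h1 : 0 ≤ ∫ θ in (0 : ℝ)..2 * π, (k θ - ℓ θ) :=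
        intervalIntegral.integral_nonneg (by positivity) fun θ _ => (hpos θ).le
      have hl0 : ∫ θ in (0 : ℝ)..2 * π, ℓ θ = 0 := by
        simp only [hℓ, inner_dir]
        rw [intervalIntegral.integral_add (Continuous.intervalIntegrable (by fun_prop) _ _)
          (Continuous.intervalIntegrable (by fun_prop) _ _), intervalIntegral.integral_const_mul,
          intervalIntegral.integral_const_mul]
        simp
      rw [intervalIntegral.integral_sub (c0.intervalIntegrable _ _) (hlc.intervalIntegrable _ _),
        hl0, hmean', sub_zero] at h1
      exact nonneg_of_mul_nonneg_right h1 (by positivity)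
    obtain ⟨ha1, hcub⟩ := integral_max_pow_three_le hk hk' hkc hper ha0 hmean' hkcos hksin harea'
    have hap : a ≤ p + c := by
      rw [ha, hp]
      gcongr
    refine ⟨ha1.trans hap, (lintegral_norm_le_of_inner_le c0 hper hFm hinner).trans ?_⟩
    refine ENNReal.ofReal_le_ofReal ?_
    have := hcub.trans (cubicBound_mono ha1 hap)
    linarith
  refine ⟨?_, x₀, ?_⟩
  · exact le_of_forall_pos_le_add fun c hc => (key c hc).1
  · have h1 : ∫⁻ x in Ω, ENNReal.ofReal ‖x - x₀‖ = ∫⁻ x in F, ENNReal.ofReal ‖x‖ := by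
      have := (measurePreserving_add_right volume x₀).setLIntegral_comp_emb
        (measurableEmbedding_addRight x₀) (fun x => ENNReal.ofReal ‖x - x₀‖) F
      simp only [add_sub_cancel_right] at this
      rw [this]
      congr 2
      rw [hF, image_preimage_eq]
      exact add_right_surjective x₀
    rw [h1]
    have ht : Tendsto (fun c : ℝ => ENNReal.ofReal (1 / 3 * cubicBound (p + c))) (𝓝[>] 0)
        (𝓝 (ENNReal.ofReal (1 / 3 * cubicBound (p + 0)))) := by
      refine Tendsto.mono_left ?_ nhdsWithin_le_nhds
      refine Continuous.tendsto (ENNReal.continuous_ofReal.comp ?_) 0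
      exact continuous_const.mul (continuous_cubicBound.comp (by fun_prop))
    rw [add_zero] at ht
    exact ge_of_tendsto ht (eventually_nhdsWithin_of_forall fun c hc => (key c hc).2)

end RieszIsoperimetric

namespace RieszIsoperimetric

open Real Set Filter Topology

/-! ### The Riesz kernel -/

/-- The Riesz interaction `∫_A ∫_B |x - y|^{-α} dx dy`. -/
noncomputable def interaction (α : ℝ) (A B : Set Plane) : ℝ≥0∞ :=
  ∫⁻ y in A, ∫⁻ x in B, ENNReal.ofReal (1 / ‖x - y‖ ^ α)

lemma rieszEnergy_eq_interaction (α : ℝ) (F : Set Plane) :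
    rieszEnergy α F = interaction α F F := rfl

lemma measurable_kernel_left (α : ℝ) (y : Plane) :
    Measurable fun x : Plane => ENNReal.ofReal (1 / ‖x - y‖ ^ α) :=
  ENNReal.measurable_ofReal.comp (measurable_const.div
    ((continuous_id.sub continuous_const).norm.measurable.pow_const α))

lemma ennreal_two_mul_le_add_sq (a b : ℝ≥0∞) : 2 * (a * b) ≤ a * a + b * b := by
  wlog hab : a ≤ b generalizing a b
  · have := this b a (le_of_not_ge hab)
    rwa [mul_comm b a, add_comm (b * b)] at this
  obtain ⟨c, rfl⟩ := exists_add_of_le hab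
  calc 2 * (a * (a + c)) ≤ 2 * (a * (a + c)) + c * c := le_self_add
    _ = a * a + (a + c) * (a + c) := by ring

/-- A kernel of the form `∫ c(w) k(x, w) k(y, w) dw` is positive definite. -/
lemma two_mul_lintegral_kernel_le {W : Type*} [MeasurableSpace W] (μ : Measure W) [SFinite μ]
    {c : W → ℝ≥0∞} (hc : Measurable c) {k : Plane → W → ℝ≥0∞}
    (hk : Measurable (Function.uncurry k)) (A B : Set Plane) :
    2 * ∫⁻ y in A, ∫⁻ x in B, ∫⁻ w, c w * (k x w * k y w) ∂μ
      ≤ (∫⁻ y in A, ∫⁻ x in A, ∫⁻ w, c w * (k x w * k y w) ∂μ)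
        + ∫⁻ y in B, ∫⁻ x in B, ∫⁻ w, c w * (k x w * k y w) ∂μ := by
  have hk1 : ∀ x, Measurable (k x) := fun x => hk.comp (measurable_const.prodMk measurable_id)
  have hk2 : ∀ w, Measurable fun x => k x w := fun w =>
    hk.comp (measurable_id.prodMk measurable_const)
  have hf : ∀ S : Set Plane, Measurable fun w => ∫⁻ x in S, k x w := fun S =>
    Measurable.lintegral_prod_left' (f := fun p : Plane × W => k p.1 p.2) hk
  have key : ∀ S T : Set Plane, ∫⁻ y in S, ∫⁻ x in T, ∫⁻ w, c w * (k x w * k y w) ∂μ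
      = ∫⁻ w, c w * ((∫⁻ x in S, k x w) * ∫⁻ x in T, k x w) ∂μ := by
    intro S T
    have h1 : ∀ y, ∫⁻ x in T, ∫⁻ w, c w * (k x w * k y w) ∂μ
        = ∫⁻ w, c w * (k y w * ∫⁻ x in T, k x w) ∂μ := by
      intro y
      rw [lintegral_lintegral_swap]
      · refine lintegral_congr fun w => ?_
        rw [← lintegral_const_mul _ (hk2 w),
          ← lintegral_const_mul]
        · refine lintegral_congr fun x => ?_
          ring
        · exact (hk2 w).const_mul _
      · refine Measurable.aemeasurable ?_
        exact (hc.comp measurable_snd).mul (hk.mul ((hk1 y).comp measurable_snd))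
    simp only [h1]
    rw [lintegral_lintegral_swap]
    · refine lintegral_congr fun w => ?_
      rw [← lintegral_mul_const _ (hk2 w),
        ← lintegral_const_mul]
      exact (hk2 w).mul_const _
    · refine Measurable.aemeasurable ?_
      exact (hc.comp measurable_snd).mul (hk.mul ((hf T).comp measurable_snd))
  rw [key, key, key, ← lintegral_const_mul' _ _ (by norm_num), ← lintegral_add_left]
  · refine lintegral_mono fun w => ?_
    rw [mul_left_comm, ← mul_add]
    gcongr
    exact ennreal_two_mul_le_add_sq _ _
  · exact hc.mul ((hf A).mul (hf A))

/-- By the parallelogram identity the product of the two Gaussians is a Gaussian centred at the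
midpoint of `x` and `y`. -/
lemma lintegral_exp_mul_exp {s : ℝ} (hs : 0 < s) (x y : Plane) :
    ∫⁻ z, ENNReal.ofReal (exp (-(2 * s) * ‖x - z‖ ^ 2))
        * ENNReal.ofReal (exp (-(2 * s) * ‖y - z‖ ^ 2))
      = ENNReal.ofReal (π / (4 * s) * exp (-s * ‖x - y‖ ^ 2)) := by
  set m : Plane := (1 / 2 : ℝ) • (x + y) with hm
  have h1 : ∀ z, ENNReal.ofReal (exp (-(2 * s) * ‖x - z‖ ^ 2))
        * ENNReal.ofReal (exp (-(2 * s) * ‖y - z‖ ^ 2))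
      = ENNReal.ofReal (exp (-s * ‖x - y‖ ^ 2))
        * ENNReal.ofReal (exp (-(4 * s) * ‖z - m‖ ^ 2)) := by
    intro z
    rw [← ENNReal.ofReal_mul (exp_pos _).le, ← ENNReal.ofReal_mul (exp_pos _).le, ← exp_add,
      ← exp_add]
    congr 2
    simp only [norm_sq_plane, hm, PiLp.sub_apply, PiLp.smul_apply, PiLp.add_apply, smul_eq_mul]
    ring
  simp only [h1]
  rw [lintegral_const_mul' _ _ ENNReal.ofReal_ne_top,
    lintegral_sub_right_eq_self (fun z : Plane => ENNReal.ofReal (exp (-(4 * s) * ‖z‖ ^ 2))) m,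
    ← ofReal_integral_eq_lintegral_ofReal, GaussianFourier.integral_rexp_neg_mul_sq_norm
      (by positivity), ← ENNReal.ofReal_mul (exp_pos _).le, mul_comm]
  · congr 2
    rw [finrank_euclideanSpace_fin]
    norm_num
  · have := GaussianFourier.integrable_cexp_neg_mul_sq_norm_add (V := Plane) (b := (4 * s : ℝ))
      (by simpa using hs) 0 0
    refine this.norm.congr (Eventually.of_forall fun z => ?_)
    simp [Complex.norm_exp, ← Complex.ofReal_pow]
  · exact Eventually.of_forall fun z => (exp_pos _).le

/-- The Riesz kernel as a superposition of products of Gaussians. -/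
lemma kernel_eq_lintegral {α : ℝ} (hα : 0 < α) {x y : Plane} (hxy : x ≠ y) :
    ENNReal.ofReal (1 / ‖x - y‖ ^ α)
      = ∫⁻ w : ℝ × Plane, ENNReal.ofReal (4 * w.1 / π * w.1 ^ (α / 2 - 1) / Gamma (α / 2))
        * (ENNReal.ofReal (exp (-(2 * w.1) * ‖x - w.2‖ ^ 2))
          * ENNReal.ofReal (exp (-(2 * w.1) * ‖y - w.2‖ ^ 2)))
        ∂((volume.restrict (Ioi (0 : ℝ))).prod volume) := by
  have hd : 0 < ‖x - y‖ := norm_pos_iff.2 (sub_ne_zero.2 hxy)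
  have hG : 0 < Gamma (α / 2) := Gamma_pos_of_pos (by positivity)
  have hme : ∀ v : Plane, Measurable fun w : ℝ × Plane =>
      ENNReal.ofReal (exp (-(2 * w.1) * ‖v - w.2‖ ^ 2)) := fun v =>
    ENNReal.measurable_ofReal.comp (Continuous.measurable (by fun_prop))
  have hmc : Measurable fun s : ℝ =>
      ENNReal.ofReal (4 * s / π * s ^ (α / 2 - 1) / Gamma (α / 2)) :=
    ENNReal.measurable_ofReal.comp (by fun_prop)
  have hmeas : Measurable fun w : ℝ × Plane =>
      ENNReal.ofReal (4 * w.1 / π * w.1 ^ (α / 2 - 1) / Gamma (α / 2))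
        * (ENNReal.ofReal (exp (-(2 * w.1) * ‖x - w.2‖ ^ 2))
          * ENNReal.ofReal (exp (-(2 * w.1) * ‖y - w.2‖ ^ 2))) :=
    (hmc.comp measurable_fst).mul ((hme x).mul (hme y))
  rw [lintegral_prod _ hmeas.aemeasurable]
  have h1 : ∀ s ∈ Ioi (0 : ℝ), ∫⁻ z, ENNReal.ofReal (4 * s / π * s ^ (α / 2 - 1) / Gamma (α / 2))
        * (ENNReal.ofReal (exp (-(2 * s) * ‖x - z‖ ^ 2))
          * ENNReal.ofReal (exp (-(2 * s) * ‖y - z‖ ^ 2)))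
      = ENNReal.ofReal ((Gamma (α / 2))⁻¹ *
        (s ^ (α / 2 - 1) * exp (-(‖x - y‖ ^ 2 * s)))) := by
    intro s hs
    have hs' : 0 < s := hs
    rw [lintegral_const_mul' _ _ ENNReal.ofReal_ne_top, lintegral_exp_mul_exp hs',
      ← ENNReal.ofReal_mul (by positivity)]
    congr 1
    have hpi := Real.pi_pos
    rw [show -s * ‖x - y‖ ^ 2 = -(‖x - y‖ ^ 2 * s) by ring]
    field_simp
  rw [setLIntegral_congr_fun measurableSet_Ioi h1, ← ofReal_integral_eq_lintegral_ofReal,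
    integral_const_mul, integral_rpow_mul_exp_neg_mul_Ioi (by positivity) (by positivity)]
  · congr 1
    rw [one_div (‖x - y‖ ^ 2), inv_rpow (by positivity), ← rpow_natCast, ← rpow_mul hd.le]
    rw [show ((2 : ℕ) : ℝ) * (α / 2) = α by push_cast; ring]
    field_simp
  · refine Integrable.const_mul ?_ _
    refine Integrable.of_integral_ne_zero ?_
    rw [integral_rpow_mul_exp_neg_mul_Ioi (by positivity) (by positivity)]
    positivity
  · filter_upwards [ae_restrict_mem measurableSet_Ioi] with s hs
    have : (0 : ℝ) < s := hs
    positivity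

/-- Positive definiteness of the Riesz kernel. -/
theorem two_mul_interaction_le {α : ℝ} (hα : 0 < α) (A B : Set Plane) :
    2 * interaction α A B ≤ interaction α A A + interaction α B B := by
  have h : ∀ S T : Set Plane, interaction α S T = ∫⁻ y in S, ∫⁻ x in T, ∫⁻ w : ℝ × Plane,
      ENNReal.ofReal (4 * w.1 / π * w.1 ^ (α / 2 - 1) / Gamma (α / 2))
        * (ENNReal.ofReal (exp (-(2 * w.1) * ‖x - w.2‖ ^ 2))
          * ENNReal.ofReal (exp (-(2 * w.1) * ‖y - w.2‖ ^ 2)))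
        ∂((volume.restrict (Ioi (0 : ℝ))).prod volume) := by
    intro S T
    refine lintegral_congr fun y => lintegral_congr_ae ?_
    have : ∀ᵐ x ∂(volume.restrict T), x ≠ y :=
      ae_restrict_of_ae (by simp [ae_iff, measure_singleton])
    filter_upwards [this] with x hx using kernel_eq_lintegral hα hx
  rw [h, h, h]
  refine two_mul_lintegral_kernel_le _ (c := fun w : ℝ × Plane =>
    ENNReal.ofReal (4 * w.1 / π * w.1 ^ (α / 2 - 1) / Gamma (α / 2)))
    (k := fun x w => ENNReal.ofReal (exp (-(2 * w.1) * ‖x - w.2‖ ^ 2))) ?_ ?_ A B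
  · exact ENNReal.measurable_ofReal.comp (by fun_prop)
  · exact ENNReal.measurable_ofReal.comp (Continuous.measurable (by fun_prop))

lemma lintegral_ball_kernel_lt_top {α : ℝ} (hα : α < 2) :
    ∫⁻ x in Metric.ball (0 : Plane) 1, ENNReal.ofReal (1 / ‖x‖ ^ α) < ⊤ := by
  have hm : Measurable ((Metric.ball (0 : Plane) 1).indicator
      fun x => ENNReal.ofReal (1 / ‖x‖ ^ α)) := by
    refine Measurable.indicator ?_ measurableSet_ball
    simpa using measurable_kernel_left α 0
  rw [← lintegral_indicator measurableSet_ball, lintegral_eq_lintegral_polar hm]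
  have h1 : ∀ θ : ℝ, ∫⁻ r in Ioi (0 : ℝ), ENNReal.ofReal r * (Metric.ball (0 : Plane) 1).indicator
      (fun x => ENNReal.ofReal (1 / ‖x‖ ^ α)) (r • dir θ)
      ≤ ∫⁻ r in Ioc (0 : ℝ) 1, ENNReal.ofReal (r ^ (1 - α)) := by
    intro θ
    rw [← lintegral_indicator measurableSet_Ioi, ← lintegral_indicator measurableSet_Ioc]
    refine lintegral_mono fun r => ?_
    by_cases hr : r ∈ Ioi (0 : ℝ)
    · have hr' : 0 < r := hr
      rw [indicator_of_mem hr]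
      by_cases hb : r • dir θ ∈ Metric.ball (0 : Plane) 1
      · have hn : ‖r • dir θ‖ = r := by
          rw [norm_smul, norm_dir, mul_one, Real.norm_of_nonneg hr'.le]
        have hr1 : r < 1 := by rwa [mem_ball_zero_iff, hn] at hb
        rw [indicator_of_mem hb, hn, indicator_of_mem (show r ∈ Ioc (0 : ℝ) 1 from ⟨hr', hr1.le⟩),
          ← ENNReal.ofReal_mul hr'.le, rpow_sub hr', rpow_one, mul_one_div]
      · rw [indicator_of_notMem hb]; simp
    · rw [indicator_of_notMem hr]; exact zero_le
  refine (lintegral_mono h1).trans_lt ?_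
  rw [setLIntegral_const]
  refine ENNReal.mul_lt_top ?_ (by simp)
  have hi : IntegrableOn (fun r : ℝ => r ^ (1 - α)) (Ioc 0 1) :=
    (intervalIntegrable_iff_integrableOn_Ioc_of_le zero_le_one).1
      (intervalIntegral.intervalIntegrable_rpow' (by linarith))
  exact hi.lintegral_lt_top

/-- The potential of a set, at any point, is bounded in terms of its area only. -/
lemma lintegral_kernel_le {α : ℝ} (hα : 0 < α) (F : Set Plane) (y : Plane) :
    ∫⁻ x in F, ENNReal.ofReal (1 / ‖x - y‖ ^ α)
      ≤ (∫⁻ x in Metric.ball (0 : Plane) 1, ENNReal.ofReal (1 / ‖x‖ ^ α)) + volume F := by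
  have h1 : ∀ x, ENNReal.ofReal (1 / ‖x - y‖ ^ α)
      ≤ (Metric.ball (0 : Plane) 1).indicator (fun x => ENNReal.ofReal (1 / ‖x‖ ^ α)) (x - y)
        + 1 := by
    intro x
    by_cases hx : x - y ∈ Metric.ball (0 : Plane) 1
    · rw [indicator_of_mem hx]; exact le_self_add
    · rw [mem_ball_zero_iff, not_lt] at hx
      refine le_trans ?_ le_add_self
      rw [ENNReal.ofReal_le_one, div_le_one (by positivity)]
      exact one_le_rpow hx hα.le
  have hm : Measurable ((Metric.ball (0 : Plane) 1).indicator
      fun x => ENNReal.ofReal (1 / ‖x‖ ^ α)) := by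
    refine Measurable.indicator ?_ measurableSet_ball
    simpa using measurable_kernel_left α 0
  refine (lintegral_mono h1).trans ?_
  rw [lintegral_add_right _ measurable_const, setLIntegral_const, one_mul]
  refine add_le_add ?_ le_rfl
  refine (setLIntegral_le_lintegral _ _).trans ?_
  rw [lintegral_sub_right_eq_self ((Metric.ball (0 : Plane) 1).indicator
      fun x => ENNReal.ofReal (1 / ‖x‖ ^ α)) y, lintegral_indicator measurableSet_ball]

lemma interaction_lt_top {α : ℝ} (hα : 0 < α) (hα2 : α < 2) {A B : Set Plane}
    (hA : volume A < ⊤) (hB : volume B < ⊤) : interaction α A B < ⊤ := by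
  refine (lintegral_mono fun y => lintegral_kernel_le hα B y).trans_lt ?_
  rw [setLIntegral_const]
  exact ENNReal.mul_lt_top (ENNReal.add_lt_top.2 ⟨lintegral_ball_kernel_lt_top hα2, hB⟩) hA

/-- A lower bound for the Riesz energy in terms of the area and the diameter. -/
lemma le_rieszEnergy {α : ℝ} (hα : 0 < α) {F : Set Plane} (hFm : MeasurableSet F) {d : ℝ}
    (hd : ∀ x ∈ F, ∀ y ∈ F, ‖x - y‖ ≤ d) :
    ENNReal.ofReal (1 / d ^ α) * volume F * volume F ≤ rieszEnergy α F := by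
  unfold rieszEnergy
  have h1 : ∀ y ∈ F, ENNReal.ofReal (1 / d ^ α) * volume F
      ≤ ∫⁻ x in F, ENNReal.ofReal (1 / ‖x - y‖ ^ α) := by
    intro y hy
    rw [← setLIntegral_const]
    refine lintegral_mono_ae ?_
    have hne : ∀ᵐ x ∂(volume.restrict F), x ≠ y :=
      ae_restrict_of_ae (by simp [ae_iff, measure_singleton])
    filter_upwards [hne, ae_restrict_mem hFm] with x hx hxF
    have hpos : 0 < ‖x - y‖ := norm_pos_iff.2 (sub_ne_zero.2 hx)
    refine ENNReal.ofReal_le_ofReal ?_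
    exact one_div_le_one_div_of_le (by positivity)
      (rpow_le_rpow hpos.le (hd x hxF y hy) hα.le)
  calc _ = ∫⁻ y in F, ENNReal.ofReal (1 / d ^ α) * volume F := by rw [setLIntegral_const]
    _ ≤ _ := setLIntegral_mono' hFm h1

end RieszIsoperimetric

namespace RieszIsoperimetric

open Real Set Filter Topology

/-! ### The radial derivative of the potential of the disk -/

/-- Minus the radial derivative, at distance `ρ` from the centre, of the potential of the unit
disk: by the divergence theorem it is an integral over the unit circle. -/
noncomputable def diskForce (α ρ : ℝ) : ℝ :=
  ∫ θ in (-π)..π, cos θ * (1 + ρ ^ 2 - 2 * ρ * cos θ) ^ (-(α / 2))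

lemma multichoose_nonneg {a : ℝ} (ha : 0 < a) (n : ℕ) : 0 ≤ Ring.multichoose a n := by
  have h := Ring.factorial_nsmul_multichoose_eq_ascPochhammer a n
  rw [Polynomial.ascPochhammer_smeval_eq_eval] at h
  have h2 : 0 < (ascPochhammer ℝ n).eval a := ascPochhammer_pos n a ha
  rw [← h, nsmul_eq_mul] at h2
  exact (pos_of_mul_pos_right h2 (by positivity)).le

lemma hasSum_multichoose_mul_pow (a : ℝ) {z : ℂ} (hz : ‖z‖ < 1) :
    HasSum (fun n : ℕ => ((Ring.multichoose a n : ℝ) : ℂ) * z ^ n) (1 / (1 - z) ^ (a : ℂ)) := by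
  have h := (Complex.one_div_one_sub_cpow_hasFPowerSeriesOnBall_zero (a : ℂ)).hasSum
    (y := z) (by simpa [enorm_eq_nnnorm, ← NNReal.coe_lt_coe] using hz)
  rw [zero_add] at h
  have h2 : (fun n : ℕ => ((Ring.multichoose a n : ℝ) : ℂ) * z ^ n) = fun n : ℕ =>
      (FormalMultilinearSeries.ofScalars ℂ fun n => Ring.choose ((a : ℂ) + n - 1) n) n
        fun _ => z := by
    funext n
    rw [FormalMultilinearSeries.ofScalars_apply_eq, Ring.multichoose_eq, Complex.ofReal_choose]
    simp
  rwa [h2]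

/-- The squared distance from `1` to the point of modulus `ρ` and argument `θ`. -/
lemma norm_one_sub_mul_exp_sq (ρ θ : ℝ) :
    ‖1 - ρ * Complex.exp (θ * Complex.I)‖ ^ 2 = 1 + ρ ^ 2 - 2 * ρ * cos θ := by
  rw [← Complex.normSq_eq_norm_sq, Complex.exp_mul_I, Complex.normSq_apply]
  simp [← Complex.ofReal_cos, ← Complex.ofReal_sin]
  nlinarith [sin_sq_add_cos_sq θ]

lemma integral_cos_mul_cos_int_nonneg (k : ℤ) : 0 ≤ ∫ θ in (-π)..π, cos θ * cos (k * θ) := by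
  have h : ∀ θ, cos θ * cos (k * θ)
      = (cos (((k + 1 : ℤ) : ℝ) * θ) + cos (((k - 1 : ℤ) : ℝ) * θ)) / 2 := by
    intro θ
    push_cast
    rw [add_mul, sub_mul, one_mul, cos_add, cos_sub]
    ring
  have h2 : ∀ m : ℤ, 0 ≤ ∫ θ in (-π)..π, cos ((m : ℝ) * θ) := by
    intro m
    rcases eq_or_ne m 0 with rfl | hm
    · simp [Real.pi_pos.le]
    · have hm' : (m : ℝ) ≠ 0 := by exact_mod_cast hm
      rw [intervalIntegral.integral_comp_mul_left _ hm', integral_cos, mul_neg, sin_neg,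
        sin_int_mul_pi]
      simp
  simp only [h]
  rw [intervalIntegral.integral_div, intervalIntegral.integral_add]
  · have := h2 (k + 1)
    have := h2 (k - 1)
    positivity
  · exact Continuous.intervalIntegrable (by fun_prop) _ _
  · exact Continuous.intervalIntegrable (by fun_prop) _ _

lemma norm_sum_mul_exp_pow_sq (b : ℕ → ℝ) (N : ℕ) (ρ θ : ℝ) :
    ‖∑ n ∈ Finset.range N, (b n : ℂ) * (ρ * Complex.exp (θ * Complex.I)) ^ n‖ ^ 2
      = ∑ n ∈ Finset.range N, ∑ m ∈ Finset.range N,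
        b n * b m * ρ ^ (n + m) * cos (((n : ℤ) - (m : ℤ) : ℤ) * θ) := by
  have h1 : ∀ n : ℕ, (b n : ℂ) * (ρ * Complex.exp (θ * Complex.I)) ^ n
      = ((b n * ρ ^ n * cos (n * θ) : ℝ) : ℂ)
        + ((b n * ρ ^ n * sin (n * θ) : ℝ) : ℂ) * Complex.I := by
    intro n
    rw [mul_pow, ← Complex.exp_nat_mul, ← mul_assoc (n : ℂ), Complex.exp_mul_I]
    push_cast
    ring
  simp only [h1]
  rw [Finset.sum_add_distrib, ← Finset.sum_mul, ← Complex.ofReal_sum, ← Complex.ofReal_sum,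
    ← Complex.normSq_eq_norm_sq, Complex.normSq_add_mul_I, sq, sq, Finset.sum_mul_sum,
    Finset.sum_mul_sum, ← Finset.sum_add_distrib]
  refine Finset.sum_congr rfl fun n _ => ?_
  rw [← Finset.sum_add_distrib]
  refine Finset.sum_congr rfl fun m _ => ?_
  push_cast
  rw [sub_mul, cos_sub]
  ring

/-- The binomial series of `(1 - z) ^ (-α / 2)` has nonnegative coefficients, and the kernel is its
squared modulus on the circle of radius `ρ`; this makes `diskForce` a power series in `ρ` with
nonnegative coefficients. -/
lemma diskForce_le_diskForce {α : ℝ} (hα : 0 < α) {ρ σ : ℝ} (hρ : 0 ≤ ρ) (hρσ : ρ ≤ σ)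
    (hσ : σ < 1) : diskForce α ρ ≤ diskForce α σ := by
  have hα2 : 0 < α / 2 := by positivity
  set b : ℕ → ℝ := Ring.multichoose (α / 2) with hb
  have hb0 : ∀ n, 0 ≤ b n := multichoose_nonneg hα2
  set S : ℕ → ℝ → ℝ → ℂ := fun N r θ =>
    ∑ n ∈ Finset.range N, (b n : ℂ) * (r * Complex.exp (θ * Complex.I)) ^ n with hS
  have hI : ∀ N r, ∫ θ in (-π)..π, cos θ * ‖S N r θ‖ ^ 2
      = ∑ n ∈ Finset.range N, ∑ m ∈ Finset.range N,
        b n * b m * r ^ (n + m) * ∫ θ in (-π)..π, cos θ * cos (((n : ℤ) - (m : ℤ) : ℤ) * θ) := by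
    intro N r
    simp only [hS, norm_sum_mul_exp_pow_sq, Finset.mul_sum]
    rw [intervalIntegral.integral_finsetSum]
    · refine Finset.sum_congr rfl fun n _ => ?_
      rw [intervalIntegral.integral_finsetSum]
      · refine Finset.sum_congr rfl fun m _ => ?_
        rw [← intervalIntegral.integral_const_mul]
        refine intervalIntegral.integral_congr fun θ _ => ?_
        ring
      · exact fun _ _ => Continuous.intervalIntegrable (by fun_prop) _ _
    · exact fun _ _ => Continuous.intervalIntegrable (by fun_prop) _ _
  have hlim : ∀ r, 0 ≤ r → r < 1 →
      Tendsto (fun N => ∫ θ in (-π)..π, cos θ * ‖S N r θ‖ ^ 2) atTop (𝓝 (diskForce α r)) := by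
    intro r hr0 hr1
    have hnz : ∀ θ : ℝ, ‖(r : ℂ) * Complex.exp (θ * Complex.I)‖ = r := by
      intro θ
      rw [norm_mul, Complex.norm_exp_ofReal_mul_I, mul_one, Complex.norm_real,
        Real.norm_of_nonneg hr0]
    have hsum : Summable fun n => b n * r ^ n := by
      have := (hasSum_multichoose_mul_pow (α / 2) (z := (r : ℂ))
        (by rwa [Complex.norm_real, Real.norm_of_nonneg hr0])).summable
      exact_mod_cast this
    refine intervalIntegral.tendsto_integral_filter_of_dominated_convergence
      (fun _ => (∑' n, b n * r ^ n) ^ 2) ?_ ?_ (by simp) ?_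
    · refine Eventually.of_forall fun N => Continuous.aestronglyMeasurable ?_
      simp only [hS]
      fun_prop
    · refine Eventually.of_forall fun N => Eventually.of_forall fun θ _ => ?_
      rw [norm_mul, norm_pow, norm_norm]
      have h1 : ‖cos θ‖ ≤ 1 := abs_cos_le_one θ
      have h2 : ‖S N r θ‖ ≤ ∑' n, b n * r ^ n := by
        refine (norm_sum_le _ _).trans ?_
        refine le_trans (le_of_eq (Finset.sum_congr rfl fun n _ => ?_))
          (hsum.sum_le_tsum (Finset.range N) fun n _ => mul_nonneg (hb0 n) (pow_nonneg hr0 n))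
        rw [norm_mul, norm_pow, hnz, Complex.norm_real, Real.norm_of_nonneg (hb0 n)]
      calc ‖cos θ‖ * ‖S N r θ‖ ^ 2 ≤ 1 * (∑' n, b n * r ^ n) ^ 2 := by gcongr
        _ = _ := one_mul _
    · refine Eventually.of_forall fun θ _ => Tendsto.const_mul _ ?_
      have h1 := (hasSum_multichoose_mul_pow (α / 2) (z := r * Complex.exp (θ * Complex.I))
        (by rwa [hnz])).tendsto_sum_nat
      have h2 := (h1.norm.pow 2)
      have h3 : ‖1 / (1 - r * Complex.exp (θ * Complex.I)) ^ ((α / 2 : ℝ) : ℂ)‖ ^ 2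
          = (1 + r ^ 2 - 2 * r * cos θ) ^ (-(α / 2)) := by
        rw [← norm_one_sub_mul_exp_sq, norm_div, norm_one, Complex.norm_cpow_real, one_div,
          ← rpow_neg (norm_nonneg _), ← rpow_natCast, ← rpow_natCast,
          ← rpow_mul (norm_nonneg _), ← rpow_mul (norm_nonneg _),
          mul_comm (-(α / 2))]
      rwa [h3] at h2
  refine le_of_tendsto_of_tendsto' (hlim ρ hρ (hρσ.trans_lt hσ)) (hlim σ (hρ.trans hρσ) hσ)
    fun N => ?_
  rw [hI, hI]
  refine Finset.sum_le_sum fun n _ => Finset.sum_le_sum fun m _ => ?_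
  refine mul_le_mul_of_nonneg_right ?_ (integral_cos_mul_cos_int_nonneg _)
  exact mul_le_mul_of_nonneg_left (pow_le_pow_left₀ hρ hρσ _) (mul_nonneg (hb0 n) (hb0 m))

/-- The singularity at `θ = 0` is of order `|θ| ^ (-α)`, integrable as `α < 1`. -/
lemma intervalIntegrable_one_sub_cos_rpow {α : ℝ} (hα0 : 0 < α) (hα1 : α < 1) :
    IntervalIntegrable (fun θ => (1 - cos θ) ^ (-(α / 2))) volume (-π) π := by
  have h1 : IntervalIntegrable (fun θ : ℝ => (2 / π ^ 2) ^ (-(α / 2)) * |θ| ^ (-α)) volume (-π) π :=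
    by
    refine IntervalIntegrable.const_mul ?_ _
    refine intervalIntegrable_of_even (fun x => by rw [abs_neg]) (fun x hx => ?_)
      ENNReal.coe_ne_top ENNReal.coe_ne_top
    refine (intervalIntegral.intervalIntegrable_rpow' (r := -α) (by linarith)).congr fun y hy => ?_
    rw [uIoc_of_le hx.le] at hy
    simp only [abs_of_pos hy.1]
  refine h1.mono_fun' (Measurable.aestronglyMeasurable (by fun_prop)) ?_
  rw [EventuallyLE, ae_restrict_iff' measurableSet_uIoc]
  have h0 : ∀ᵐ θ : ℝ, θ ≠ 0 := by simp [ae_iff, measure_singleton]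
  filter_upwards [h0] with θ hθ hm
  rw [uIoc_of_le (by linarith [Real.pi_pos])] at hm
  have h2 := cos_le_one_sub_mul_cos_sq (x := θ) (abs_le.2 ⟨hm.1.le, hm.2⟩)
  have hθ' : 0 < |θ| := abs_pos.2 hθ
  have h3 : 0 < 2 / π ^ 2 * θ ^ 2 := by positivity
  rw [Real.norm_of_nonneg (rpow_nonneg (by linarith) _)]
  calc (1 - cos θ) ^ (-(α / 2)) ≤ (2 / π ^ 2 * θ ^ 2) ^ (-(α / 2)) :=
        rpow_le_rpow_of_nonpos h3 (by linarith) (by linarith)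
    _ = _ := by
        rw [mul_rpow (by positivity) (by positivity), ← sq_abs θ, ← rpow_natCast |θ|,
          ← rpow_mul hθ'.le]
        congr 2
        push_cast; ring

/-- The Lipschitz constant of the potential of the unit disk, attained by its radial derivative at
the boundary. -/
noncomputable def diskLipschitz (α : ℝ) : ℝ :=
  π * α * (2 - α) * Gamma (1 - α) / (2 * Gamma (2 - α / 2) ^ 2)

/-- The real form of the Beta integral. -/
lemma integrableOn_integral_beta {u v : ℝ} (hu : 0 < u) (hv : 0 < v) :
    IntegrableOn (fun x : ℝ => x ^ (u - 1) * (1 - x) ^ (v - 1)) (Ioo 0 1) ∧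
      ∫ x in Ioo (0 : ℝ) 1, x ^ (u - 1) * (1 - x) ^ (v - 1)
        = Gamma u * Gamma v / Gamma (u + v) := by
  have hint : IntegrableOn (fun x : ℝ => (x : ℂ) ^ ((u : ℂ) - 1) * (1 - (x : ℂ)) ^ ((v : ℂ) - 1))
      (Ioc 0 1) := by
    have := Complex.betaIntegral_convergent (u := u) (v := v) (by simpa) (by simpa)
    rwa [intervalIntegrable_iff_integrableOn_Ioc_of_le (by simp)] at this
  have hre : ∀ x ∈ Ioc (0 : ℝ) 1, x ^ (u - 1) * (1 - x) ^ (v - 1)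
      = RCLike.re ((x : ℂ) ^ ((u : ℂ) - 1) * (1 - (x : ℂ)) ^ ((v : ℂ) - 1)) := by
    intro x hx
    norm_cast
    rw [← Complex.ofReal_cpow hx.1.le, ← Complex.ofReal_cpow (by linarith [hx.2]),
      RCLike.re_to_complex, Complex.re_mul_ofReal, Complex.ofReal_re]
  constructor
  · refine IntegrableOn.mono_set ?_ Ioo_subset_Ioc_self
    exact IntegrableOn.congr_fun hint.re (fun x hx => (hre x hx).symm) measurableSet_Ioc
  · have h := ProbabilityTheory.beta_eq_betaIntegralReal u v hu hv
    rw [ProbabilityTheory.beta] at h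
    rw [h, Complex.betaIntegral, intervalIntegral.integral_of_le zero_le_one,
      ← integral_Ioc_eq_integral_Ioo, setIntegral_congr_fun measurableSet_Ioc hre,
      ← RCLike.re_to_complex, integral_re hint]

lemma image_half_one_sub_cos : (fun θ => (1 - cos θ) / 2) '' Ioo 0 π = Ioo 0 1 := by
  ext x
  constructor
  · rintro ⟨θ, ⟨h0, h1⟩, rfl⟩
    have h2 := cos_lt_cos_of_nonneg_of_le_pi le_rfl h1.le h0
    have h3 := cos_lt_cos_of_nonneg_of_le_pi h0.le le_rfl h1
    rw [cos_zero] at h2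
    rw [cos_pi] at h3
    exact ⟨by linarith, by linarith⟩
  · rintro ⟨h0, h1⟩
    refine ⟨arccos (1 - 2 * x), ⟨arccos_pos.2 (by linarith), arccos_lt_pi.2 (by linarith)⟩, ?_⟩
    simp only
    rw [cos_arccos (by linarith) (by linarith)]
    ring

lemma injOn_half_one_sub_cos : InjOn (fun θ => (1 - cos θ) / 2) (Ioo 0 π) := by
  intro x hx y hy hxy
  refine injOn_cos (Ioo_subset_Icc_self hx) (Ioo_subset_Icc_self hy) ?_
  simp only at hxy
  linarith

/-- The force at the boundary, evaluated through the substitution `x = (1 - cos θ) / 2` and the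
Beta integral. -/
lemma diskForce_one {α : ℝ} (hα0 : 0 < α) (hα1 : α < 1) : diskForce α 1 = diskLipschitz α := by
  have hpi := Real.pi_pos
  set l := α / 2 with hl
  have hint : IntervalIntegrable (fun θ => cos θ * (1 + (1 : ℝ) ^ 2 - 2 * 1 * cos θ) ^ (-l))
      volume (-π) π := by
    have := ((intervalIntegrable_one_sub_cos_rpow hα0 hα1).const_mul ((2 : ℝ) ^ (-l)))
    refine (this.continuousOn_mul continuous_cos.continuousOn).congr fun θ _ => ?_
    rw [← mul_rpow (by norm_num) (by linarith [cos_le_one θ])]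
    ring_nf
  have hhalf : diskForce α 1
      = 2 * ∫ θ in Ioo 0 π, cos θ * (2 - 2 * cos θ) ^ (-l) := by
    have h0 : (0 : ℝ) ∈ uIcc (-π) π := by
      rw [uIcc_of_le (by linarith)]; exact ⟨by linarith, hpi.le⟩
    have hneg := intervalIntegral.integral_comp_neg (a := 0) (b := π)
      (fun θ => cos θ * (1 + (1 : ℝ) ^ 2 - 2 * 1 * cos θ) ^ (-l))
    rw [neg_zero] at hneg
    rw [diskForce, ← intervalIntegral.integral_add_adjacent_intervals
      (hint.mono_set (uIcc_subset_uIcc left_mem_uIcc h0))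
      (hint.mono_set (uIcc_subset_uIcc h0 right_mem_uIcc)), ← hneg]
    simp only [cos_neg]
    rw [← two_mul, intervalIntegral.integral_of_le hpi.le, integral_Ioc_eq_integral_Ioo]
    norm_num
  have hsub : ∫ θ in Ioo 0 π, cos θ * (2 - 2 * cos θ) ^ (-l)
      = ∫ x in Ioo (0 : ℝ) 1, 4 ^ (-l) * (x ^ ((1 / 2 - l) - 1) * (1 - x) ^ ((1 / 2 : ℝ) - 1)
        - 2 * (x ^ ((3 / 2 - l) - 1) * (1 - x) ^ ((1 / 2 : ℝ) - 1))) := by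
    rw [← image_half_one_sub_cos, integral_image_eq_integral_abs_deriv_smul
      (f' := fun θ => sin θ / 2) measurableSet_Ioo
      (fun θ _ => by
        have := ((hasDerivAt_cos θ).const_sub 1).div_const 2
        simpa using this.hasDerivWithinAt) injOn_half_one_sub_cos]
    refine setIntegral_congr_fun measurableSet_Ioo fun θ hθ => ?_
    have hs : 0 < sin θ := sin_pos_of_mem_Ioo hθ
    have hx : (1 - cos θ) / 2 ∈ Ioo (0 : ℝ) 1 := by
      rw [← image_half_one_sub_cos]; exact mem_image_of_mem _ hθ
    simp only [smul_eq_mul]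
    set x := (1 - cos θ) / 2 with hxd
    have hx0 : 0 < x := hx.1
    have hx1 : 0 < 1 - x := by linarith [hx.2]
    have hsx : sin θ / 2 = x ^ (1 / 2 : ℝ) * (1 - x) ^ (1 / 2 : ℝ) := by
      rw [← mul_rpow hx0.le hx1.le, ← sqrt_eq_rpow, eq_comm, sqrt_eq_iff_mul_self_eq
        (by positivity) (by positivity)]
      rw [hxd]
      nlinarith [sin_sq_add_cos_sq θ]
    have hc : cos θ = 1 - 2 * x := by rw [hxd]; ring
    rw [abs_of_pos (by positivity), hsx, hc, show 2 - 2 * (1 - 2 * x) = 4 * x by ring,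
      mul_rpow (by norm_num) hx0.le]
    have e1 : x ^ ((1 / 2 - l) - 1) = x ^ (-l) * (x ^ (1 / 2 : ℝ))⁻¹ := by
      rw [← rpow_neg hx0.le, ← rpow_add hx0]; ring_nf
    have e2 : x ^ ((3 / 2 - l) - 1) = x * (x ^ (-l) * (x ^ (1 / 2 : ℝ))⁻¹) := by
      rw [show 3 / 2 - l - 1 = 1 + (-l + -(1 / 2)) by ring, rpow_add hx0, rpow_add hx0, rpow_one,
        rpow_neg hx0.le (1 / 2)]
    have e3 : (1 - x) ^ ((1 / 2 : ℝ) - 1) = ((1 - x) ^ (1 / 2 : ℝ))⁻¹ := by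
      rw [← rpow_neg hx1.le]; norm_num
    have p1 : 0 < x ^ (1 / 2 : ℝ) := by positivity
    have p2 : 0 < (1 - x) ^ (1 / 2 : ℝ) := by positivity
    rw [e1, e2, e3]
    field_simp
  obtain ⟨i1, v1⟩ := integrableOn_integral_beta (u := 1 / 2 - l) (v := 1 / 2) (by linarith)
    (by norm_num)
  obtain ⟨i2, v2⟩ := integrableOn_integral_beta (u := 3 / 2 - l) (v := 1 / 2) (by linarith)
    (by norm_num)
  rw [hhalf, hsub, integral_const_mul, integral_sub i1 (i2.const_mul 2), integral_const_mul, v1, v2,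
    show (1 / 2 - l + 1 / 2 : ℝ) = 1 - l by ring, show (3 / 2 - l : ℝ) = (1 / 2 - l) + 1 by ring,
    show (1 / 2 - l + 1 + 1 / 2 : ℝ) = (1 - l) + 1 by ring,
    Gamma_add_one (by linarith : (1 / 2 - l) ≠ 0), Gamma_add_one (by linarith : (1 - l) ≠ 0),
    Gamma_one_half_eq]
  -- the duplication formula expresses `Γ (1 / 2 - l)` through `Γ (1 - α)`
  have hdup := Gamma_mul_Gamma_add_half (1 / 2 - l)
  rw [show (1 / 2 - l + 1 / 2 : ℝ) = 1 - l by ring, show 2 * (1 / 2 - l) = 1 - α by rw [hl]; ring,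
    show (1 - (1 - α)) = α by ring] at hdup
  have h4 : (4 : ℝ) ^ (-l) * 2 ^ α = 1 := by
    rw [show (4 : ℝ) = 2 ^ (2 : ℝ) by norm_num, ← rpow_mul (by norm_num), ← rpow_add (by norm_num),
      hl, show (2 * -(α / 2) + α : ℝ) = 0 by ring, rpow_zero]
  have hG : Gamma (1 - l) ≠ 0 := (Gamma_pos_of_pos (by linarith)).ne'
  have hΓ : Gamma (1 / 2 - l) = Gamma (1 - α) * 2 ^ α * √π / Gamma (1 - l) := by
    rw [← hdup]; field_simp
  have h1l : (1 - l) ≠ 0 := by linarith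
  rw [diskLipschitz, hΓ, show (2 - α / 2 : ℝ) = (1 - l) + 1 by rw [hl]; ring,
    Gamma_add_one h1l]
  have hsq : √π * √π = π := mul_self_sqrt hpi.le
  have hα : α = 2 * l := by rw [hl]; ring
  calc _ = 2 * (4 ^ (-l) * 2 ^ α) * (√π * √π) * (Gamma (1 - α) / Gamma (1 - l) ^ 2)
        * (l / (1 - l)) := by
        field_simp
        ring
    _ = _ := by
        rw [h4, hsq]
        nth_rw 2 [hα]
        nth_rw 2 [hα]
        field_simp

/-- Continuity of `diskForce` at `ρ = 1`, from the left, extends the monotonicity up to the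
boundary. -/
lemma diskForce_le_of_lt_one {α : ℝ} (hα0 : 0 < α) (hα1 : α < 1) {ρ : ℝ} (hρ0 : 0 ≤ ρ)
    (hρ1 : ρ < 1) : diskForce α ρ ≤ diskForce α 1 := by
  have hlim : Tendsto (diskForce α) (𝓝[<] 1) (𝓝 (diskForce α 1)) := by
    refine intervalIntegral.tendsto_integral_filter_of_dominated_convergence
      (fun θ => (1 - cos θ) ^ (-(α / 2))) ?_ ?_ (intervalIntegrable_one_sub_cos_rpow hα0 hα1) ?_
    · exact Eventually.of_forall fun r => Measurable.aestronglyMeasurable (by fun_prop)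
    · have hhalf : ∀ᶠ r : ℝ in 𝓝[<] 1, 1 / 2 < r :=
        nhdsWithin_le_nhds (lt_mem_nhds (by norm_num))
      have h0 : ∀ᵐ θ : ℝ, θ ≠ 0 := by simp [ae_iff, measure_singleton]
      filter_upwards [hhalf] with r hr
      filter_upwards [h0] with θ hθ hm
      rw [uIoc_of_le (by linarith [Real.pi_pos])] at hm
      have h2 := cos_le_one_sub_mul_cos_sq (x := θ) (abs_le.2 ⟨hm.1.le, hm.2⟩)
      have h3 : 0 < 2 / π ^ 2 * θ ^ 2 := by positivity
      have h4 : 1 - cos θ ≤ 1 + r ^ 2 - 2 * r * cos θ := by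
        nlinarith [sq_nonneg (1 - r), mul_nonneg (by linarith : (0 : ℝ) ≤ 2 * r - 1)
          (h3.le.trans (by linarith : _ ≤ 1 - cos θ))]
      rw [norm_mul, Real.norm_of_nonneg (rpow_nonneg (by linarith) _)]
      calc ‖cos θ‖ * (1 + r ^ 2 - 2 * r * cos θ) ^ (-(α / 2))
          ≤ 1 * (1 - cos θ) ^ (-(α / 2)) := by
            refine mul_le_mul (abs_cos_le_one θ) ?_ (rpow_nonneg (by linarith) _) zero_le_one
            exact rpow_le_rpow_of_nonpos (by linarith) h4 (by linarith)
        _ = _ := one_mul _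
    · have h0 : ∀ᵐ θ : ℝ, θ ≠ 0 := by simp [ae_iff, measure_singleton]
      filter_upwards [h0] with θ hθ hm
      rw [uIoc_of_le (by linarith [Real.pi_pos])] at hm
      have h2 := cos_le_one_sub_mul_cos_sq (x := θ) (abs_le.2 ⟨hm.1.le, hm.2⟩)
      have h3 : 0 < 2 / π ^ 2 * θ ^ 2 := by positivity
      refine Tendsto.mono_left ?_ nhdsWithin_le_nhds
      refine ContinuousAt.tendsto
        (f := fun r : ℝ => cos θ * (1 + r ^ 2 - 2 * r * cos θ) ^ (-(α / 2))) ?_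
      refine ContinuousAt.mul continuousAt_const (ContinuousAt.rpow_const (by fun_prop) (Or.inl ?_))
      have : 0 < 1 + (1:ℝ) ^ 2 - 2 * 1 * cos θ := by linarith
      exact this.ne'
  refine ge_of_tendsto hlim ?_
  filter_upwards [Ioo_mem_nhdsLT hρ1] with r hr
  exact diskForce_le_diskForce hα0 hρ0 hr.1.le hr.2

end RieszIsoperimetric

namespace RieszIsoperimetric

open Real Set Filter Topology

/-! ### Lipschitz bound for the potential of the disk -/

lemma diskForce_nonneg {α : ℝ} (hα0 : 0 < α) {ρ : ℝ} (hρ0 : 0 ≤ ρ) (hρ1 : ρ < 1) :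
    0 ≤ diskForce α ρ := by
  have h := diskForce_le_diskForce hα0 le_rfl hρ0 hρ1
  refine le_trans (le_of_eq ?_) h
  simp [diskForce]

/-- Inversion reduces the exterior of the disk to its interior. -/
lemma diskForce_le_diskForce_one {α : ℝ} (hα0 : 0 < α) (hα1 : α < 1) {ρ : ℝ} (hρ0 : 0 < ρ)
    (hρ1 : ρ ≠ 1) : diskForce α ρ ≤ diskForce α 1 := by
  rcases lt_or_gt_of_ne hρ1 with h | h
  · exact diskForce_le_of_lt_one hα0 hα1 hρ0.le h
  · have hinv0 : 0 < ρ⁻¹ := by positivity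
    have hinv1 : ρ⁻¹ < 1 := inv_lt_one_of_one_lt₀ h
    have h1 : diskForce α ρ = ρ ^ (-α) * diskForce α ρ⁻¹ := by
      rw [diskForce, diskForce, ← intervalIntegral.integral_const_mul]
      refine intervalIntegral.integral_congr fun θ _ => ?_
      have h2 : 0 ≤ 1 + ρ⁻¹ ^ 2 - 2 * ρ⁻¹ * cos θ := by
        nlinarith [sq_nonneg (ρ⁻¹ - cos θ), cos_sq_le_one θ]
      have h3 : 1 + ρ ^ 2 - 2 * ρ * cos θ = ρ ^ 2 * (1 + ρ⁻¹ ^ 2 - 2 * ρ⁻¹ * cos θ) := by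
        field_simp
        ring
      rw [h3, mul_rpow (by positivity) h2, ← rpow_natCast ρ, ← rpow_mul hρ0.le,
        show ((2 : ℕ) : ℝ) * -(α / 2) = -α by push_cast; ring]
      ring
    rw [h1]
    calc ρ ^ (-α) * diskForce α ρ⁻¹ ≤ 1 * diskForce α ρ⁻¹ := by
          refine mul_le_mul_of_nonneg_right ?_ (diskForce_nonneg hα0 hinv0.le hinv1)
          exact rpow_le_one_of_one_le_of_nonpos h.le (by linarith)
      _ ≤ _ := by
          rw [one_mul]
          exact diskForce_le_of_lt_one hα0 hα1 hinv0.le hinv1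

/-- The contribution to `diskForce` of one half of the circle: `c = -cos` is the half facing the
point at distance `ρ`, `c = cos` is the opposite half, and `diskForce` is their difference. -/
noncomputable def halfForce (α : ℝ) (c : ℝ → ℝ) (ρ : ℝ) : ℝ≥0∞ :=
  ∫⁻ θ in Ioo (-(π / 2)) (π / 2), ENNReal.ofReal (cos θ)
    * ENNReal.ofReal (((ρ + c θ) ^ 2 + sin θ ^ 2) ^ (-(α / 2)))

lemma halfForce_neg_cos_le {α : ℝ} (hα0 : 0 < α) (hα1 : α < 1) {ρ : ℝ} (hρ0 : 0 < ρ)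
    (hρ1 : ρ ≠ 1) : halfForce α (fun θ => -cos θ) ρ
      ≤ halfForce α cos ρ + ENNReal.ofReal (diskLipschitz α) := by
  have hpi := Real.pi_pos
  set K : ℝ → ℝ := fun x => (1 + ρ ^ 2 - 2 * ρ * x) ^ (-(α / 2)) with hK
  have hbase : ∀ x : ℝ, x ∈ Icc (-1) 1 → 0 < 1 + ρ ^ 2 - 2 * ρ * x := by
    intro x hx
    have : 0 < (1 - ρ) ^ 2 := by
      have : 1 - ρ ≠ 0 := sub_ne_zero.2 hρ1.symm
      positivity
    nlinarith [hx.2]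
  have hKc : ∀ f : ℝ → ℝ, Continuous f → (∀ θ, f θ ∈ Icc (-1 : ℝ) 1) →
      Continuous fun θ => cos θ * K (f θ) := by
    intro f hf hf1
    refine continuous_cos.mul (Continuous.rpow_const (by fun_prop) fun θ => Or.inl ?_)
    exact (hbase _ (hf1 θ)).ne'
  have hK1 := hKc cos continuous_cos fun θ => cos_mem_Icc θ
  have hK2 := hKc (fun θ => -cos θ) continuous_cos.neg
    fun θ => ⟨by linarith [cos_le_one θ], by linarith [neg_one_le_cos θ]⟩
  have hreal : ∀ f : ℝ → ℝ, Continuous (fun θ => cos θ * K (f θ)) → (∀ θ, f θ ∈ Icc (-1 : ℝ) 1) →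
      ∫⁻ θ in Ioo (-(π / 2)) (π / 2), ENNReal.ofReal (cos θ) * ENNReal.ofReal (K (f θ))
        = ENNReal.ofReal (∫ θ in (-(π / 2))..(π / 2), cos θ * K (f θ)) := by
    intro f hf hf1
    rw [intervalIntegral.integral_of_le (by linarith), integral_Ioc_eq_integral_Ioo,
      ofReal_integral_eq_lintegral_ofReal]
    · refine setLIntegral_congr_fun measurableSet_Ioo fun θ hθ => ?_
      rw [ENNReal.ofReal_mul (cos_pos_of_mem_Ioo hθ).le]
    · exact (hf.intervalIntegrable (-(π / 2)) (π / 2)).1.mono_set Ioo_subset_Ioc_self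
    · filter_upwards [ae_restrict_mem measurableSet_Ioo] with θ hθ
      exact mul_nonneg (cos_pos_of_mem_Ioo hθ).le (rpow_nonneg (hbase _ (hf1 θ)).le _)
  have e1 : halfForce α (fun θ => -cos θ) ρ
      = ENNReal.ofReal (∫ θ in (-(π / 2))..(π / 2), cos θ * K (cos θ)) := by
    rw [← hreal cos hK1 fun θ => cos_mem_Icc θ]
    refine lintegral_congr fun θ => ?_
    rw [hK]
    congr 3
    nlinarith [sin_sq_add_cos_sq θ]
  have e2 : halfForce α cos ρ
      = ENNReal.ofReal (∫ θ in (-(π / 2))..(π / 2), cos θ * K (-cos θ)) := by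
    rw [← hreal (fun θ => -cos θ) hK2
      fun θ => ⟨by linarith [cos_le_one θ], by linarith [neg_one_le_cos θ]⟩]
    refine lintegral_congr fun θ => ?_
    rw [hK]
    congr 3
    nlinarith [sin_sq_add_cos_sq θ]
  have e3 : diskForce α ρ = (∫ θ in (-(π / 2))..(π / 2), cos θ * K (cos θ))
      - ∫ θ in (-(π / 2))..(π / 2), cos θ * K (-cos θ) := by
    have hper : Function.Periodic (fun θ => cos θ * K (cos θ)) (2 * π) := fun θ => by
      simp only [cos_add_two_pi]
    have h1 := hper.intervalIntegral_add_eq (-π) (-(π / 2))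
    rw [show -π + 2 * π = π by ring] at h1
    rw [diskForce, h1, ← intervalIntegral.integral_add_adjacent_intervals
      (hK1.intervalIntegrable _ (π / 2)) (hK1.intervalIntegrable _ _), sub_eq_add_neg]
    congr 1
    have h2 := intervalIntegral.integral_comp_add_right (a := -(π / 2)) (b := π / 2)
      (fun θ => cos θ * K (cos θ)) π
    rw [show -(π / 2) + 2 * π = π / 2 + π by ring]
    rw [show -(π / 2) + π = π / 2 by ring] at h2
    rw [← h2, ← intervalIntegral.integral_neg]
    refine intervalIntegral.integral_congr fun θ _ => ?_
    simp only [cos_add_pi]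
    ring
  have h := diskForce_le_diskForce_one hα0 hα1 hρ0 hρ1
  rw [e3, diskForce_one hα0 hα1] at h
  rw [e1, e2]
  exact (ENNReal.ofReal_le_ofReal (by linarith)).trans ENNReal.ofReal_add_le

/-- The points of the half circle opposite to the point at distance `ρ` are at distance at least
`1` from it. -/
lemma halfForce_cos_le {α : ℝ} (hα0 : 0 < α) {ρ : ℝ} (hρ0 : 0 ≤ ρ) :
    halfForce α cos ρ ≤ ENNReal.ofReal π := by
  calc halfForce α cos ρ ≤ ∫⁻ θ in Ioo (-(π / 2)) (π / 2), 1 := by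
        refine setLIntegral_mono' measurableSet_Ioo fun θ hθ => ?_
        rw [← one_mul (1 : ℝ≥0∞)]
        refine mul_le_mul' (ENNReal.ofReal_le_one.2 (cos_le_one θ)) (ENNReal.ofReal_le_one.2 ?_)
        refine rpow_le_one_of_one_le_of_nonpos ?_ (by linarith)
        nlinarith [sin_sq_add_cos_sq θ, mul_nonneg hρ0 (cos_pos_of_mem_Ioo hθ).le]
    _ = ENNReal.ofReal π := by
        rw [setLIntegral_const, Real.volume_Ioo, one_mul]
        ring_nf

/-- The potential `∫_B |y - x|^{-α} dy` of the unit disk `B`. -/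
noncomputable def diskPotential (α : ℝ) (x : Plane) : ℝ≥0∞ :=
  ∫⁻ y in Metric.ball 0 1, ENNReal.ofReal (1 / ‖y - x‖ ^ α)

lemma setLIntegral_Ioc_comp_add (f : ℝ → ℝ≥0∞) (a b d : ℝ) :
    ∫⁻ x in Ioc a b, f (x + d) = ∫⁻ x in Ioc (a + d) (b + d), f x := by
  rw [← lintegral_indicator measurableSet_Ioc, ← lintegral_indicator measurableSet_Ioc,
    ← lintegral_add_right_eq_self ((Ioc (a + d) (b + d)).indicator fun x => f x) d]
  refine lintegral_congr fun x => ?_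
  simp only [indicator, mem_Ioc, add_lt_add_iff_right, add_le_add_iff_right]

lemma image_sin_Ioo : sin '' Ioo (-(π / 2)) (π / 2) = Ioo (-1) 1 := by
  ext x
  constructor
  · rintro ⟨θ, ⟨h0, h1⟩, rfl⟩
    have h2 := sin_lt_sin_of_lt_of_le_pi_div_two le_rfl h1.le h0
    have h3 := sin_lt_sin_of_lt_of_le_pi_div_two h0.le le_rfl h1
    rw [sin_neg, sin_pi_div_two] at h2
    rw [sin_pi_div_two] at h3
    exact ⟨h2, h3⟩
  · rintro ⟨h0, h1⟩
    exact ⟨arcsin x, ⟨neg_pi_div_two_lt_arcsin.2 h0, arcsin_lt_pi_div_two.2 h1⟩,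
      sin_arcsin h0.le h1.le⟩

/-- The potential of the disk as an integral over the chords parallel to the direction of `x`. -/
lemma diskPotential_eq_chords (α φ r : ℝ) :
    diskPotential α (-(r • dir φ)) = ∫⁻ θ in Ioo (-(π / 2)) (π / 2), ENNReal.ofReal (cos θ)
      * ∫⁻ a in Ioc (r - cos θ) (r + cos θ), ENNReal.ofReal ((a ^ 2 + sin θ ^ 2) ^ (-(α / 2))) := by
  have hm : Measurable ((Metric.ball (0 : Plane) 1).indicator
      fun y => ENNReal.ofReal (1 / ‖y - -(r • dir φ)‖ ^ α)) :=
    (measurable_kernel_left α _).indicator measurableSet_ball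
  have hnorm : ∀ a t : ℝ, ‖a • dir φ + t • dir (φ + π / 2)‖ ^ 2 = a ^ 2 + t ^ 2 := by
    intro a t
    rw [norm_sq_plane]
    simp only [PiLp.add_apply, PiLp.smul_apply, dir_zero_apply, dir_one_apply, smul_eq_mul,
      cos_add_pi_div_two, sin_add_pi_div_two]
    nlinarith [sin_sq_add_cos_sq φ]
  set F : ℝ → ℝ≥0∞ := fun t => ∫⁻ s : ℝ, (Metric.ball (0 : Plane) 1).indicator
      (fun y => ENNReal.ofReal (1 / ‖y - -(r • dir φ)‖ ^ α)) (s • dir φ + t • dir (φ + π / 2))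
    with hF
  have hF0 : ∀ t ∉ Ioo (-1 : ℝ) 1, F t = 0 := by
    intro t ht
    rw [hF]
    simp only
    rw [← lintegral_zero (μ := (volume : Measure ℝ))]
    refine lintegral_congr fun s : ℝ => indicator_of_notMem (fun hs => ht ?_) _
    rw [mem_ball_zero_iff] at hs
    have h1 := hnorm s t
    have h2 : t ^ 2 < 1 := by nlinarith [norm_nonneg (s • dir φ + t • dir (φ + π / 2))]
    exact abs_lt.1 (by rwa [sq_lt_one_iff_abs_lt_one] at h2)
  rw [diskPotential, ← lintegral_indicator measurableSet_ball, lintegral_eq_lintegral_frame φ hm]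
  have h1 : ∫⁻ t, F t = ∫⁻ t in Ioo (-1 : ℝ) 1, F t := by
    rw [← lintegral_indicator measurableSet_Ioo]
    refine lintegral_congr fun t => ?_
    by_cases ht : t ∈ Ioo (-1 : ℝ) 1
    · rw [indicator_of_mem ht]
    · rw [indicator_of_notMem ht, hF0 t ht]
  refine h1.trans ?_
  rw [← image_sin_Ioo, lintegral_image_eq_lintegral_abs_deriv_mul (f' := cos) measurableSet_Ioo
    (fun θ _ => (hasDerivAt_sin θ).hasDerivWithinAt)
    (injOn_sin.mono Ioo_subset_Icc_self)]
  refine setLIntegral_congr_fun measurableSet_Ioo fun θ hθ => ?_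
  have hc := cos_pos_of_mem_Ioo hθ
  rw [abs_of_pos hc]
  congr 1
  rw [show r - cos θ = -cos θ + r by ring, show r + cos θ = cos θ + r by ring,
    ← setLIntegral_Ioc_comp_add (fun a => ENNReal.ofReal ((a ^ 2 + sin θ ^ 2) ^ (-(α / 2)))),
    ← restrict_Ioo_eq_restrict_Ioc, ← lintegral_indicator measurableSet_Ioo, hF]
  refine lintegral_congr fun s => ?_
  have hiff : s • dir φ + sin θ • dir (φ + π / 2) ∈ Metric.ball (0 : Plane) 1
      ↔ s ∈ Ioo (-cos θ) (cos θ) := by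
    rw [mem_ball_zero_iff, ← sq_lt_one_iff₀ (norm_nonneg _), hnorm, mem_Ioo, ← abs_lt,
      ← sq_lt_sq₀ (abs_nonneg _) hc.le, sq_abs]
    constructor <;> intro h <;> linarith [sin_sq_add_cos_sq θ]
  by_cases hs : s ∈ Ioo (-cos θ) (cos θ)
  · rw [indicator_of_mem (hiff.2 hs), indicator_of_mem hs]
    congr 1
    rw [show s • dir φ + sin θ • dir (φ + π / 2) - -(r • dir φ)
      = (s + r) • dir φ + sin θ • dir (φ + π / 2) by module, ← hnorm, ← rpow_natCast,
      ← rpow_mul (norm_nonneg _), one_div, ← rpow_neg (norm_nonneg _)]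
    congr 1
    push_cast
    ring
  · rw [indicator_of_notMem (fun h => hs (hiff.1 h)), indicator_of_notMem hs]

lemma lintegral_mul_lintegral_swap {f : ℝ → ℝ≥0∞} (hf : Measurable f) {K : ℝ → ℝ → ℝ≥0∞}
    (hK : Measurable fun p : ℝ × ℝ => K p.1 p.2) (S T : Set ℝ) :
    ∫⁻ ρ in T, ∫⁻ θ in S, f θ * K θ ρ = ∫⁻ θ in S, f θ * ∫⁻ ρ in T, K θ ρ := by
  rw [lintegral_lintegral_swap]
  · refine lintegral_congr fun θ => ?_
    exact lintegral_const_mul _ (hK.comp (measurable_const.prodMk measurable_id))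
  · exact ((hf.comp measurable_snd).mul (hK.comp measurable_swap)).aemeasurable

/-- Sliding each chord from position `r` to position `s` gains its front end and loses its rear
end. -/
lemma diskPotential_add_lintegral_halfForce (α φ ψ : ℝ) {r s : ℝ} (hrs : r ≤ s) :
    diskPotential α (-(r • dir φ)) + ∫⁻ ρ in Ioc r s, halfForce α cos ρ
      = diskPotential α (-(s • dir ψ)) + ∫⁻ ρ in Ioc r s, halfForce α (fun θ => -cos θ) ρ := by
  set k : ℝ → ℝ → ℝ≥0∞ := fun θ a => ENNReal.ofReal ((a ^ 2 + sin θ ^ 2) ^ (-(α / 2))) with hk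
  have hkm : ∀ c : ℝ → ℝ, Continuous c → Measurable fun p : ℝ × ℝ => k p.1 (p.2 + c p.1) := by
    intro c hc
    exact ENNReal.measurable_ofReal.comp
      ((Continuous.measurable (by fun_prop)).pow_const _)
  have hswap : ∀ c : ℝ → ℝ, Continuous c → ∫⁻ ρ in Ioc r s, halfForce α c ρ
      = ∫⁻ θ in Ioo (-(π / 2)) (π / 2),
        ENNReal.ofReal (cos θ) * ∫⁻ ρ in Ioc r s, k θ (ρ + c θ) := by
    intro c hc
    exact lintegral_mul_lintegral_swap (ENNReal.measurable_ofReal.comp continuous_cos.measurable)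
      (K := fun θ ρ => k θ (ρ + c θ)) (hkm c hc) _ _
  have hmeas : ∀ c : ℝ → ℝ, Continuous c → Measurable fun θ =>
      ENNReal.ofReal (cos θ) * ∫⁻ ρ in Ioc r s, k θ (ρ + c θ) := by
    intro c hc
    refine Measurable.mul (ENNReal.measurable_ofReal.comp continuous_cos.measurable) ?_
    exact Measurable.lintegral_prod_right' (hkm c hc)
  rw [hswap cos continuous_cos, hswap (fun θ => -cos θ) continuous_cos.neg,
    diskPotential_eq_chords, diskPotential_eq_chords,
    ← lintegral_add_right _ (hmeas cos continuous_cos),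
    ← lintegral_add_right _ (hmeas (fun θ => -cos θ) continuous_cos.neg)]
  refine setLIntegral_congr_fun measurableSet_Ioo fun θ hθ => ?_
  have hc := cos_pos_of_mem_Ioo hθ
  rw [← mul_add, ← mul_add, setLIntegral_Ioc_comp_add (k θ), setLIntegral_Ioc_comp_add (k θ)]
  congr 1
  have hu : ∀ a b c : ℝ, a ≤ b → b ≤ c →
      (∫⁻ x in Ioc a b, k θ x) + ∫⁻ x in Ioc b c, k θ x = ∫⁻ x in Ioc a c, k θ x := by
    intro a b c hab hbc
    rw [← lintegral_union measurableSet_Ioc (Ioc_disjoint_Ioc_of_le le_rfl),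
      Ioc_union_Ioc_eq_Ioc hab hbc]
  rw [hu _ _ _ (by linarith) (by linarith), add_comm (∫⁻ x in Ioc (s - cos θ) _, k θ x),
    ← sub_eq_add_neg, ← sub_eq_add_neg, hu _ _ _ (by linarith) (by linarith)]

/-- The radial Lipschitz bound for the potential of the unit disk. -/
theorem diskPotential_le_add {α : ℝ} (hα0 : 0 < α) (hα1 : α < 1) {x y : Plane} (hxy : ‖x‖ ≤ ‖y‖) :
    diskPotential α x
      ≤ diskPotential α y + ENNReal.ofReal (diskLipschitz α * (‖y‖ - ‖x‖)) := by
  obtain ⟨φ, hφ⟩ := exists_eq_smul_dir x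
  obtain ⟨ψ, hψ⟩ := exists_eq_smul_dir y
  have hx : x = -(‖x‖ • dir (φ + π)) := by rw [dir_add_pi, smul_neg, neg_neg, ← hφ]
  have hy : y = -(‖y‖ • dir (ψ + π)) := by rw [dir_add_pi, smul_neg, neg_neg, ← hψ]
  have h := diskPotential_add_lintegral_halfForce α (φ + π) (ψ + π) hxy
  rw [← hx, ← hy] at h
  have hne : ∫⁻ ρ in Ioc ‖x‖ ‖y‖, halfForce α cos ρ ≠ ⊤ := by
    refine ne_of_lt (lt_of_le_of_lt (setLIntegral_mono' measurableSet_Ioc fun ρ hρ =>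
      halfForce_cos_le hα0 ((norm_nonneg x).trans hρ.1.le)) ?_)
    rw [setLIntegral_const]
    exact ENNReal.mul_lt_top ENNReal.ofReal_lt_top (by simp)
  -- the radius `ρ = 1`, where the force is singular, is negligible
  have hle : ∫⁻ ρ in Ioc ‖x‖ ‖y‖, halfForce α (fun θ => -cos θ) ρ
      ≤ (∫⁻ ρ in Ioc ‖x‖ ‖y‖, halfForce α cos ρ)
        + ENNReal.ofReal (diskLipschitz α * (‖y‖ - ‖x‖)) := by
    have h1 : ∀ᵐ ρ ∂(volume.restrict (Ioc ‖x‖ ‖y‖)), halfForce α (fun θ => -cos θ) ρ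
        ≤ halfForce α cos ρ + ENNReal.ofReal (diskLipschitz α) := by
      have hne1 : ∀ᵐ ρ ∂(volume.restrict (Ioc ‖x‖ ‖y‖)), ρ ≠ 1 :=
        ae_restrict_of_ae (by simp [ae_iff, measure_singleton])
      filter_upwards [hne1, ae_restrict_mem measurableSet_Ioc] with ρ h1 hρ
      exact halfForce_neg_cos_le hα0 hα1 ((norm_nonneg x).trans_lt hρ.1) h1
    refine (lintegral_mono_ae h1).trans ?_
    rw [lintegral_add_right _ measurable_const, setLIntegral_const, Real.volume_Ioc,
      ← ENNReal.ofReal_mul' (sub_nonneg.2 hxy)]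
  refine (ENNReal.add_le_add_iff_right hne).1 ?_
  rw [h, add_assoc, add_comm (ENNReal.ofReal _)]
  gcongr

end RieszIsoperimetric

namespace RieszIsoperimetric

open Real Set Filter Topology

/-! ### Comparison with the disk -/

lemma measure_diff_eq_of_measure_eq {A B : Set Plane} (hA : MeasurableSet A) (hB : MeasurableSet B)
    (hAB : volume A = volume B) (hfin : volume B ≠ ⊤) : volume (B \ A) = volume (A \ B) := by
  have h1 := measure_inter_add_sdiff (μ := volume) A hB
  have h2 := measure_inter_add_sdiff (μ := volume) B hA
  rw [inter_comm] at h2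
  have hne : volume (A ∩ B) ≠ ⊤ := ne_top_of_le_ne_top hfin (measure_mono inter_subset_right)
  exact (ENNReal.add_right_inj hne).1 (by rw [h1, h2, hAB])

/-- The bathtub principle: among sets of given measure, a sublevel set minimizes the integral. -/
lemma setLIntegral_le_setLIntegral_of_sublevel {A B : Set Plane} (hA : MeasurableSet A)
    (hB : MeasurableSet B) (hAB : volume A = volume B) (hfin : volume B ≠ ⊤) {G : Plane → ℝ≥0∞}
    {c : ℝ≥0∞} (h1 : ∀ x ∈ B, G x ≤ c) (h2 : ∀ x ∉ B, c ≤ G x) :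
    ∫⁻ x in B, G x ≤ ∫⁻ x in A, G x := by
  rw [← lintegral_inter_add_sdiff G B hA, ← lintegral_inter_add_sdiff G A hB, inter_comm]
  refine add_le_add le_rfl ?_
  calc ∫⁻ x in B \ A, G x ≤ ∫⁻ x in B \ A, c :=
        setLIntegral_mono' (hB.diff hA) fun x hx => h1 x hx.1
    _ = ∫⁻ x in A \ B, c := by
        rw [setLIntegral_const, setLIntegral_const, measure_diff_eq_of_measure_eq hA hB hAB hfin]
    _ ≤ _ := setLIntegral_mono' (hA.diff hB) fun x hx => h2 x hx.2

lemma lintegral_ball_norm :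
    ∫⁻ x in Metric.ball (0 : Plane) 1, ENNReal.ofReal ‖x‖ = ENNReal.ofReal (2 * π / 3) := by
  have hpi := Real.pi_pos
  have hm : Measurable ((Metric.ball (0 : Plane) 1).indicator fun x => ENNReal.ofReal ‖x‖) :=
    (ENNReal.measurable_ofReal.comp continuous_norm.measurable).indicator measurableSet_ball
  rw [← lintegral_indicator measurableSet_ball, lintegral_eq_lintegral_polar hm]
  have h1 : ∀ θ : ℝ, ∫⁻ r in Ioi (0 : ℝ), ENNReal.ofReal r
      * (Metric.ball (0 : Plane) 1).indicator (fun x => ENNReal.ofReal ‖x‖) (r • dir θ)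
      = ENNReal.ofReal (1 / 3) := by
    intro θ
    have h2 : ∫⁻ r in Ioo (0 : ℝ) 1, ENNReal.ofReal (r ^ 2) = ENNReal.ofReal (1 / 3) := by
      rw [← ofReal_integral_eq_lintegral_ofReal, ← integral_Ioc_eq_integral_Ioo,
        ← intervalIntegral.integral_of_le zero_le_one, integral_pow]
      · norm_num
      · exact ((continuous_pow 2).intervalIntegrable (0 : ℝ) 1).1.mono_set Ioo_subset_Ioc_self
      · exact Eventually.of_forall fun r => by positivity
    rw [← h2, ← lintegral_indicator measurableSet_Ioi, ← lintegral_indicator measurableSet_Ioo]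
    refine lintegral_congr fun r => ?_
    by_cases hr : 0 < r
    · have hn : ‖r • dir θ‖ = r := by
        rw [norm_smul, norm_dir, mul_one, Real.norm_of_nonneg hr.le]
      rw [indicator_of_mem (show r ∈ Ioi (0 : ℝ) from hr)]
      by_cases hr1 : r < 1
      · rw [indicator_of_mem (show r ∈ Ioo (0 : ℝ) 1 from ⟨hr, hr1⟩), indicator_of_mem
          (by rwa [mem_ball_zero_iff, hn]), hn, ← ENNReal.ofReal_mul hr.le, sq]
      · rw [indicator_of_notMem (fun h : r ∈ Ioo (0 : ℝ) 1 => hr1 h.2), indicator_of_notMem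
          (by rwa [mem_ball_zero_iff, hn]), mul_zero]
    · rw [indicator_of_notMem (show r ∉ Ioi (0 : ℝ) from hr),
        indicator_of_notMem (fun h : r ∈ Ioo (0 : ℝ) 1 => hr h.1)]
  simp only [h1]
  rw [setLIntegral_const, Real.volume_Ioo, ← ENNReal.ofReal_mul (by norm_num)]
  congr 1
  ring

lemma rieszEnergy_preimage_add (α : ℝ) (x₀ : Plane) (F : Set Plane) :
    rieszEnergy α ((fun x => x + x₀) ⁻¹' F) = rieszEnergy α F := by
  have hmp := measurePreserving_add_right (volume : Measure Plane) x₀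
  have hemb := measurableEmbedding_addRight x₀
  unfold rieszEnergy
  rw [← hmp.setLIntegral_comp_preimage_emb hemb _ F]
  refine lintegral_congr fun y => ?_
  rw [← hmp.setLIntegral_comp_preimage_emb hemb _ F]
  simp only [add_sub_add_right_eq_sub]

lemma diskLipschitz_pos {α : ℝ} (hα0 : 0 < α) (hα1 : α < 1) : 0 < diskLipschitz α := by
  have := Gamma_pos_of_pos (show 0 < 1 - α by linarith)
  have := Gamma_pos_of_pos (show 0 < 2 - α / 2 by linarith)
  have : 0 < 2 - α := by linarith
  unfold diskLipschitz
  positivity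

lemma rieszEnergy_ball_add_le_of_center_zero {α : ℝ} (hα0 : 0 < α) (hα1 : α < 1) {A : Set Plane}
    (hA : MeasurableSet A) (hvol : volume A = ENNReal.ofReal π) :
    rieszEnergy α (Metric.ball 0 1) + ENNReal.ofReal (2 * diskLipschitz α * (2 * π / 3))
      ≤ rieszEnergy α A
        + ENNReal.ofReal (2 * diskLipschitz α) * ∫⁻ x in A, ENNReal.ofReal ‖x‖ := by
  set B : Set Plane := Metric.ball 0 1 with hB
  set L := diskLipschitz α with hL
  have hLpos : 0 < L := diskLipschitz_pos hα0 hα1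
  have hvB : volume B = ENNReal.ofReal π := isAdmissible_ball.volume_eq
  have hBt : volume B ≠ ⊤ := by rw [hvB]; exact ENNReal.ofReal_ne_top
  have he : ‖dir 0‖ = 1 := norm_dir 0
  have hbath := setLIntegral_le_setLIntegral_of_sublevel hA measurableSet_ball (hvol.trans hvB.symm)
    hBt (G := fun x => diskPotential α x + ENNReal.ofReal L * ENNReal.ofReal ‖x‖)
    (c := diskPotential α (dir 0) + ENNReal.ofReal L) (fun x hx => ?_) (fun x hx => ?_)
  · have hm : Measurable fun x : Plane => ENNReal.ofReal L * ENNReal.ofReal ‖x‖ :=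
      (ENNReal.measurable_ofReal.comp continuous_norm.measurable).const_mul _
    rw [lintegral_add_right _ hm, lintegral_add_right _ hm, lintegral_const_mul' _ _
      ENNReal.ofReal_ne_top, lintegral_const_mul' _ _ ENNReal.ofReal_ne_top,
      lintegral_ball_norm] at hbath
    have hPD := two_mul_interaction_le hα0 A B
    have hBB : rieszEnergy α B ≠ ⊤ :=
      (interaction_lt_top hα0 (by linarith) hBt.lt_top hBt.lt_top).ne
    change interaction α B B + _ ≤ interaction α A B + _ at hbath
    have h2 : ENNReal.ofReal (2 * L) = 2 * ENNReal.ofReal L := by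
      rw [ENNReal.ofReal_mul (by norm_num)]; norm_num
    refine (ENNReal.add_le_add_iff_left hBB).1 ?_
    calc rieszEnergy α B + (rieszEnergy α B + ENNReal.ofReal (2 * L * (2 * π / 3)))
        = 2 * (interaction α B B + ENNReal.ofReal L * ENNReal.ofReal (2 * π / 3)) := by
          rw [ENNReal.ofReal_mul (by positivity), h2, rieszEnergy_eq_interaction]
          ring
      _ ≤ 2 * (interaction α A B + ENNReal.ofReal L * ∫⁻ x in A, ENNReal.ofReal ‖x‖) := by
          gcongr
      _ = 2 * interaction α A B + ENNReal.ofReal (2 * L) * ∫⁻ x in A, ENNReal.ofReal ‖x‖ := by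
          rw [h2]; ring
      _ ≤ (interaction α A A + interaction α B B)
          + ENNReal.ofReal (2 * L) * ∫⁻ x in A, ENNReal.ofReal ‖x‖ := by gcongr
      _ = _ := by
          rw [rieszEnergy_eq_interaction, rieszEnergy_eq_interaction]
          ring
  · have hx1 : ‖x‖ < 1 := mem_ball_zero_iff.1 hx
    have h := diskPotential_le_add hα0 hα1 (x := x) (y := dir 0) (by rw [he]; exact hx1.le)
    rw [← ENNReal.ofReal_mul hLpos.le]
    calc _ ≤ diskPotential α (dir 0) + ENNReal.ofReal (L * (‖dir 0‖ - ‖x‖))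
          + ENNReal.ofReal (L * ‖x‖) := by gcongr
      _ = _ := by
        rw [add_assoc, ← ENNReal.ofReal_add (mul_nonneg hLpos.le (by rw [he]; linarith))
          (by positivity), he]
        ring_nf
  · have hx1 : 1 ≤ ‖x‖ := not_lt.1 fun h => hx (mem_ball_zero_iff.2 h)
    have h := diskPotential_le_add hα0 hα1 (x := dir 0) (y := x) (by rwa [he])
    rw [← ENNReal.ofReal_mul hLpos.le]
    calc _ ≤ diskPotential α x + ENNReal.ofReal (L * (‖x‖ - ‖dir 0‖)) + ENNReal.ofReal L := by
          gcongr
      _ = _ := by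
        rw [add_assoc, ← ENNReal.ofReal_add (mul_nonneg hLpos.le (by rw [he]; linarith))
          hLpos.le, he]
        ring_nf

/-- The gap in Riesz energy to the disk is controlled by the gap in first moments, `2 * π / 3`
being the first moment of the disk. -/
theorem rieszEnergy_ball_add_le {α : ℝ} (hα0 : 0 < α) (hα1 : α < 1) {F : Set Plane}
    (hF : MeasurableSet F) (hvol : volume F = ENNReal.ofReal π) (x₀ : Plane) :
    rieszEnergy α (Metric.ball 0 1) + ENNReal.ofReal (2 * diskLipschitz α * (2 * π / 3))
      ≤ rieszEnergy α F
        + ENNReal.ofReal (2 * diskLipschitz α) * ∫⁻ x in F, ENNReal.ofReal ‖x - x₀‖ := by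
  have hmp := measurePreserving_add_right (volume : Measure Plane) x₀
  have hemb := measurableEmbedding_addRight x₀
  have h := rieszEnergy_ball_add_le_of_center_zero hα0 hα1 (hmp.measurable hF)
    ((hmp.measure_preimage hF.nullMeasurableSet).trans hvol)
  rw [rieszEnergy_preimage_add] at h
  have h2 := hmp.setLIntegral_comp_preimage_emb hemb (fun x => ENNReal.ofReal ‖x - x₀‖) F
  simp only [add_sub_cancel_right] at h2
  rwa [h2] at h

/-- Among convex open sets of area `π`, only disks attain the minimal first moment. -/
theorem eq_ball_of_lintegral_norm_sub_le {Ω : Set Plane} (ho : IsOpen Ω) (hconv : Convex ℝ Ω)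
    (hvol : volume Ω = ENNReal.ofReal π) {x₀ : Plane}
    (h : ∫⁻ x in Ω, ENNReal.ofReal ‖x - x₀‖ ≤ ENNReal.ofReal (2 * π / 3)) :
    Ω = Metric.ball x₀ 1 := by
  set B : Set Plane := Metric.ball x₀ 1 with hB
  set f : Plane → ℝ≥0∞ := fun x => ENNReal.ofReal ‖x - x₀‖ with hf
  have hfm : Measurable f := ENNReal.measurable_ofReal.comp (by fun_prop)
  have hmp := measurePreserving_add_right (volume : Measure Plane) x₀
  have hemb := measurableEmbedding_addRight x₀
  have hpre : (fun x => x + x₀) ⁻¹' B = Metric.ball 0 1 := by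
    ext x; simp [hB, dist_eq_norm]
  have hvB : volume B = ENNReal.ofReal π := by
    rw [← hmp.measure_preimage_emb hemb B, hpre]
    exact isAdmissible_ball.volume_eq
  have hBt : volume B ≠ ⊤ := by rw [hvB]; exact ENNReal.ofReal_ne_top
  have hfB : ∫⁻ x in B, f x = ENNReal.ofReal (2 * π / 3) := by
    rw [← hmp.setLIntegral_comp_preimage_emb hemb, hpre, ← lintegral_ball_norm]
    simp only [hf, add_sub_cancel_right]
  have hdiff := measure_diff_eq_of_measure_eq ho.measurableSet
    (measurableSet_ball (x := x₀) (ε := 1))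
    (hvol.trans hvB.symm) hBt
  rw [← hfB] at h
  -- otherwise moving `Ω \ B`, where `1 ≤ f`, onto `B \ Ω`, where `f < 1`, would lower the moment
  have hnull : volume (B \ Ω) = 0 := by
    by_contra hne
    have hle : ∫⁻ x in Ω \ B, f x ≤ ∫⁻ x in B \ Ω, f x := by
      rw [← lintegral_inter_add_sdiff f B ho.measurableSet,
        ← lintegral_inter_add_sdiff f Ω measurableSet_ball, inter_comm B Ω] at h
      refine (ENNReal.add_le_add_iff_left (ne_top_of_le_ne_top ?_
        (lintegral_mono_set (inter_subset_right (s := Ω) (t := B))))).1 h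
      rw [hfB]
      exact ENNReal.ofReal_ne_top
    have hlt : ∫⁻ x in B \ Ω, f x < ∫⁻ x in B \ Ω, 1 := by
      refine setLIntegral_strict_mono (measurableSet_ball.diff ho.measurableSet) hne
        measurable_const ?_ (Eventually.of_forall fun x hx => ?_)
      · refine ne_top_of_le_ne_top ?_ (lintegral_mono_set (sdiff_subset (s := B) (t := Ω)))
        rw [hfB]
        exact ENNReal.ofReal_ne_top
      · have : ‖x - x₀‖ < 1 := by simpa [hB, dist_eq_norm] using hx.1
        exact ENNReal.ofReal_lt_one.2 this
    have hge : ∫⁻ x in Ω \ B, 1 ≤ ∫⁻ x in Ω \ B, f x := by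
      refine setLIntegral_mono' (ho.measurableSet.diff measurableSet_ball) fun x hx => ?_
      have : ¬ ‖x - x₀‖ < 1 := by simpa [hB, dist_eq_norm] using hx.2
      exact ENNReal.one_le_ofReal.2 (not_lt.1 this)
    rw [setLIntegral_const, one_mul] at hlt hge
    rw [hdiff] at hlt
    exact absurd (hge.trans hle) (not_le.2 hlt)
  rw [hnull] at hdiff
  have hne : (interior Ω).Nonempty := by
    rw [ho.interior_eq]
    refine nonempty_of_measure_ne_zero (μ := volume) ?_
    rw [hvol]
    exact (ENNReal.ofReal_pos.2 Real.pi_pos).ne'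
  -- open sets of measure zero are empty
  have hsub1 : Ω ⊆ Metric.closedBall x₀ 1 := by
    have : Ω \ Metric.closedBall x₀ 1 = ∅ := by
      refine (ho.sdiff Metric.isClosed_closedBall).measure_eq_zero_iff (μ := volume) |>.1 ?_
      exact measure_mono_null (sdiff_subset_sdiff_right Metric.ball_subset_closedBall) hdiff.symm
    exact sdiff_eq_empty.1 this
  have hsub2 : B ⊆ closure Ω := by
    have : B \ closure Ω = ∅ := by
      refine (Metric.isOpen_ball.sdiff isClosed_closure).measure_eq_zero_iff (μ := volume) |>.1 ?_
      exact measure_mono_null (sdiff_subset_sdiff_right subset_closure) hnull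
    exact sdiff_eq_empty.1 this
  refine subset_antisymm ?_ ?_
  · have := interior_maximal hsub1 ho
    rwa [interior_closedBall _ one_ne_zero] at this
  · have := interior_maximal hsub2 Metric.isOpen_ball
    rwa [hconv.interior_closure_eq_interior_of_nonempty_interior hne, ho.interior_eq] at this

end RieszIsoperimetric

namespace RieszIsoperimetric

open Real Set Filter Topology

/-! ### The constants -/

lemma volume_ball_ne_top : volume (Metric.ball (0 : Plane) 1) ≠ ⊤ := by
  rw [isAdmissible_ball.volume_eq]; exact ENNReal.ofReal_ne_top

lemma rieszEnergy_ne_top {α : ℝ} (hα0 : 0 < α) (hα1 : α < 1) {F : Set Plane}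
    (hF : volume F ≠ ⊤) : rieszEnergy α F ≠ ⊤ :=
  (interaction_lt_top hα0 (by linarith) hF.lt_top hF.lt_top).ne

lemma pi_sq_div_rpow_le_rieszEnergy {α : ℝ} (hα0 : 0 < α) (hα1 : α < 1) {F : Set Plane}
    (hF : MeasurableSet F) (hvol : volume F = ENNReal.ofReal π) {d : ℝ} (hd0 : 0 < d)
    (hd : ∀ x ∈ F, ∀ y ∈ F, ‖x - y‖ ≤ d) : π ^ 2 / d ^ α ≤ (rieszEnergy α F).toReal := by
  have h := le_rieszEnergy hα0 hF hd
  have hne := rieszEnergy_ne_top hα0 hα1 (F := F) (by rw [hvol]; exact ENNReal.ofReal_ne_top)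
  have hpi := Real.pi_pos
  rw [hvol, ← ENNReal.ofReal_mul (by positivity), ← ENNReal.ofReal_mul (by positivity),
    ENNReal.ofReal_le_iff_le_toReal hne] at h
  refine le_trans (le_of_eq ?_) h
  ring

lemma pi_rpow_le_V₀ {α : ℝ} (hα0 : 0 < α) (hα1 : α < 1) : π ^ (2 - α) ≤ V₀ α := by
  have h := pi_sq_div_rpow_le_rieszEnergy hα0 hα1 measurableSet_ball isAdmissible_ball.volume_eq
    (d := 2) two_pos (fun x hx y hy => by
      rw [mem_ball_zero_iff] at hx hy
      linarith [norm_sub_le x y])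
  refine le_trans ?_ h
  rw [rpow_sub Real.pi_pos, rpow_two]
  gcongr
  exact two_le_pi

lemma V₀_pos {α : ℝ} (hα0 : 0 < α) (hα1 : α < 1) : 0 < V₀ α :=
  (rpow_pos_of_pos Real.pi_pos _).trans_le (pi_rpow_le_V₀ hα0 hα1)

lemma C₀_mono {α : ℝ} (hα0 : 0 < α) (hα1 : α < 1) {ε ε' : ℝ} (hε : 0 ≤ ε) (h : ε ≤ ε') :
    C₀ α ε ≤ C₀ α ε' := by
  have hV := V₀_pos hα0 hα1
  have hpi := Real.pi_pos
  have hle := pi_rpow_le_V₀ hα0 hα1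
  have h1 : (1 : ℝ) ≤ (1 + ε / (2 * π) * V₀ α) ^ α := by
    refine one_le_rpow ?_ hα0.le
    have : 0 ≤ ε / (2 * π) * V₀ α := by positivity
    linarith
  have h2 : π ^ (2 - α) / (1 + ε / (2 * π) * V₀ α) ^ α ≤ π ^ (2 - α) :=
    div_le_self (by positivity) h1
  have h3 : 0 ≤ ε' / (2 * π) := by have := hε.trans h; positivity
  unfold C₀
  refine mul_le_mul (by gcongr) ?_ (by linarith) h3
  gcongr

lemma C₀_zero (α : ℝ) : C₀ α 0 = 0 := by simp [C₀]

lemma C₀_nonneg {α : ℝ} (hα0 : 0 < α) (hα1 : α < 1) {ε : ℝ} (hε : 0 ≤ ε) : 0 ≤ C₀ α ε := by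
  rw [← C₀_zero α]; exact C₀_mono hα0 hα1 le_rfl hε

lemma continuousOn_C₀ {α : ℝ} (hα0 : 0 < α) (hα1 : α < 1) : ContinuousOn (C₀ α) (Ici 0) := by
  have hV := V₀_pos hα0 hα1
  have hpi := Real.pi_pos
  have hb : ∀ ε ∈ Ici (0 : ℝ), 0 < 1 + ε / (2 * π) * V₀ α := fun ε hε => by
    have : 0 ≤ ε := hε
    positivity
  unfold C₀
  refine ContinuousOn.mul (by fun_prop) (ContinuousOn.sub continuousOn_const
    (ContinuousOn.div continuousOn_const ?_ fun ε hε => (rpow_pos_of_pos (hb ε hε) _).ne'))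
  exact ContinuousOn.rpow_const (by fun_prop) fun ε hε => Or.inl (hb ε hε).ne'

/-- `C₃` is nondecreasing in `C₀ * (C₀ + 2)`, with the factor `π L`. -/
lemma C₃_eq (α ε : ℝ) : C₃ α ε
    = π * diskLipschitz α * (1 + 2 / 3 * √(π * (C₀ α ε * (C₀ α ε + 2)))) := by
  unfold C₃ diskLipschitz
  rw [mul_assoc π (C₀ α ε)]
  ring

lemma C₀_mul_mono {α : ℝ} (hα0 : 0 < α) (hα1 : α < 1) {ε ε' : ℝ} (hε : 0 ≤ ε) (h : ε ≤ ε') :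
    C₀ α ε * (C₀ α ε + 2) ≤ C₀ α ε' * (C₀ α ε' + 2) := by
  have h1 := C₀_nonneg hα0 hα1 hε
  have h2 := C₀_mono hα0 hα1 hε h
  gcongr
  linarith

lemma C₃_mono {α : ℝ} (hα0 : 0 < α) (hα1 : α < 1) {ε ε' : ℝ} (hε : 0 ≤ ε) (h : ε ≤ ε') :
    C₃ α ε ≤ C₃ α ε' := by
  have hL := diskLipschitz_pos hα0 hα1
  have hpi := Real.pi_pos
  have := C₀_mul_mono hα0 hα1 hε h
  rw [C₃_eq, C₃_eq]
  gcongr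

lemma le_C₃ {α : ℝ} (hα0 : 0 < α) (hα1 : α < 1) (ε : ℝ) : π * diskLipschitz α ≤ C₃ α ε := by
  have hL := diskLipschitz_pos hα0 hα1
  have hpi := Real.pi_pos
  rw [C₃_eq]
  refine le_mul_of_one_le_right (by positivity) ?_
  have := sqrt_nonneg (π * (C₀ α ε * (C₀ α ε + 2)))
  linarith

lemma C₃_pos {α : ℝ} (hα0 : 0 < α) (hα1 : α < 1) (ε : ℝ) : 0 < C₃ α ε :=
  (mul_pos Real.pi_pos (diskLipschitz_pos hα0 hα1)).trans_le (le_C₃ hα0 hα1 ε)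

/-- The function of `ε` whose unit level defines the threshold `ε₁`. -/
noncomputable def threshold (α ε : ℝ) : ℝ :=
  ε * C₃ α ε * (ε * C₃ α ε * C₀ α ε * (C₀ α ε + 2) + 2)

lemma threshold_strictMonoOn {α : ℝ} (hα0 : 0 < α) (hα1 : α < 1) :
    StrictMonoOn (threshold α) (Ici 0) := by
  intro ε hε ε' hε' h
  have hε0 : 0 ≤ ε := hε
  have h1 := C₀_mul_mono hα0 hα1 hε0 h.le
  have h0 : 0 ≤ C₀ α ε * (C₀ α ε + 2) := by
    have := C₀_nonneg hα0 hα1 hε0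
    positivity
  have h2 : ε * C₃ α ε < ε' * C₃ α ε' :=
    mul_lt_mul h (C₃_mono hα0 hα1 hε0 h.le) (C₃_pos hα0 hα1 ε) (hε0.trans h.le)
  have h3 : 0 ≤ ε * C₃ α ε := mul_nonneg hε0 (C₃_pos hα0 hα1 ε).le
  unfold threshold
  rw [mul_assoc (ε * C₃ α ε) (C₀ α ε), mul_assoc (ε' * C₃ α ε') (C₀ α ε')]
  have h4 := h3.trans h2.le
  refine mul_lt_mul h2 ?_ (by positivity) h4
  gcongr

lemma continuousOn_threshold {α : ℝ} (hα0 : 0 < α) (hα1 : α < 1) :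
    ContinuousOn (threshold α) (Ici 0) := by
  have h0 := continuousOn_C₀ hα0 hα1
  have h3 : ContinuousOn (C₃ α) (Ici 0) := by
    have : C₃ α = fun ε =>
      π * diskLipschitz α * (1 + 2 / 3 * √(π * (C₀ α ε * (C₀ α ε + 2)))) := funext (C₃_eq α)
    rw [this]
    fun_prop
  unfold threshold
  fun_prop

/-- Existence by the intermediate value theorem: `C₃ ≥ π L`, so the threshold function is at
least `1` at `ε = (π L)⁻¹`. -/
lemma exists_threshold_eq_one {α : ℝ} (hα0 : 0 < α) (hα1 : α < 1) :
    ∃ ε₁ : ℝ, 0 < ε₁ ∧ threshold α ε₁ = 1 := by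
  have hc : 0 < π * diskLipschitz α := mul_pos Real.pi_pos (diskLipschitz_pos hα0 hα1)
  set M := (π * diskLipschitz α)⁻¹ with hM
  have hM0 : 0 < M := by positivity
  have hzero : threshold α 0 = 0 := by simp [threshold]
  have hbig : 1 ≤ threshold α M := by
    have h0 := C₀_nonneg hα0 hα1 hM0.le
    have h1 : 1 ≤ M * C₃ α M := by
      calc 1 = M * (π * diskLipschitz α) := by rw [hM, inv_mul_cancel₀ hc.ne']
        _ ≤ _ := by gcongr; exact le_C₃ hα0 hα1 M
    have h2 : 0 ≤ M * C₃ α M * C₀ α M * (C₀ α M + 2) := by positivity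
    unfold threshold
    nlinarith
  obtain ⟨ε₁, hε₁, h⟩ := intermediate_value_Icc hM0.le
    ((continuousOn_threshold hα0 hα1).mono Icc_subset_Ici_self)
    (show (1 : ℝ) ∈ Icc (threshold α 0) (threshold α M) from ⟨by rw [hzero]; norm_num, hbig⟩)
  refine ⟨ε₁, lt_of_le_of_ne hε₁.1 fun h0 => ?_, h⟩
  rw [← h0, hzero] at h
  norm_num at h

/-! ### Convex minimizers -/

/-- The diameter is at most half the perimeter: the integral over all directions of the width
`supportFn Ω θ + supportFn Ω (θ + π)` is at most twice the perimeter, while a segment of length `d`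
forces it to be at least `4 d`. -/
lemma norm_sub_le_half_perimeter {Ω : Set Plane} (ho : IsOpen Ω) (hb : Bornology.IsBounded Ω)
    (hconv : Convex ℝ Ω) (hP : perimeter Ω ≠ ⊤) {x y : Plane} (hx : x ∈ Ω) (hy : y ∈ Ω) :
    ‖x - y‖ ≤ (perimeter Ω).toReal / 2 := by
  have hne : Ω.Nonempty := ⟨x, hx⟩
  have hh := integral_supportFn_le_perimeter ho hb hne hconv hP
  have hcont := continuous_supportFn hb hne
  have hpi := Real.pi_pos
  obtain ⟨φ, hφ⟩ := exists_eq_smul_dir (x - y)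
  have h1 : ∀ θ, ‖x - y‖ * |cos (φ - θ)| ≤ supportFn Ω θ + supportFn Ω (θ + π) := by
    intro θ
    have h2 : ‖x - y‖ * |cos (φ - θ)| = |inner ℝ (x - y) (dir θ)| := by
      conv_rhs => rw [hφ]
      rw [inner_smul_left, inner_dir_dir, abs_mul]
      simp
    rw [h2, inner_sub_left, abs_le]
    have a1 := inner_le_supportFn hb hx θ
    have a2 := inner_le_supportFn hb hy θ
    have a3 := inner_le_supportFn hb hx (θ + π)
    have a4 := inner_le_supportFn hb hy (θ + π)
    rw [dir_add_pi, inner_neg_right] at a3 a4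
    constructor <;> linarith
  have hshift : ∫ θ in (0 : ℝ)..2 * π, supportFn Ω (θ + π)
      = ∫ θ in (0 : ℝ)..2 * π, supportFn Ω θ := by
    have hper : Function.Periodic (supportFn Ω) (2 * π) := supportFn_add_two_pi Ω
    rw [intervalIntegral.integral_comp_add_right (supportFn Ω) π]
    have := hper.intervalIntegral_add_eq (0 + π) 0
    rwa [show 0 + π + 2 * π = 2 * π + π by ring, zero_add (2 * π)] at this
  have h3 := intervalIntegral.integral_mono (μ := volume) (a := 0) (b := 2 * π) (by linarith)
    (Continuous.intervalIntegrable (by fun_prop) _ _)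
    (Continuous.intervalIntegrable (by fun_prop) _ _) h1
  rw [intervalIntegral.integral_const_mul, integral_abs_cos_sub,
    intervalIntegral.integral_add (Continuous.intervalIntegrable (by fun_prop) _ _)
      (Continuous.intervalIntegrable (by fun_prop) _ _), hshift] at h3
  linarith

lemma cubicBound_one : cubicBound 1 = 2 * π := by
  simp [cubicBound]

/-- The gap of `cubicBound` to its value `2 π` at `a = 1`, in terms of `X = a ^ 2 - 1`, with the
constants that enter `C₃`. With `a ≤ 1 + X / 2` and `a ≤ 1 + √X`, it reduces to the inequalities
`5 ≤ 3 π` for the coefficient of `X` and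
`4 + 8 π / (3 √3) ≤ 2 π √π` for that of `X √X`. -/
lemma cubicBound_le {a : ℝ} (ha : 1 ≤ a) : cubicBound a
    ≤ 2 * π + 3 * π ^ 2 * (a ^ 2 - 1) * (1 + 2 / 3 * √(π * (a ^ 2 - 1))) := by
  have hX : 0 ≤ a ^ 2 - 1 := by nlinarith
  have hpi := pi_gt_d2
  set s := √(a ^ 2 - 1) with hs
  have hs0 : 0 ≤ s := sqrt_nonneg _
  have hs2 : s * s = a ^ 2 - 1 := mul_self_sqrt hX
  have h3 : √((a ^ 2 - 1) / 3) ≤ 3 / 5 * s := by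
    rw [sqrt_le_left (by positivity)]
    nlinarith
  have hpi' : (17 / 10 : ℝ) ≤ √π := by
    rw [le_sqrt' (by norm_num)]
    linarith
  have h4 : 17 / 10 * s ≤ √(π * (a ^ 2 - 1)) := by
    rw [sqrt_mul Real.pi_pos.le]
    gcongr
  have ha1 : a ≤ 1 + (a ^ 2 - 1) / 2 := by nlinarith [sq_nonneg (a - 1)]
  have ha2 : a ≤ 1 + s := by nlinarith
  have hXs : 0 ≤ (a ^ 2 - 1) * s := mul_nonneg hX hs0
  unfold cubicBound
  have e1 : 8 * π ^ 2 / 3 * √((a ^ 2 - 1) / 3) * (a ^ 2 - 1)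
      ≤ 8 * π ^ 2 / 3 * (3 / 5 * s) * (a ^ 2 - 1) := by gcongr
  have e2 : 3 * π ^ 2 * (a ^ 2 - 1) * (1 + 2 / 3 * (17 / 10 * s))
      ≤ 3 * π ^ 2 * (a ^ 2 - 1) * (1 + 2 / 3 * √(π * (a ^ 2 - 1))) := by gcongr
  have e3 : a * (a ^ 2 - 1) ≤ (1 + s) * (a ^ 2 - 1) := by gcongr
  have e4 : 2 * π * a ^ 3 + 2 * π * a * (a ^ 2 - 1)
      ≤ 2 * π + π * (5 * (a ^ 2 - 1) + 4 * ((a ^ 2 - 1) * s)) := by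
    have : 2 * a ^ 3 + 2 * (a * (a ^ 2 - 1)) ≤ 2 + (5 * (a ^ 2 - 1) + 4 * ((a ^ 2 - 1) * s)) := by
      nlinarith
    nlinarith
  have e5 : π * (5 * (a ^ 2 - 1) + 4 * ((a ^ 2 - 1) * s))
      ≤ π * (π * (3 * (a ^ 2 - 1) + 9 / 5 * ((a ^ 2 - 1) * s))) := by
    refine mul_le_mul_of_nonneg_left ?_ Real.pi_pos.le
    nlinarith
  nlinarith

/-- The algebra behind the threshold: a deficit `D > 0` with `D ≤ κ X`, `X = D (D + 2) ≤ X₀`,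
satisfies `X ≤ (κ X) ^ 2 + 2 κ X`, so `1 ≤ κ (κ X₀ + 2)`. -/
lemma eq_zero_of_le_mul_sq {D κ X₀ : ℝ} (hD : 0 ≤ D) (hκ : 0 ≤ κ) (hX : D * (D + 2) ≤ X₀)
    (h : D ≤ κ * (D * (D + 2))) (hlt : κ * (κ * X₀ + 2) < 1) : D = 0 := by
  by_contra hne
  have hpos : 0 < D := lt_of_le_of_ne hD (Ne.symm hne)
  have hXpos : 0 < D * (D + 2) := by positivity
  have h1 : D * (D + 2) ≤ (κ * (D * (D + 2))) * (κ * (D * (D + 2)) + 2) := by gcongr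
  have h2 : 1 ≤ κ * (κ * (D * (D + 2)) + 2) := by
    refine le_of_mul_le_mul_right ?_ hXpos
    linarith
  have h3 : κ * (κ * (D * (D + 2)) + 2) ≤ κ * (κ * X₀ + 2) := by gcongr
  linarith

/-- Convex minimizers below the threshold are unit disks. -/
theorem IsMinimizer.eq_ball {α ε : ℝ} (hα0 : 0 < α) (hα1 : α < 1) (hε : 0 < ε)
    (hlt : threshold α ε < 1) {Ω : Set Plane} (hΩ : IsMinimizer α ε Ω) (hconv : Convex ℝ Ω) :
    ∃ x₀ : Plane, Ω = Metric.ball x₀ 1 := by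
  obtain ⟨⟨ho, hb, -, hvol⟩, hmin⟩ := hΩ
  have hpi := Real.pi_pos
  have hL := diskLipschitz_pos hα0 hα1
  have hVB := rieszEnergy_ne_top hα0 hα1 volume_ball_ne_top
  have hVΩ := rieszEnergy_ne_top hα0 hα1 (F := Ω) (by rw [hvol]; exact ENNReal.ofReal_ne_top)
  -- the disk is a competitor
  have hE : perimeter Ω + ENNReal.ofReal ε * rieszEnergy α Ω
      ≤ ENNReal.ofReal (2 * π) + ENNReal.ofReal ε * rieszEnergy α (Metric.ball 0 1) :=
    (hmin _ isAdmissible_ball).trans (add_le_add perimeter_ball_le le_rfl)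
  have hrhs : ENNReal.ofReal (2 * π) + ENNReal.ofReal ε * rieszEnergy α (Metric.ball 0 1) ≠ ⊤ :=
    ENNReal.add_ne_top.2 ⟨ENNReal.ofReal_ne_top, ENNReal.mul_ne_top ENNReal.ofReal_ne_top hVB⟩
  have hP : perimeter Ω ≠ ⊤ := ne_top_of_le_ne_top hrhs (le_self_add.trans hE)
  have hEr : (perimeter Ω).toReal + ε * (rieszEnergy α Ω).toReal ≤ 2 * π + ε * V₀ α := by
    have := ENNReal.toReal_mono hrhs hE
    rwa [ENNReal.toReal_add hP (ENNReal.mul_ne_top ENNReal.ofReal_ne_top hVΩ),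
      ENNReal.toReal_add ENNReal.ofReal_ne_top (ENNReal.mul_ne_top ENNReal.ofReal_ne_top hVB),
      ENNReal.toReal_mul, ENNReal.toReal_mul, ENNReal.toReal_ofReal hε.le,
      ENNReal.toReal_ofReal (by positivity)] at this
  obtain ⟨ha, x₀, hx₀⟩ := exists_lintegral_norm_sub_le ho hb hconv hvol hP
  set P := (perimeter Ω).toReal with hPdef
  set VΩ := (rieszEnergy α Ω).toReal with hVdef
  set a := P / (2 * π) with hadef
  have hPa : P = 2 * π * a := by rw [hadef]; field_simp
  have hV0 := V₀_pos hα0 hα1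
  have hVΩ0 : 0 ≤ VΩ := ENNReal.toReal_nonneg
  -- the energy of `Ω` is bounded below through its diameter, which is at most half its perimeter
  have hdef : a - 1 ≤ ε / (2 * π) * (V₀ α - VΩ) := by
    rw [div_mul_eq_mul_div, le_div_iff₀ (by positivity)]
    nlinarith
  have hC₀ : a - 1 ≤ C₀ α ε := by
    refine hdef.trans ?_
    unfold C₀
    have hdiam : ∀ x ∈ Ω, ∀ y ∈ Ω, ‖x - y‖ ≤ π * (1 + ε / (2 * π) * V₀ α) := by
      intro x hx y hy
      refine (norm_sub_le_half_perimeter ho hb hconv hP hx hy).trans ?_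
      have : π * (1 + ε / (2 * π) * V₀ α) = (2 * π + ε * V₀ α) / 2 := by
        field_simp
      rw [this]
      have := mul_nonneg hε.le hVΩ0
      linarith
    have h1 := pi_sq_div_rpow_le_rieszEnergy hα0 hα1 ho.measurableSet hvol (by positivity) hdiam
    have h2 : π ^ (2 - α) / (1 + ε / (2 * π) * V₀ α) ^ α
        = π ^ 2 / (π * (1 + ε / (2 * π) * V₀ α)) ^ α := by
      rw [mul_rpow hpi.le (by positivity), rpow_sub hpi, rpow_two]
      field_simp
    rw [h2]
    gcongr
  -- the gap in energy is bounded through the gap in first moments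
  have hgap : V₀ α - VΩ ≤ 2 * diskLipschitz α * (1 / 3 * cubicBound a - 2 * π / 3) := by
    have hcb : 0 ≤ 1 / 3 * cubicBound a := by
      have := cubicBound_mono le_rfl ha
      rw [cubicBound_one] at this
      linarith
    have h1 := (rieszEnergy_ball_add_le hα0 hα1 ho.measurableSet hvol x₀).trans
      (add_le_add le_rfl (mul_le_mul' le_rfl hx₀))
    rw [← ENNReal.ofReal_mul (by positivity)] at h1
    have h2 := ENNReal.toReal_mono (ENNReal.add_ne_top.2 ⟨hVΩ, ENNReal.ofReal_ne_top⟩) h1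
    rw [ENNReal.toReal_add hVB ENNReal.ofReal_ne_top, ENNReal.toReal_add hVΩ ENNReal.ofReal_ne_top,
      ENNReal.toReal_ofReal (by positivity), ENNReal.toReal_ofReal (by positivity)] at h2
    change V₀ α + _ ≤ VΩ + _ at h2
    linarith
  have hX0 : (a - 1) * (a - 1 + 2) ≤ C₀ α ε * (C₀ α ε + 2) := by
    have h0 : 0 ≤ a - 1 := by linarith
    have h1 := h0.trans hC₀
    gcongr
  have hXeq : a ^ 2 - 1 = (a - 1) * (a - 1 + 2) := by ring
  have hD : a - 1 ≤ ε * C₃ α ε * ((a - 1) * (a - 1 + 2)) := by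
    have h1 := cubicBound_le ha
    rw [hXeq] at h1
    set X := (a - 1) * (a - 1 + 2) with hX
    have hXnn : 0 ≤ X := by
      have h0 : 0 ≤ a - 1 := by linarith
      positivity
    calc a - 1 ≤ ε / (2 * π) * (V₀ α - VΩ) := hdef
      _ ≤ ε / (2 * π) * (2 * diskLipschitz α * (π ^ 2 * X * (1 + 2 / 3 * √(π * X)))) := by
          gcongr
          refine hgap.trans ?_
          gcongr
          linarith
      _ = ε * (π * diskLipschitz α * (1 + 2 / 3 * √(π * X))) * X := by
          field_simp
      _ ≤ ε * C₃ α ε * X := by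
          rw [C₃_eq]
          gcongr
  have hzero := eq_zero_of_le_mul_sq (by linarith)
    (mul_nonneg hε.le (C₃_pos hα0 hα1 ε).le) hX0 hD (by
      rw [← mul_assoc (ε * C₃ α ε) (C₀ α ε)]; exact hlt)
  have ha1 : a = 1 := by linarith
  refine ⟨x₀, eq_ball_of_lintegral_norm_sub_le ho hconv hvol (hx₀.trans (le_of_eq ?_))⟩
  rw [ha1, cubicBound_one]
  congr 1
  ring

end RieszIsoperimetric

theorem proposition5p5 (α : ℝ) (hα0 : 0 < α) (hα1 : α < 1) :
    ∃ ε₁ : ℝ,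
      (0 < ε₁ ∧
        ε₁ * RieszIsoperimetric.C₃ α ε₁ *
          (ε₁ * RieszIsoperimetric.C₃ α ε₁ * RieszIsoperimetric.C₀ α ε₁ *
            (RieszIsoperimetric.C₀ α ε₁ + 2) + 2) = 1) ∧
      (∀ ε : ℝ, 0 < ε →
        ε * RieszIsoperimetric.C₃ α ε *
          (ε * RieszIsoperimetric.C₃ α ε * RieszIsoperimetric.C₀ α ε *
            (RieszIsoperimetric.C₀ α ε + 2) + 2) = 1 → ε = ε₁) ∧
      ∀ ε : ℝ, 0 < ε → ε < ε₁ →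
        ∀ Ω : Set RieszIsoperimetric.Plane, RieszIsoperimetric.IsMinimizer α ε Ω →
          Convex ℝ Ω → ∃ x₀ : RieszIsoperimetric.Plane, Ω = Metric.ball x₀ 1 := by
  obtain ⟨ε₁, hpos, h1⟩ := RieszIsoperimetric.exists_threshold_eq_one hα0 hα1
  have hmono := RieszIsoperimetric.threshold_strictMonoOn hα0 hα1
  refine ⟨ε₁, ⟨hpos, h1⟩, fun ε hε h => ?_, fun ε hε hlt Ω hΩ hconv => ?_⟩
  · exact hmono.injOn (Set.mem_Ici.2 hε.le) (Set.mem_Ici.2 hpos.le) (h.trans h1.symm)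
  · refine hΩ.eq_ball hα0 hα1 hε ?_ hconv
    rw [← h1]
    exact hmono (Set.mem_Ici.2 hε.le) (Set.mem_Ici.2 hpos.le) hlt
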